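/- **Setting.** Let $n\in\mathbb N$ and let $\bigwedge V$ be the complex Grassmann algebra generated by fields $\psi_1,\dots,\psi_{2n}$. Every $f\in\bigwedge V$ is written uniquely as $f=\sum_{J\subset\{1,\dots,2n\}}\zeta_J(f)\Psi_J$ with $\Psi_J=\psi_{i_1}\wedge\cdots\wedge\psi_{i_p}$ for $J=\{i_1<\dots<i_p\}$, and $f$ is even if $\zeta_J(f)=0$ whenever $|J|$ is odd. For $m\ge 1$ the norm coefficients of $f$ are $$f_m:=\sup_{1\le i\le 2n}\frac1{2m}\sum_{J\ni i,\ |J|=2m}|\zeta_J(f)| ,$$ and $\|A\|:=\sup_i\sum_j|A_{ij}|$ for a $2n\times 2n$ matrix $A$. For $g=g_0+g_1\in\bigwedge V$, with $g_0$ the constant term of $g$, functions such as $e^g$ and $\log g$ are defined by the Taylor series in the nilpotent $g_1$ around $g_0$. For a skew-symmetric matrix $A\in M_{2n}(\mathbb C)$, $\mathbb E_{\mu_A}$ is the linear functional on $\bigwedge V$ with $\mathbb E_{\mu_A}[\Psi_J]=\operatorname{Pf}\big((A_{ij})_{i,j\in J}\big)$ (zero for $|J|$ odd), and $(\mu_A*f)(\Psi):=\int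 f(\Psi+\Theta)\,d\mu_A(\Theta)$. Let $T\ge 0$ and, for $\tau\in[0,T]$, let $\dot C(\tau)=\dot C^+(\tau)-\dot C^-(\tau)$ be a symmetric matrix, where $\dot C^\pm(\tau)\in M_n(\mathbb C)$ are positive semidefinite with entries integrable on $[0,T]$. Put $$\dot A(\tau)=\begin{pmatrix}0&\dot C(\tau)\\-\dot C(\tau)&0\end{pmatrix},\qquad A(t)=\int_0^t\dot A(\tau)\,d\tau,\qquad \sigma_{(s,t)}:=\Big(\int_s^t 4\max_{\pm,\,1\le i\le n}\dot C^{\pm}_{ii}(\tau)\,d\tau\Big)^{1/2}.$$ Let $f\in\bigwedge V$ be even (the bare action), with $\mathbb E_{\mu_{A(s)}}[e^{-f}]\ne 0$ for all $s\in[0,T]$, and let $$F(t,\Psi):=-\log\frac{(\mu_{A(t)}*e^{-f})(\Psi)}{\mathbb E_{\mu_{A(t)}}[e^{-f}]}$$ be the normalized effective action. Denote by $F_m(t)$ the norm coefficients of $F(t,\cdot)$ and by $F_m^0$ those of the bare action $f$. **Proposition.** For every $t\in[0,T]$ and every integer $k\ge 1$, the integrand below is integrable on $[0,t]$ and $$F_k(t)\le\sum_{m=k}^{n}F_m^0\binom{2m}{2k}\sigma_{(0,t)}^{2(m-k)}+\frac12\int_0^t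 ds\,\|\dot A(s)\|\sum_{\substack{1\le l,m\le n\\ l+m\ge k+1}}F_l(s)F_m(s)\,\Gamma_{l,m}(\sigma_{(s,t)}),$$ where $$\Gamma_{l,m}(\xi):=4lm\sum_{\substack{k',k''\ \mathrm{odd}\\ k'+k''=2k}}\binom{2l-1}{k'}\xi^{2l-1-k'}\binom{2m-1}{k''}\xi^{2m-1-k''}$$ (binomial coefficients with $k'>2l-1$ or $k''>2m-1$ are zero). -/

import Mathlib

open scoped ComplexOrder

noncomputable section

namespace GrassmannRG

/-! ### Grassmann algebras with a finite, linearly ordered set of generators -/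

/-- The complex Grassmann algebra `⋀V`, where `V` has the basis `(ψ i)` indexed by `I`. -/
abbrev Grassmann (I : Type) : Type := ExteriorAlgebra ℂ (I → ℂ)

section Algebra

variable {I : Type} [Fintype I] [LinearOrder I]

/-- The monomials `Ψ_J = ψ_{i₁} ∧ ⋯ ∧ ψ_{i_p}`, for `J = {i₁ < ⋯ < i_p}`, as a basis of `⋀V`. -/
def monomialBasis (I : Type) [Fintype I] [LinearOrder I] :
    Module.Basis (Finset I) ℂ (Grassmann I) :=
  (Pi.basisFun ℂ I).ExteriorAlgebra

/-- The monomial `Ψ_J`. -/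
def monomial (J : Finset I) : Grassmann I := monomialBasis I J

/-- The coefficient `ζ_J` in the expansion `f = ∑_J ζ_J Ψ_J`. -/
def coeff (J : Finset I) (f : Grassmann I) : ℂ := (monomialBasis I).repr f J

/-- `f` is even: its coefficients of odd degree vanish. -/
def IsEven (f : Grassmann I) : Prop := ∀ J : Finset I, Odd J.card → coeff J f = 0

/-- The function `G` applied to `f = f₀ + f₁`, with `f₀` scalar and `f₁` without constant term:
`G(f) = ∑_k G⁽ᵏ⁾(f₀) / k! • f₁ ^ k`. The sum is finite as `f₁ ^ k = 0` for `k > |I|`. -/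
def applyFun (G : ℂ → ℂ) (f : Grassmann I) : Grassmann I :=
  ∑ k ∈ Finset.range (Fintype.card I + 1),
    (iteratedDeriv k G (coeff ∅ f) / (k.factorial : ℂ)) •
      (f - algebraMap ℂ (Grassmann I) (coeff ∅ f)) ^ k

/-- The exponential in the Grassmann algebra. -/
def gexp (f : Grassmann I) : Grassmann I := applyFun Complex.exp f

/-- The logarithm in the Grassmann algebra. -/
def glog (f : Grassmann I) : Grassmann I := applyFun Complex.log f

/-! ### Grassmann Gaussian integrals -/

/-- The Pfaffian of a `p × p` matrix: with `p = 2q` it is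
`1 / (2 ^ q q!) ∑_σ sgn σ ∏_{r < q} M (σ (2r)) (σ (2r+1))`, and it is zero for odd `p`. -/
def pfaffian {p : ℕ} (M : Matrix (Fin p) (Fin p) ℂ) : ℂ :=
  if Even p then
    (1 / ((2 : ℂ) ^ (p / 2) * ((p / 2).factorial : ℂ))) *
      ∑ σ : Equiv.Perm (Fin p), ((Equiv.Perm.sign σ : ℤ) : ℂ) *
        ∏ r : Fin (p / 2), M (σ ⟨2 * r.1, by omega⟩) (σ ⟨2 * r.1 + 1, by omega⟩)
  else 0

/-- The Pfaffian of the submatrix of `A` with rows and columns `J`, in increasing order. -/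
def pfaffianOn (A : Matrix I I ℂ) (J : Finset I) : ℂ :=
  pfaffian (A.submatrix (J.orderEmbOfFin rfl) (J.orderEmbOfFin rfl))

/-- The Grassmann Gaussian integral `𝔼_{μ_A}[f]`: the linear functional with
`𝔼_{μ_A}[Ψ_J] = Pf (A_J)`. -/
def expectation (A : Matrix I I ℂ) (f : Grassmann I) : ℂ :=
  ∑ J : Finset I, coeff J f * pfaffianOn A J

/-- The substitution `f(Ψ) ↦ f(Ψ + Θ)`, the algebra map with `ψ i ↦ ψ i + θ i`. In the target,
`ψ i` and `θ i` are the generators with the indices `inl i` and `inr i`. -/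
def translate (f : Grassmann I) : Grassmann (I ⊕ₗ I) :=
  ExteriorAlgebra.map
    (LinearMap.funLeft ℂ ℂ (fun x : I ⊕ₗ I => Sum.elim id id (ofLex x))) f

/-- The index set of the monomial `Ψ_J ∧ Θ_K` in the variables `Ψ, Θ`. -/
def pairIndex (J K : Finset I) : Finset (I ⊕ₗ I) := (J.disjSum K).map toLex.toEmbedding

/-- The convolution `(μ_A * f)(Ψ) = ∫ f(Ψ + Θ) dμ_A(Θ)`, the integral over `Θ` being the linear
map with `Ψ_J ∧ Θ_K ↦ Pf (A_K) Ψ_J`. -/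
def convolve (A : Matrix I I ℂ) (f : Grassmann I) : Grassmann I :=
  ∑ J : Finset I, ∑ K : Finset I,
    (coeff (pairIndex J K) (translate f) * pfaffianOn A K) • monomial J

/-! ### Norms -/

/-- The norm coefficient `f_m = sup_i 1/(2m) ∑_{J ∋ i, |J| = 2m} |ζ_J|`, for `m ≥ 1`. -/
def normCoeff (m : ℕ) (f : Grassmann I) : ℝ :=
  ⨆ i : I, (1 / (2 * (m : ℝ))) *
    ∑ J : Finset I with i ∈ J ∧ J.card = 2 * m, ‖coeff J f‖

/-- The norm `‖A‖_{1,∞} = sup_i ∑_j |A_ij|`. -/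
def normOneInf (A : Matrix I I ℂ) : ℝ := ⨆ i : I, ∑ j : I, ‖A i j‖

/-! ### The effective action -/

/-- `A(t) = ∫_0^t Ȧ(τ) dτ`, entrywise. -/
def cumulative (Adot : ℝ → Matrix I I ℂ) (t : ℝ) : Matrix I I ℂ :=
  fun i j => ∫ τ in (0 : ℝ)..t, Adot τ i j

/-- The normalized effective action
`F(t) = - log (μ_{A(t)} * e^{-f} / 𝔼_{μ_{A(t)}}[e^{-f}])`. -/
def effectiveAction (Adot : ℝ → Matrix I I ℂ) (f : Grassmann I) (t : ℝ) : Grassmann I :=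
  -glog ((expectation (cumulative Adot t) (gexp (-f)))⁻¹ •
    convolve (cumulative Adot t) (gexp (-f)))

end Algebra

/-! ### Covariances in block form -/

/-- The index set `{1, …, 2n}` of the fields, split in two blocks of size `n`. -/
abbrev Index (n : ℕ) : Type := Fin n ⊕ₗ Fin n

/-- The block matrix with rows `(0, C)` and `(-C, 0)`. -/
def blockCov {n : ℕ} (C : Matrix (Fin n) (Fin n) ℂ) : Matrix (Index n) (Index n) ℂ :=
  (Matrix.fromBlocks 0 C (-C) 0).submatrix ofLex ofLex

/-- `σ_{(s,t)}`, the square root of `∫_s^t 4 max_{±, i} Ċ^±_ii(τ) dτ`. -/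
def sigma {n : ℕ} (Cp Cm : ℝ → Matrix (Fin n) (Fin n) ℂ) (s t : ℝ) : ℝ :=
  Real.sqrt (∫ τ in s..t, 4 * ⨆ i : Fin n, max (Cp τ i i).re (Cm τ i i).re)

/-- `Γ_{l,m}(ξ)`, for a given `k`. -/
def Gam (k l m : ℕ) (ξ : ℝ) : ℝ :=
  4 * (l : ℝ) * (m : ℝ) *
    ∑ p ∈ Finset.HasAntidiagonal.antidiagonal (2 * k) with Odd p.1 ∧ Odd p.2,
      (((2 * l - 1).choose p.1 : ℝ) * ξ ^ (2 * l - 1 - p.1)) *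
        (((2 * m - 1).choose p.2 : ℝ) * ξ ^ (2 * m - 1 - p.2))

end GrassmannRG

end

open GrassmannRG

/-!
The convolution `f ↦ μ_A * f` is the operator `exp (½ ∑ A_ij ∂_j ∂_i)`. It is taken here as
Mathlib's change of form between Clifford algebras along an alternating form (`gauss`), which gives
integration by parts at once; `expectation_eq_constTerm` and `convolve_eq_gauss` identify it with
the Pfaffian integral and the convolution of the statement.

*Flow equation.* Along an absolutely continuous covariance, `Z(s) = μ_{A(s)} * e^{-f}` solves
`Z' = Δ Z` with `Δ = ½ ∑ Ȧ_ij ∂_j ∂_i`, so by the Hopf-Cole transformation (`lap_eq_mul`) the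
effective action solves `F' = Δ F - ½ ∑ Ȧ_ij ∂_j F ∂_i F + scalar`. Duhamel's formula
(`effectiveAction_duhamel`) is then the fundamental theorem of calculus for
`s ↦ μ_{A(t) - A(s)} * F(s)`; the entries of `Ȧ` being only integrable, all derivatives exist almost
everywhere, and the calculus is that of absolutely continuous functions, coefficient by coefficient.

*Gram bound.* `A(t) - A(s)` is again a block covariance, of a difference `P - M` of positive
semidefinite matrices. The Gaussian integral of a monomial with fields `J` in the first and `K` in
the second block is, up to sign, a minor of `P - M`, and it vanishes for `|J| ≠ |K|`. As `P - M` is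
the Gram matrix of the vectors `(x_a, y_a)` and `(x_b, -y_b)`, the minor is at most
`(σ² / 2) ^ |J|` (`norm_constTerm_gauss_pairIndex_le`).

*Counting.* In the linear term all subsets of contracted legs are counted, which gives `C(2m, 2k)`
(`normCoeff_gauss_le`). In the quadratic term two vertices with `2l` and `2m` legs are joined, and
`2N = 2(l + m - 1)` legs remain. With one external leg fixed, only the balanced subsets of the other
`2N - 1` legs contribute, and there are at most `C(N - 1, r) C(N, r)` of them with `2r` elements
(`choose_mul_choose_le`), so the quadratic term carries the combinatorial factor
`C(N, r)² (σ² / 2) ^ r`, where `N = k + r`. That only odd `k'` and `k''` enter `Γ` is accounted for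
by the inequality `C(N, r)² ≤ 2 ^ r ∑ C(2l - 1, k') C(2m - 1, k'')`, the sum being over odd `k'`,
`k''` with `k' + k'' = 2k` (`choose_mul_choose_le_Gam`): in terms of complements it counts subsets
of size `2r` that meet both parts evenly, and follows by induction on `l - m`, together with a
companion for subsets of odd size (`choose_le_evenCount`).
-/

open GrassmannRG

set_option linter.unusedSectionVars false

noncomputable section

namespace GrassmannRG

/-! ### Derivatives, constant term and parity -/

section Core

variable {I : Type} [Fintype I] [LinearOrder I]

/-- The generator `ψ i` of the Grassmann algebra. -/
def field (i : I) : Grassmann I := ExteriorAlgebra.ι ℂ (Pi.single i (1 : ℂ))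

/-- The left Grassmann derivative `∂ / ∂ψ i`. -/
def fieldDeriv (i : I) : Grassmann I →ₗ[ℂ] Grassmann I :=
  CliffordAlgebra.contractLeft (LinearMap.proj i : (I → ℂ) →ₗ[ℂ] ℂ)

/-- The constant term of an element of the Grassmann algebra. -/
def constTerm : Grassmann I →ₐ[ℂ] ℂ := ExteriorAlgebra.algebraMapInv

/-- The parity automorphism `ψ i ↦ -ψ i`. -/
def parity : Grassmann I →ₐ[ℂ] Grassmann I := CliffordAlgebra.involute

theorem fieldDeriv_ι_mul (i : I) (m : I → ℂ) (x : Grassmann I) :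
    fieldDeriv i (ExteriorAlgebra.ι ℂ m * x) =
      m i • x - ExteriorAlgebra.ι ℂ m * fieldDeriv i x :=
  CliffordAlgebra.contractLeft_ι_mul _ _ _

theorem fieldDeriv_algebraMap (i : I) (c : ℂ) :
    fieldDeriv i (algebraMap ℂ (Grassmann I) c) = 0 :=
  CliffordAlgebra.contractLeft_algebraMap _ _ _

theorem fieldDeriv_one (i : I) : fieldDeriv i (1 : Grassmann I) = 0 :=
  CliffordAlgebra.contractLeft_one _ _

theorem fieldDeriv_comm (i j : I) (x : Grassmann I) :
    fieldDeriv i (fieldDeriv j x) = -fieldDeriv j (fieldDeriv i x) :=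
  CliffordAlgebra.contractLeft_comm _ _ _

theorem contractLeft_eq_sum (d : Module.Dual ℂ (I → ℂ)) (x : Grassmann I) :
    CliffordAlgebra.contractLeft d x = ∑ j, d (Pi.single j 1) • fieldDeriv j x := by
  have hd : d = ∑ j, d (Pi.single j 1) • (LinearMap.proj j : (I → ℂ) →ₗ[ℂ] ℂ) := by
    refine LinearMap.pi_ext' fun i => LinearMap.ext_ring ?_
    simp [Pi.single_apply]
  conv_lhs => rw [hd]
  simp only [map_sum, map_smul, LinearMap.sum_apply, LinearMap.smul_apply]
  rfl

theorem constTerm_ι (m : I → ℂ) : constTerm (ExteriorAlgebra.ι ℂ m) = 0 := by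
  simp [constTerm, ExteriorAlgebra.algebraMapInv]

theorem constTerm_algebraMap (c : ℂ) : constTerm (algebraMap ℂ (Grassmann I) c) = c := by
  simp

/-- Induction on products of generators, built up from the left. -/
theorem grassmann_induction {P : Grassmann I → Prop}
    (algebraMap : ∀ c, P (algebraMap ℂ (Grassmann I) c))
    (add : ∀ x y, P x → P y → P (x + y))
    (ι_mul : ∀ x m, P x → P (ExteriorAlgebra.ι ℂ m * x)) (x : Grassmann I) : P x :=
  CliffordAlgebra.left_induction (Q := (0 : QuadraticForm ℂ (I → ℂ))) algebraMap add ι_mul x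

/-! ### Monomials -/

theorem monomial_eq_prod (J : Finset I) :
    monomial J = (List.ofFn fun a : Fin J.card => field (J.orderEmbOfFin rfl a)).prod := by
  rw [monomial, monomialBasis, ExteriorAlgebra.basis_apply_ofCard _ rfl,
    ExteriorAlgebra.ιMulti_family, ExteriorAlgebra.ιMulti_apply]
  congr 2
  funext a
  simp only [Function.comp_apply, Pi.basisFun_apply, field]
  rfl

theorem monomial_empty : monomial (∅ : Finset I) = 1 := by
  rw [monomial_eq_prod]; simp

theorem monomial_singleton (i : I) : monomial {i} = field i := by
  rw [monomial_eq_prod]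
  have : (List.ofFn fun a : Fin ({i} : Finset I).card =>
      field ((({i} : Finset I).orderEmbOfFin rfl) a)) = [field i] := by
    rw [List.ofFn_congr (Finset.card_singleton i), List.ofFn_succ, List.ofFn_zero]
    congr 2
    exact Finset.mem_singleton.mp (Finset.orderEmbOfFin_mem _ _ _)
  rw [this]; simp

theorem monomial_mul_of_not_disjoint {P Q : Finset I} (h : ¬Disjoint P Q) :
    monomial P * monomial Q = 0 :=
  ExteriorAlgebra.basis_mul_of_not_disjoint (Pi.basisFun ℂ I)
    (Set.powersetCard.ofCard (s := P) rfl) (Set.powersetCard.ofCard (s := Q) rfl) h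

/-- The constant `c` is a sign; only its modulus matters for the estimates. -/
theorem monomial_mul_of_disjoint {P Q : Finset I} (h : Disjoint P Q) :
    ∃ c : ℂ, ‖c‖ = 1 ∧ monomial P * monomial Q = c • monomial (P ∪ Q) := by
  have h1 := ExteriorAlgebra.basis_mul_of_disjoint (Pi.basisFun ℂ I)
    (Set.powersetCard.ofCard (s := P) rfl) (Set.powersetCard.ofCard (s := Q) rfl) h
  set u := Equiv.Perm.sign (Set.powersetCard.permOfDisjoint
    (s := Set.powersetCard.ofCard (s := P) rfl) (t := Set.powersetCard.ofCard (s := Q) rfl) h)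
  refine ⟨((u : ℤ) : ℂ), ?_, ?_⟩
  · rcases Int.units_eq_one_or u with hu | hu <;> simp [hu]
  · refine h1.trans ?_
    have : ((Set.powersetCard.disjUnion (s := Set.powersetCard.ofCard (s := P) rfl)
        (t := Set.powersetCard.ofCard (s := Q) rfl) h : Set.powersetCard I _) : Finset I) =
        P ∪ Q := by
      simp [Set.powersetCard.disjUnion]
    rw [this]
    rcases Int.units_eq_one_or u with hu | hu <;> simp [hu, monomial, monomialBasis]

theorem field_mul_monomial {i : I} {J : Finset I} (h : i ∉ J) :
    ∃ c : ℂ, ‖c‖ = 1 ∧ field i * monomial J = c • monomial (insert i J) := by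
  rw [← monomial_singleton, Finset.insert_eq]
  exact monomial_mul_of_disjoint (by simpa using h)

theorem monomial_eq_field_mul {i : I} {J : Finset I} (h : i ∈ J) :
    ∃ c : ℂ, ‖c‖ = 1 ∧ monomial J = c • (field i * monomial (J.erase i)) := by
  obtain ⟨c, hc, h1⟩ := field_mul_monomial (Finset.notMem_erase i J)
  have hc0 : c ≠ 0 := by rintro rfl; simp at hc
  refine ⟨c⁻¹, by simp [hc], ?_⟩
  rw [h1, Finset.insert_erase h, smul_smul, inv_mul_cancel₀ hc0, one_smul]

theorem fieldDeriv_field_mul (i j : I) (x : Grassmann I) :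
    fieldDeriv i (field j * x) = (if i = j then x else 0) - field j * fieldDeriv i x := by
  rw [field, fieldDeriv_ι_mul, Pi.single_apply]
  split_ifs <;> simp

theorem fieldDeriv_monomial_of_notMem {i : I} {J : Finset I} (h : i ∉ J) :
    fieldDeriv i (monomial J) = 0 := by
  induction J using Finset.induction_on with
  | empty => rw [monomial_empty, fieldDeriv_one]
  | insert a s ha ih =>
    obtain ⟨c, -, hc⟩ := monomial_eq_field_mul (Finset.mem_insert_self a s)
    rw [hc, map_smul, fieldDeriv_field_mul, Finset.erase_insert ha, ih (by grind), if_neg (by grind)]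
    simp

theorem fieldDeriv_monomial_of_mem {i : I} {J : Finset I} (h : i ∈ J) :
    ∃ c : ℂ, ‖c‖ = 1 ∧ fieldDeriv i (monomial J) = c • monomial (J.erase i) := by
  obtain ⟨c, hc, h1⟩ := monomial_eq_field_mul h
  refine ⟨c, hc, ?_⟩
  rw [h1, map_smul, fieldDeriv_field_mul, fieldDeriv_monomial_of_notMem (Finset.notMem_erase i J)]
  simp

theorem constTerm_monomial (J : Finset I) : constTerm (monomial J) = if J = ∅ then 1 else 0 := by
  split_ifs with h
  · rw [h, monomial_empty, map_one]
  · obtain ⟨i, hi⟩ := Finset.nonempty_iff_ne_empty.mpr h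
    obtain ⟨c, -, hc⟩ := monomial_eq_field_mul hi
    rw [hc, map_smul, map_mul, field, constTerm_ι, zero_mul, smul_zero]

/-! ### Coefficients -/

/-- The coefficient functional as a linear map. -/
def coeffₗ (J : Finset I) : Grassmann I →ₗ[ℂ] ℂ := (monomialBasis I).coord J

theorem coeffₗ_apply (J : Finset I) (x : Grassmann I) : coeffₗ J x = coeff J x := rfl

theorem coeff_monomial (J K : Finset I) : coeff J (monomial K) = if J = K then 1 else 0 := by
  rw [coeff, monomial, Module.Basis.repr_self, Finsupp.single_apply]
  simp [eq_comm]

theorem sum_coeff (x : Grassmann I) : ∑ J, coeff J x • monomial J = x :=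
  (monomialBasis I).sum_repr x

theorem coeff_add (J : Finset I) (x y : Grassmann I) : coeff J (x + y) = coeff J x + coeff J y :=
  (coeffₗ J).map_add x y

theorem coeff_smul (J : Finset I) (c : ℂ) (x : Grassmann I) : coeff J (c • x) = c * coeff J x :=
  (coeffₗ J).map_smul c x

theorem coeff_sub (J : Finset I) (x y : Grassmann I) : coeff J (x - y) = coeff J x - coeff J y :=
  (coeffₗ J).map_sub x y

theorem coeff_neg (J : Finset I) (x : Grassmann I) : coeff J (-x) = -coeff J x :=
  (coeffₗ J).map_neg x

theorem coeff_zero (J : Finset I) : coeff J (0 : Grassmann I) = 0 := (coeffₗ J).map_zero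

theorem coeff_sum {α : Type*} (J : Finset I) (s : Finset α) (x : α → Grassmann I) :
    coeff J (∑ a ∈ s, x a) = ∑ a ∈ s, coeff J (x a) := map_sum (coeffₗ J) x s

theorem grassmann_ext {x y : Grassmann I} (h : ∀ J, coeff J x = coeff J y) : x = y :=
  (monomialBasis I).ext_elem h

theorem linearMap_ext_monomial {M : Type*} [AddCommGroup M] [Module ℂ M]
    {f g : Grassmann I →ₗ[ℂ] M} (h : ∀ J, f (monomial J) = g (monomial J)) : f = g :=
  (monomialBasis I).ext h

theorem coeff_linearMap {I' : Type} [Fintype I'] [LinearOrder I']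
    (L : Grassmann I →ₗ[ℂ] Grassmann I') (J : Finset I') (x : Grassmann I) :
    coeff J (L x) = ∑ K, coeff K x * coeff J (L (monomial K)) := by
  conv_lhs => rw [← sum_coeff x]
  simp [coeff_sum, coeff_smul]

theorem constTerm_eq_coeff (x : Grassmann I) : constTerm x = coeff ∅ x := by
  have : (constTerm (I := I)).toLinearMap = coeffₗ ∅ := linearMap_ext_monomial fun J => by
    rw [coeffₗ_apply, coeff_monomial]
    exact (constTerm_monomial J).trans (by simp [eq_comm])
  exact LinearMap.congr_fun this x

theorem coeff_algebraMap (J : Finset I) (c : ℂ) :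
    coeff J (algebraMap ℂ (Grassmann I) c) = if J = ∅ then c else 0 := by
  rw [Algebra.algebraMap_eq_smul_one, ← monomial_empty, coeff_smul, coeff_monomial]
  simp

/-- Differentiation deletes `i` from the index set, up to a sign. -/
theorem norm_coeff_fieldDeriv (i : I) (J : Finset I) (x : Grassmann I) :
    ‖coeff J (fieldDeriv i x)‖ = if i ∈ J then 0 else ‖coeff (insert i J) x‖ := by
  rw [coeff_linearMap, Finset.sum_eq_single (insert i J)]
  · split_ifs with h
    · obtain ⟨c, hc, h1⟩ := fieldDeriv_monomial_of_mem (Finset.mem_insert_self i J)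
      rw [h1, coeff_smul, coeff_monomial, if_neg (by grind)]; simp
    · obtain ⟨c, hc, h1⟩ := fieldDeriv_monomial_of_mem (Finset.mem_insert_self i J)
      rw [h1, coeff_smul, coeff_monomial, if_pos (by grind)]; simp [hc]
  · intro K _ hK
    by_cases hi : i ∈ K
    · obtain ⟨c, hc, h1⟩ := fieldDeriv_monomial_of_mem hi
      rw [h1, coeff_smul, coeff_monomial, if_neg (by grind)]; simp
    · rw [fieldDeriv_monomial_of_notMem hi, coeff_zero, mul_zero]
  · simp

/-- An element killed by all derivatives is a scalar. -/
theorem eq_algebraMap_of_fieldDeriv_eq_zero {x : Grassmann I} (h : ∀ i, fieldDeriv i x = 0) :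
    x = algebraMap ℂ (Grassmann I) (constTerm x) := by
  refine grassmann_ext fun J => ?_
  rw [coeff_algebraMap, constTerm_eq_coeff]
  split_ifs with hJ
  · rw [hJ]
  · obtain ⟨i, hi⟩ := Finset.nonempty_iff_ne_empty.mpr hJ
    have := norm_coeff_fieldDeriv i (J.erase i) x
    rw [h i, coeff_zero, if_neg (Finset.notMem_erase i J), Finset.insert_erase hi] at this
    simpa using this.symm

/-! ### Even elements -/

theorem parity_ι (m : I → ℂ) : parity (ExteriorAlgebra.ι ℂ m) = -ExteriorAlgebra.ι ℂ m :=
  CliffordAlgebra.involute_ι m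

theorem parity_monomial (J : Finset I) : parity (monomial J) = (-1 : ℂ) ^ J.card • monomial J := by
  induction J using Finset.induction_on with
  | empty => simp [monomial_empty]
  | insert a s ha ih =>
    obtain ⟨c, -, hc⟩ := monomial_eq_field_mul (Finset.mem_insert_self a s)
    rw [hc, map_smul, map_mul, Finset.erase_insert ha, ih, field, parity_ι,
      Finset.card_insert_of_notMem ha, pow_succ]
    simp only [neg_mul, mul_smul_comm, smul_smul, mul_neg, mul_one, smul_neg, neg_smul]
    rw [mul_comm]

theorem coeff_parity (J : Finset I) (x : Grassmann I) :
    coeff J (parity x) = (-1 : ℂ) ^ J.card * coeff J x := by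
  have := coeff_linearMap (parity (I := I)).toLinearMap J x
  rw [AlgHom.toLinearMap_apply] at this
  rw [this, Finset.sum_eq_single J]
  · rw [AlgHom.toLinearMap_apply, parity_monomial, coeff_smul, coeff_monomial, if_pos rfl]; ring
  · intro K _ hK
    rw [AlgHom.toLinearMap_apply, parity_monomial, coeff_smul, coeff_monomial, if_neg hK.symm]; simp
  · simp

theorem isEven_iff_parity {x : Grassmann I} : IsEven x ↔ parity x = x := by
  constructor
  · intro h
    refine grassmann_ext fun J => ?_
    rw [coeff_parity]
    rcases Nat.even_or_odd J.card with hJ | hJ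
    · rw [hJ.neg_one_pow, one_mul]
    · rw [h J hJ, mul_zero]
  · intro h J hJ
    have := coeff_parity J x
    rw [h, hJ.neg_one_pow] at this
    linear_combination this / 2

theorem ι_mul_eq_parity_mul (m : I → ℂ) (x : Grassmann I) :
    ExteriorAlgebra.ι ℂ m * x = parity x * ExteriorAlgebra.ι ℂ m := by
  induction x using grassmann_induction with
  | algebraMap c => rw [AlgHom.commutes, Algebra.commutes]
  | add x y hx hy => rw [mul_add, hx, hy, map_add, add_mul]
  | ι_mul x v hx =>
    rw [map_mul, parity_ι, neg_mul, neg_mul, mul_assoc, ← hx, ← mul_assoc, ← mul_assoc, ← neg_mul]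
    congr 1
    exact eq_neg_of_add_eq_zero_left (ExteriorAlgebra.ι_add_mul_swap m v)

theorem IsEven.commute {x : Grassmann I} (hx : IsEven x) (y : Grassmann I) : Commute x y := by
  rw [isEven_iff_parity] at hx
  induction y using grassmann_induction with
  | algebraMap c => exact (Algebra.commutes c x).symm
  | add y z hy hz => exact hy.add_right hz
  | ι_mul y v hy =>
    refine Commute.mul_right ?_ hy
    have := ι_mul_eq_parity_mul v x
    rw [hx] at this
    exact this.symm

theorem fieldDeriv_mul (i : I) (x y : Grassmann I) :
    fieldDeriv i (x * y) = fieldDeriv i x * y + parity x * fieldDeriv i y := by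
  induction x using grassmann_induction with
  | algebraMap c =>
    rw [fieldDeriv_algebraMap, AlgHom.commutes, zero_mul, zero_add, ← Algebra.smul_def, map_smul,
      Algebra.smul_def]
  | add x z hx hz => rw [add_mul, map_add, hx, hz, map_add, map_add]; simp only [add_mul]; abel
  | ι_mul x v hx =>
    rw [mul_assoc, fieldDeriv_ι_mul, hx, fieldDeriv_ι_mul, map_mul, parity_ι, mul_add, sub_mul,
      smul_mul_assoc]
    simp only [neg_mul, mul_assoc]
    abel

theorem IsEven.fieldDeriv_mul {x : Grassmann I} (hx : IsEven x) (i : I) (y : Grassmann I) :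
    fieldDeriv i (x * y) = fieldDeriv i x * y + x * fieldDeriv i y := by
  rw [GrassmannRG.fieldDeriv_mul, isEven_iff_parity.mp hx]

theorem parity_fieldDeriv (i : I) (x : Grassmann I) :
    parity (fieldDeriv i x) = -fieldDeriv i (parity x) := by
  induction x using grassmann_induction with
  | algebraMap c => simp [fieldDeriv_algebraMap]
  | add x z hx hz => simp only [map_add, hx, hz, neg_add]
  | ι_mul x v hx =>
    rw [fieldDeriv_ι_mul, map_sub, map_smul, map_mul, parity_ι, hx, map_mul, parity_ι, neg_mul,
      neg_mul, map_neg, fieldDeriv_ι_mul]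
    simp

theorem IsEven.sub {x y : Grassmann I} (hx : IsEven x) (hy : IsEven y) : IsEven (x - y) := by
  rw [isEven_iff_parity] at *; rw [map_sub, hx, hy]

theorem IsEven.neg {x : Grassmann I} (hx : IsEven x) : IsEven (-x) := by
  rw [isEven_iff_parity] at *; rw [map_neg, hx]

theorem IsEven.smul {x : Grassmann I} (c : ℂ) (hx : IsEven x) : IsEven (c • x) := by
  rw [isEven_iff_parity] at *; rw [map_smul, hx]

theorem isEven_algebraMap (c : ℂ) : IsEven (algebraMap ℂ (Grassmann I) c) := by
  rw [isEven_iff_parity, AlgHom.commutes]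

theorem isEven_one : IsEven (1 : Grassmann I) := by
  rw [isEven_iff_parity, map_one]

theorem IsEven.pow {x : Grassmann I} (hx : IsEven x) (k : ℕ) : IsEven (x ^ k) := by
  rw [isEven_iff_parity] at *; rw [map_pow, hx]

theorem IsEven.sum {α : Type*} {s : Finset α} {x : α → Grassmann I}
    (hx : ∀ a ∈ s, IsEven (x a)) : IsEven (∑ a ∈ s, x a) := by
  rw [isEven_iff_parity, map_sum]
  exact Finset.sum_congr rfl fun a ha => isEven_iff_parity.mp (hx a ha)

end Core

/-! ### The Gaussian convolution operator -/

section Gauss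

variable {I : Type} [Fintype I] [LinearOrder I]

/-- The skew-symmetric part of a matrix. -/
def skewPart (A : Matrix I I ℂ) : Matrix I I ℂ := fun i j => (A i j - A j i) / 2

theorem skewPart_of_skew {A : Matrix I I ℂ} (hA : ∀ i j, A j i = -A i j) : skewPart A = A := by
  ext i j
  simp [skewPart, hA i j]

/-- The bilinear form `-∑ a_ij x_i y_j`, with `a` the skew-symmetric part of `A`. -/
def covForm (A : Matrix I I ℂ) : LinearMap.BilinForm ℂ (I → ℂ) := -Matrix.toBilin' (skewPart A)

theorem covForm_apply (A : Matrix I I ℂ) (v w : I → ℂ) :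
    covForm A v w = -∑ i, ∑ j, v i * skewPart A i j * w j := by
  simp [covForm, Matrix.toBilin'_apply]

theorem toQuadraticMap_covForm (A : Matrix I I ℂ) :
    (covForm A).toQuadraticMap = (0 : QuadraticForm ℂ (I → ℂ)) - 0 := by
  ext v
  have h : ∑ i, ∑ j, v i * skewPart A i j * v j = -∑ i, ∑ j, v i * skewPart A i j * v j := by
    conv_lhs => rw [Finset.sum_comm]
    simp only [← Finset.sum_neg_distrib, skewPart]
    exact Finset.sum_congr rfl fun i _ => Finset.sum_congr rfl fun j _ => by ring
  rw [LinearMap.BilinMap.toQuadraticMap_apply, covForm_apply]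
  simp only [sub_zero, zero_apply, neg_eq_zero]
  linear_combination h / 2

/-- Convolution with the Gaussian measure of covariance `A`, the operator
`exp (1/2 ∑ A_ij ∂_j ∂_i)`, encoded as the change of form along `covForm A`. As this form is
alternating, source and target are both the Clifford algebra of the zero quadratic form. Only the
skew-symmetric part of `A` matters. -/
def gauss (A : Matrix I I ℂ) : Grassmann I →ₗ[ℂ] Grassmann I :=
  CliffordAlgebra.changeForm (toQuadraticMap_covForm A)

theorem gauss_algebraMap (A : Matrix I I ℂ) (c : ℂ) :
    gauss A (algebraMap ℂ (Grassmann I) c) = algebraMap ℂ (Grassmann I) c :=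
  CliffordAlgebra.changeForm_algebraMap _ c

theorem gauss_ι_mul' (A : Matrix I I ℂ) (m : I → ℂ) (x : Grassmann I) :
    gauss A (ExteriorAlgebra.ι ℂ m * x) = ExteriorAlgebra.ι ℂ m * gauss A x -
      CliffordAlgebra.contractLeft (covForm A m) (gauss A x) :=
  CliffordAlgebra.changeForm_ι_mul _ m x

/-- The additional field is either kept or contracted with one of the fields of `x`. -/
theorem gauss_ι_mul (A : Matrix I I ℂ) (m : I → ℂ) (x : Grassmann I) :
    gauss A (ExteriorAlgebra.ι ℂ m * x) = ExteriorAlgebra.ι ℂ m * gauss A x +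
      ∑ j, (∑ i, m i * skewPart A i j) • fieldDeriv j (gauss A x) := by
  rw [gauss_ι_mul', contractLeft_eq_sum, sub_eq_add_neg, ← Finset.sum_neg_distrib]
  congr 1
  refine Finset.sum_congr rfl fun j _ => ?_
  rw [covForm_apply, ← neg_smul, neg_neg]
  congr 1
  refine Finset.sum_congr rfl fun i _ => ?_
  simp [Pi.single_apply]

theorem gauss_fieldDeriv (A : Matrix I I ℂ) (i : I) (x : Grassmann I) :
    gauss A (fieldDeriv i x) = fieldDeriv i (gauss A x) :=
  CliffordAlgebra.changeForm_contractLeft _ _ _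

theorem gauss_zero (x : Grassmann I) : gauss (0 : Matrix I I ℂ) x = x := by
  induction x using grassmann_induction with
  | algebraMap c => rw [gauss_algebraMap]
  | add x y hx hy => rw [map_add, hx, hy]
  | ι_mul x m hx => rw [gauss_ι_mul, hx]; simp [skewPart]

theorem parity_gauss (A : Matrix I I ℂ) (x : Grassmann I) :
    parity (gauss A x) = gauss A (parity x) := by
  induction x using grassmann_induction with
  | algebraMap c => rw [gauss_algebraMap, AlgHom.commutes, gauss_algebraMap]
  | add x y hx hy => simp only [map_add, hx, hy]
  | ι_mul x m hx =>
    rw [gauss_ι_mul, map_add, map_mul, parity_ι, hx, map_mul, parity_ι, neg_mul, neg_mul, map_neg,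
      gauss_ι_mul, map_sum]
    simp only [map_smul, parity_fieldDeriv, hx, neg_add, smul_neg, Finset.sum_neg_distrib]

theorem IsEven.gauss {x : Grassmann I} (hx : IsEven x) (A : Matrix I I ℂ) :
    IsEven (gauss A x) := by
  rw [isEven_iff_parity] at *
  rw [parity_gauss, hx]

/-- The operator `1/2 ∑ A_ij ∂_j ∂_i`, the generator of `gauss`. -/
def lap (A : Matrix I I ℂ) : Grassmann I →ₗ[ℂ] Grassmann I :=
  (1 / 2 : ℂ) • ∑ i, ∑ j, A i j • (fieldDeriv j ∘ₗ fieldDeriv i)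

theorem lap_apply (A : Matrix I I ℂ) (x : Grassmann I) :
    lap A x = (1 / 2 : ℂ) • ∑ i, ∑ j, A i j • fieldDeriv j (fieldDeriv i x) := by
  simp [lap, LinearMap.sum_apply]

theorem lap_algebraMap (A : Matrix I I ℂ) (c : ℂ) :
    lap A (algebraMap ℂ (Grassmann I) c) = 0 := by
  simp [lap_apply, fieldDeriv_algebraMap]

theorem lap_ι_mul (A : Matrix I I ℂ) (m : I → ℂ) (x : Grassmann I) :
    lap A (ExteriorAlgebra.ι ℂ m * x) = ExteriorAlgebra.ι ℂ m * lap A x +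
      ∑ j, (∑ i, m i * skewPart A i j) • fieldDeriv j x := by
  have h1 : ∀ i j, fieldDeriv j (fieldDeriv i (ExteriorAlgebra.ι ℂ m * x)) =
      m i • fieldDeriv j x - m j • fieldDeriv i x +
        ExteriorAlgebra.ι ℂ m * fieldDeriv j (fieldDeriv i x) := by
    intro i j
    rw [fieldDeriv_ι_mul, map_sub, map_smul, fieldDeriv_ι_mul]
    abel
  have h2 : ∑ i, ∑ j, A i j • (m j • fieldDeriv i x) =
      ∑ i, ∑ j, A j i • (m i • fieldDeriv j x) := Finset.sum_comm
  have h3 : ∑ j, (∑ i, m i * skewPart A i j) • fieldDeriv j x =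
      (1 / 2 : ℂ) • (∑ i, ∑ j, A i j • (m i • fieldDeriv j x) -
        ∑ i, ∑ j, A j i • (m i • fieldDeriv j x)) := by
    rw [← Finset.sum_sub_distrib]
    simp only [← Finset.sum_sub_distrib, Finset.smul_sum, Finset.sum_smul]
    rw [Finset.sum_comm]
    refine Finset.sum_congr rfl fun i _ => Finset.sum_congr rfl fun j _ => ?_
    simp only [skewPart, smul_smul, ← sub_smul]
    congr 1; ring
  rw [lap_apply, lap_apply, h3, mul_smul_comm, ← smul_add, ← h2]
  simp only [h1, smul_add, smul_sub, Finset.sum_add_distrib, Finset.sum_sub_distrib,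
    Finset.mul_sum, mul_smul_comm]
  abel_nf

theorem lap_skewPart (A : Matrix I I ℂ) (x : Grassmann I) : lap (skewPart A) x = lap A x := by
  induction x using grassmann_induction with
  | algebraMap c => simp only [lap_algebraMap]
  | add x y hx hy => rw [map_add, hx, hy, map_add]
  | ι_mul x m hx =>
    rw [lap_ι_mul, lap_ι_mul, hx]
    have : skewPart (skewPart A) = skewPart A :=
      skewPart_of_skew fun i j => by simp only [skewPart]; ring
    rw [this]

/-! ### Gaussian integration of homogeneous elements -/

/-- The Euler operator `∑ ψ_i ∂_i`. -/
def euler (x : Grassmann I) : Grassmann I := ∑ i, field i * fieldDeriv i x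

/-- Euler's formula: the eigenvalues of the Euler operator are the degrees. -/
theorem euler_monomial (J : Finset I) : euler (monomial J) = (J.card : ℂ) • monomial J := by
  have h : ∀ i, field i * fieldDeriv i (monomial J) = if i ∈ J then monomial J else 0 := by
    intro i
    split_ifs with hi
    · obtain ⟨c, -, hc⟩ := monomial_eq_field_mul hi
      conv_lhs => rw [hc]
      rw [map_smul, fieldDeriv_field_mul, if_pos rfl,
        fieldDeriv_monomial_of_notMem (Finset.notMem_erase i J)]
      conv_rhs => rw [hc]
      simp
    · rw [fieldDeriv_monomial_of_notMem hi, mul_zero]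
  simp only [euler, h, Finset.sum_ite_mem, Finset.univ_inter, Finset.sum_const]
  rw [Nat.cast_smul_eq_nsmul]

theorem euler_fieldDeriv (k : I) (x : Grassmann I) :
    euler (fieldDeriv k x) = fieldDeriv k (euler x) - fieldDeriv k x := by
  simp only [euler, map_sum, fieldDeriv_field_mul, Finset.sum_sub_distrib]
  simp only [Finset.sum_ite_eq, Finset.mem_univ, if_true]
  rw [sub_sub, add_comm, ← sub_sub, sub_self, zero_sub, ← Finset.sum_neg_distrib]
  refine Finset.sum_congr rfl fun i _ => ?_
  rw [fieldDeriv_comm i k, mul_neg]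

theorem euler_smul (c : ℂ) (x : Grassmann I) : euler (c • x) = c • euler x := by
  simp [euler, Finset.smul_sum]

theorem euler_sum {α : Type*} (s : Finset α) (x : α → Grassmann I) :
    euler (∑ a ∈ s, x a) = ∑ a ∈ s, euler (x a) := by
  simp only [euler, map_sum, Finset.mul_sum]
  exact Finset.sum_comm

theorem fieldDeriv_homogeneous {x : Grassmann I} {p : ℂ} (hx : euler x = p • x) (k : I) :
    euler (fieldDeriv k x) = (p - 1) • fieldDeriv k x := by
  rw [euler_fieldDeriv, hx, map_smul, sub_smul, one_smul]

theorem lap_homogeneous {x : Grassmann I} {p : ℂ} (hx : euler x = p • x) (A : Matrix I I ℂ) :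
    euler (lap A x) = (p - 2) • lap A x := by
  simp only [lap_apply, euler_smul, euler_sum, Finset.smul_sum]
  refine Finset.sum_congr rfl fun i _ => Finset.sum_congr rfl fun j _ => ?_
  rw [fieldDeriv_homogeneous (fieldDeriv_homogeneous hx i) j, smul_smul, smul_smul, smul_smul,
    smul_smul]
  congr 1; ring

/-- Integration by parts for the Gaussian integral `constTerm ∘ gauss A`. -/
theorem constTerm_gauss_field_mul (A : Matrix I I ℂ) (i : I) (x : Grassmann I) :
    constTerm (gauss A (field i * x)) =
      ∑ j, skewPart A i j * constTerm (gauss A (fieldDeriv j x)) := by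
  rw [field, gauss_ι_mul, map_add, map_mul, constTerm_ι, zero_mul, zero_add, map_sum]
  refine Finset.sum_congr rfl fun j _ => ?_
  rw [map_smul, gauss_fieldDeriv, smul_eq_mul]
  congr 1
  simp [Pi.single_apply]

/-- Integration by parts, summed over all fields. -/
theorem two_mul_constTerm_gauss_lap (A : Matrix I I ℂ) (x : Grassmann I) :
    2 * constTerm (gauss A (lap A x)) = constTerm (gauss A (euler x)) := by
  rw [← lap_skewPart, lap_apply]
  simp only [euler, map_smul, map_sum, constTerm_gauss_field_mul, smul_eq_mul]
  ring

theorem eq_algebraMap_of_euler_eq_zero {x : Grassmann I} (h : euler x = 0) :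
    x = algebraMap ℂ (Grassmann I) (constTerm x) := by
  refine grassmann_ext fun J => ?_
  rw [coeff_algebraMap, constTerm_eq_coeff]
  split_ifs with hJ
  · rw [hJ]
  · have h1 : coeff J (euler x) = (J.card : ℂ) * coeff J x := by
      conv_lhs => rw [← sum_coeff x]
      rw [euler_sum, coeff_sum, Finset.sum_eq_single J]
      · rw [euler_smul, euler_monomial, coeff_smul, coeff_smul, coeff_monomial, if_pos rfl]; ring
      · intro K _ hK
        rw [euler_smul, euler_monomial, coeff_smul, coeff_smul, coeff_monomial, if_neg hK.symm]
        ring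
      · simp
    rw [h, coeff_zero] at h1
    have h2 : (J.card : ℂ) ≠ 0 := by
      rw [Nat.cast_ne_zero, Finset.card_ne_zero]; exact Finset.nonempty_iff_ne_empty.mpr hJ
    exact (mul_eq_zero.mp h1.symm).resolve_left h2

/-- On elements of degree `2q`, only the term `lap A ^ q / q!` of `gauss A = exp (lap A)` has a
constant part. It follows from integration by parts and Euler's formula. -/
theorem factorial_mul_constTerm_gauss (A : Matrix I I ℂ) (q : ℕ) (x : Grassmann I)
    (hx : euler x = (2 * q : ℂ) • x) :
    (q.factorial : ℂ) * constTerm (gauss A x) = constTerm ((lap A ^ q) x) := by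
  induction q generalizing x with
  | zero =>
    have := eq_algebraMap_of_euler_eq_zero (x := x) (by simpa using hx)
    rw [this, gauss_algebraMap]; simp
  | succ q ih =>
    have h1 := ih (lap A x) (by rw [lap_homogeneous hx]; congr 1; push_cast; ring)
    have h2 := two_mul_constTerm_gauss_lap A x
    rw [hx, map_smul, map_smul, smul_eq_mul] at h2
    rw [pow_succ, Module.End.mul_apply, ← h1, Nat.factorial_succ]
    push_cast at h2 ⊢
    linear_combination (-(q.factorial : ℂ) / 2) * h2

end Gauss

/-! ### Linear substitutions -/

section Map

variable {I I' : Type} [Fintype I] [LinearOrder I] [Fintype I'] [LinearOrder I']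

theorem contractLeft_map (f : (I → ℂ) →ₗ[ℂ] (I' → ℂ)) (d : Module.Dual ℂ (I' → ℂ))
    (x : Grassmann I) :
    CliffordAlgebra.contractLeft d (ExteriorAlgebra.map f x : Grassmann I') =
      ExteriorAlgebra.map f (CliffordAlgebra.contractLeft (d ∘ₗ f) x : Grassmann I) := by
  induction x using grassmann_induction with
  | algebraMap c =>
    rw [AlgHom.commutes]
    refine (CliffordAlgebra.contractLeft_algebraMap _ _ _).trans ?_
    rw [CliffordAlgebra.contractLeft_algebraMap, map_zero]
  | add x y hx hy => simp only [map_add, hx, hy]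
  | ι_mul x m hx =>
    rw [map_mul, ExteriorAlgebra.map_apply_ι]
    refine (CliffordAlgebra.contractLeft_ι_mul _ _ _).trans ?_
    rw [hx]
    have := CliffordAlgebra.contractLeft_ι_mul (Q := (0 : QuadraticForm ℂ (I → ℂ))) (d ∘ₗ f) m x
    refine Eq.trans ?_ (congrArg (ExteriorAlgebra.map f) this.symm)
    rw [map_sub, map_smul, map_mul]
    congr 2
    exact (ExteriorAlgebra.map_apply_ι f m).symm

/-- A linear substitution of the fields turns the covariance `A` into its pullback. -/
theorem gauss_map (f : (I → ℂ) →ₗ[ℂ] (I' → ℂ)) {A : Matrix I I ℂ} {A' : Matrix I' I' ℂ}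
    (h : ∀ i j, covForm A' (f (Pi.single i 1)) (f (Pi.single j 1)) = -skewPart A i j)
    (x : Grassmann I) :
    gauss A' (ExteriorAlgebra.map f x) = ExteriorAlgebra.map f (gauss A x) := by
  have hB : ∀ m, covForm A' (f m) ∘ₗ f = covForm A m := by
    have : (covForm A').compl₁₂ f f = covForm A := by
      refine LinearMap.BilinForm.ext_basis (Pi.basisFun ℂ I) fun i j => ?_
      simp only [LinearMap.compl₁₂_apply, Pi.basisFun_apply, h, covForm_apply]
      simp [Pi.single_apply]
    intro m
    rw [← this]; rfl
  induction x using grassmann_induction with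
  | algebraMap c => rw [AlgHom.commutes, gauss_algebraMap, gauss_algebraMap, AlgHom.commutes]
  | add x y hx hy => simp only [map_add, hx, hy]
  | ι_mul x m hx =>
    rw [map_mul, ExteriorAlgebra.map_apply_ι, gauss_ι_mul', hx, contractLeft_map, hB, gauss_ι_mul',
      map_sub, map_mul, ExteriorAlgebra.map_apply_ι]

end Map

/-! ### Increasing relabellings of the fields -/

section Relabel

variable {I I' : Type} [Fintype I] [LinearOrder I] [Fintype I'] [LinearOrder I']

theorem monomial_eq_prod_sort (J : Finset I) : monomial J = (J.sort.map field).prod := by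
  rw [monomial_eq_prod]
  congr 1
  refine List.ext_getElem (by simp) fun i h1 h2 => ?_
  simp [Finset.orderEmbOfFin_apply]

theorem monomial_insert_of_lt {a : I} {J : Finset I} (h : ∀ b ∈ J, a < b) :
    monomial (insert a J) = field a * monomial J := by
  rw [monomial_eq_prod_sort, monomial_eq_prod_sort,
    Finset.sort_insert _ (fun b hb => (h b hb).le) (fun ha => (h a ha).false)]
  simp

theorem monomial_union_of_lt {P Q : Finset I} (h : ∀ a ∈ P, ∀ b ∈ Q, a < b) :
    monomial (P ∪ Q) = monomial P * monomial Q := by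
  induction P using Finset.induction_on_min with
  | empty => rw [Finset.empty_union, monomial_empty, one_mul]
  | insert a s ha ih =>
    rw [Finset.insert_union, monomial_insert_of_lt, monomial_insert_of_lt ha, ih, mul_assoc]
    · exact fun b hb c hc => h b (Finset.mem_insert_of_mem hb) c hc
    · intro b hb
      rcases Finset.mem_union.mp hb with hb | hb
      · exact ha b hb
      · exact h a (Finset.mem_insert_self a s) b hb

/-- The linear map with `e_i ↦ e_{φ i}` on basis vectors. -/
def relabel (φ : I → I') : (I → ℂ) →ₗ[ℂ] (I' → ℂ) :=
  Fintype.linearCombination ℂ fun i => Pi.single (φ i) (1 : ℂ)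

theorem relabel_single (φ : I → I') (i : I) :
    relabel φ (Pi.single i 1) = Pi.single (φ i) 1 := by
  simp [relabel, Fintype.linearCombination_apply_single]

theorem map_relabel_field (φ : I → I') (i : I) :
    ExteriorAlgebra.map (relabel φ) (field i) = field (φ i) := by
  rw [field, ExteriorAlgebra.map_apply_ι, relabel_single, field]

theorem map_relabel_monomial (φ : I ↪o I') (J : Finset I) :
    ExteriorAlgebra.map (relabel φ) (monomial J) = monomial (J.map φ.toEmbedding) := by
  induction J using Finset.induction_on_min with
  | empty => simp [monomial_empty]
  | insert a s ha ih =>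
    rw [monomial_insert_of_lt ha, map_mul, map_relabel_field, ih, Finset.map_insert,
      ← monomial_insert_of_lt]
    · rfl
    · intro b hb
      obtain ⟨c, hc, rfl⟩ := Finset.mem_map.mp hb
      exact φ.strictMono (ha c hc)

theorem gauss_map_relabel {φ : I → I'} {A : Matrix I I ℂ} {A' : Matrix I' I' ℂ}
    (h : ∀ i j, A' (φ i) (φ j) = A i j) (x : Grassmann I) :
    gauss A' (ExteriorAlgebra.map (relabel φ) x) =
      ExteriorAlgebra.map (relabel φ) (gauss A x) := by
  refine gauss_map _ (fun i j => ?_) x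
  rw [relabel_single, relabel_single, covForm_apply]
  simp [Pi.single_apply, skewPart, h]

theorem constTerm_map (f : (I → ℂ) →ₗ[ℂ] (I' → ℂ)) (x : Grassmann I) :
    constTerm (ExteriorAlgebra.map f x) = constTerm x := by
  have : constTerm.comp (ExteriorAlgebra.map f) = constTerm (I := I) := by
    refine ExteriorAlgebra.hom_ext (LinearMap.ext fun m => ?_)
    simp only [LinearMap.comp_apply, AlgHom.toLinearMap_apply, AlgHom.comp_apply,
      ExteriorAlgebra.map_apply_ι, constTerm_ι]
  exact DFunLike.congr_fun this x

end Relabel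

/-! ### Gaussian integrals of monomials are Pfaffians -/

section Pfaffian

variable {I : Type} [Fintype I] [LinearOrder I]

/-- The alternating map `(d_1, …, d_p) ↦ d_p ∘ ⋯ ∘ d_1` of contractions, as a product in the
opposite of the endomorphism algebra. -/
def iteratedContract (I : Type) [Fintype I] (p : ℕ) :
    (Module.Dual ℂ (I → ℂ)) [⋀^Fin p]→ₗ[ℂ] (Module.End ℂ (Grassmann I))ᵐᵒᵖ :=
  (ExteriorAlgebra.lift ℂ ⟨(MulOpposite.opLinearEquiv ℂ).toLinearMap ∘ₗ
      (CliffordAlgebra.contractLeft (Q := (0 : QuadraticForm ℂ (I → ℂ)))), fun d => by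
        rw [LinearMap.comp_apply, LinearEquiv.coe_coe, MulOpposite.coe_opLinearEquiv,
          ← MulOpposite.op_mul, MulOpposite.op_eq_zero_iff]
        exact LinearMap.ext fun x => CliffordAlgebra.contractLeft_contractLeft d x⟩
    ).toLinearMap.compAlternatingMap (ExteriorAlgebra.ιMulti ℂ p)

theorem iteratedContract_proj {p : ℕ} (h : Fin p → I) :
    iteratedContract I p (fun a => LinearMap.proj (h a)) =
      (List.ofFn fun a => MulOpposite.op (fieldDeriv (h a))).prod := by
  rw [iteratedContract, LinearMap.compAlternatingMap_apply, ExteriorAlgebra.ιMulti_apply,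
    AlgHom.toLinearMap_apply, map_list_prod, List.map_ofFn]
  congr 2
  funext a
  rw [Function.comp_apply, ExteriorAlgebra.lift_ι_apply]
  rfl

/-- Differentiating `ψ_a ψ_b ⋯` by `ψ_a`, then by `ψ_b`, and so on, leaves `1`. -/
theorem prod_fieldDeriv_prod_field {l : List I} (hl : l.Nodup) :
    (l.map fun i => MulOpposite.op (fieldDeriv i)).prod.unop (l.map field).prod = 1 := by
  induction l with
  | nil => simp
  | cons a l ih =>
    rw [List.nodup_cons] at hl
    have h0 : ∀ l' : List I, a ∉ l' → fieldDeriv a (l'.map field).prod = 0 := by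
      intro l' hl'
      induction l' with
      | nil => simp [fieldDeriv_one]
      | cons b l' ih' =>
        rw [List.mem_cons, not_or] at hl'
        rw [List.map_cons, List.prod_cons, fieldDeriv_field_mul, if_neg hl'.1, ih' hl'.2]
        simp
    rw [List.map_cons, List.map_cons, List.prod_cons, List.prod_cons, MulOpposite.unop_mul,
      Module.End.mul_apply, MulOpposite.unop_op, fieldDeriv_field_mul, if_pos rfl, h0 l hl.1,
      mul_zero, sub_zero, ih hl.2]

theorem prod_ofFn_eq_prod_pairs {M : Type*} [Monoid M] {p : ℕ} (hp : Even p) (F : Fin p → M) :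
    (List.ofFn F).prod =
      (List.ofFn fun r : Fin (p / 2) => F ⟨2 * r.1, by omega⟩ * F ⟨2 * r.1 + 1, by omega⟩).prod := by
  have h2 : p = 2 * (p / 2) := by have := Nat.two_mul_div_two_of_even hp; omega
  rw [List.ofFn_congr h2, List.ofFn_mul', List.prod_flatten, List.map_ofFn]
  congr 2
  funext r
  simp [List.ofFn_succ]

/-- Sequences of even length `p` are sequences of `p / 2` pairs. -/
def pairsEquiv {p : ℕ} (hp : Even p) (α : Type*) : (Fin p → α) ≃ (Fin (p / 2) → α × α) where
  toFun h r := (h ⟨2 * r.1, by omega⟩, h ⟨2 * r.1 + 1, by omega⟩)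
  invFun g a := if a.1 % 2 = 0 then (g ⟨a.1 / 2, by obtain ⟨c, hc⟩ := hp; omega⟩).1
    else (g ⟨a.1 / 2, by obtain ⟨c, hc⟩ := hp; omega⟩).2
  left_inv h := by
    funext a
    dsimp only
    split_ifs with ha
    · congr 1; ext; simp only; omega
    · congr 1; ext; simp only; omega
  right_inv g := by
    funext r
    have h1 : (2 * r.1) / 2 = r.1 := by omega
    have h2 : (2 * r.1 + 1) / 2 = r.1 := by omega
    simp [h1, h2]

/-- The expansion of `lap M ^ q`, with derivatives composed in the order in which they act. -/
theorem lap_pow_eq_sum (M : Matrix I I ℂ) (q : ℕ) :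
    MulOpposite.op (lap M ^ q) = ∑ g : Fin q → I × I,
      (∏ r, (1 / 2 * M (g r).1 (g r).2)) • (List.ofFn fun r =>
        MulOpposite.op (fieldDeriv (g r).1) * MulOpposite.op (fieldDeriv (g r).2)).prod := by
  have h1 : MulOpposite.op (lap M) = ∑ c : I × I, (1 / 2 * M c.1 c.2) •
      (MulOpposite.op (fieldDeriv c.1) * MulOpposite.op (fieldDeriv c.2)) := by
    rw [Fintype.sum_prod_type, lap, MulOpposite.op_smul]
    simp only [Finset.op_sum, Finset.smul_sum, MulOpposite.op_smul, smul_smul,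
      ← MulOpposite.op_mul]
    rfl
  rw [MulOpposite.op_pow, h1, ← MultilinearMap.mkPiAlgebraFin_apply_const (R := ℂ),
    MultilinearMap.map_sum]
  refine Finset.sum_congr rfl fun g _ => ?_
  rw [MultilinearMap.map_smul_univ, MultilinearMap.mkPiAlgebraFin_apply]

/-- For an alternating form, a sum over all index sequences reduces to permutations. -/
theorem sum_alternating_eq_sum_perm {p : ℕ} {N : Type*} [AddCommGroup N] [Module ℂ N]
    (G : N [⋀^Fin p]→ₗ[ℂ] ℂ) (d : Fin p → N) (W : (Fin p → Fin p) → ℂ) :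
    ∑ h : Fin p → Fin p, W h * G (fun a => d (h a)) =
      (∑ σ : Equiv.Perm (Fin p), ((Equiv.Perm.sign σ : ℤ) : ℂ) * W σ) * G d := by
  have h0 : ∀ h : Fin p → Fin p, ¬Function.Injective h → G (fun a => d (h a)) = 0 := by
    intro h hh
    refine G.map_eq_zero_of_not_injective _ fun hinj => hh ?_
    exact Function.Injective.of_comp (f := d) hinj
  rw [Finset.sum_mul, ← Finset.sum_filter_add_sum_filter_not Finset.univ
    (fun h : Fin p → Fin p => Function.Bijective h)]
  rw [Finset.sum_eq_zero (s := Finset.univ.filter fun h : Fin p → Fin p => ¬Function.Bijective h),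
    add_zero]
  · symm
    refine Finset.sum_bij (fun σ _ => (σ : Fin p → Fin p)) ?_ ?_ ?_ ?_
    · exact fun σ _ => Finset.mem_filter.mpr ⟨Finset.mem_univ _, σ.bijective⟩
    · intro σ _ τ _ h; exact DFunLike.coe_injective h
    · intro h hh
      exact ⟨Equiv.ofBijective h (Finset.mem_filter.mp hh).2, Finset.mem_univ _, rfl⟩
    · intro σ _
      have := G.map_perm d σ
      rw [show (fun a => d (σ a)) = d ∘ σ from rfl, this]
      rcases Int.units_eq_one_or (Equiv.Perm.sign σ) with hu | hu <;> simp [hu]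
  · intro h hh
    rw [Finset.mem_filter] at hh
    rw [h0 h fun hi => hh.2 (Finite.injective_iff_bijective.mp hi), mul_zero]

theorem constTerm_gauss_monomial_of_odd (A : Matrix I I ℂ) {J : Finset I} (hJ : Odd J.card) :
    constTerm (gauss A (monomial J)) = 0 := by
  have h := parity_gauss A (monomial J)
  rw [parity_monomial, hJ.neg_one_pow, map_smul, neg_smul, one_smul] at h
  have h2 := congrArg (coeff ∅) h
  rw [coeff_parity, coeff_neg] at h2
  rw [constTerm_eq_coeff]
  simp only [Finset.card_empty, pow_zero, one_mul] at h2
  linear_combination h2 / 2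

/-- Expand `lap M ^ q / q!` in products of `2q` derivatives. Their action on the full monomial is
alternating in the derivatives, so only permutations survive, which gives the Pfaffian. -/
theorem constTerm_gauss_monomial_univ {p : ℕ} (M : Matrix (Fin p) (Fin p) ℂ) :
    constTerm (gauss M (monomial Finset.univ)) = pfaffian M := by
  rcases Nat.even_or_odd p with hp | hp
  swap
  · rw [constTerm_gauss_monomial_of_odd _ (by simpa using hp), pfaffian,
      if_neg (Nat.not_even_iff_odd.mpr hp)]
  have h2 : 2 * (p / 2) = p := Nat.two_mul_div_two_of_even hp
  have hu : monomial (Finset.univ : Finset (Fin p)) = (List.ofFn field).prod := by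
    rw [monomial_eq_prod, List.ofFn_congr (Finset.card_fin p)]
    congr 2
    funext a
    congr 1
    have := Finset.orderEmbOfFin_unique (s := Finset.univ) (Finset.card_fin p)
      (f := fun a : Fin p => a) (fun _ => Finset.mem_univ _) strictMono_id
    exact (congrFun this a).symm
  have h1 := factorial_mul_constTerm_gauss M (p / 2) (monomial Finset.univ) (by
    rw [euler_monomial, Finset.card_fin]
    congr 1
    exact_mod_cast h2.symm)
  -- the functional that evaluates the contracted monomial
  let L : (Module.End ℂ (Grassmann (Fin p)))ᵐᵒᵖ →ₗ[ℂ] ℂ := constTerm.toLinearMap ∘ₗ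
    (LinearMap.applyₗ (monomial Finset.univ)) ∘ₗ (MulOpposite.opLinearEquiv ℂ).symm.toLinearMap
  have hL : ∀ T : (Module.End ℂ (Grassmann (Fin p)))ᵐᵒᵖ,
      L T = constTerm (T.unop (monomial Finset.univ)) := fun T => rfl
  have h3 : constTerm ((lap M ^ (p / 2)) (monomial Finset.univ)) =
      L (MulOpposite.op (lap M ^ (p / 2))) := rfl
  let G := L.compAlternatingMap (iteratedContract (Fin p) p)
  have h4 : G (fun a => LinearMap.proj a) = 1 := by
    rw [LinearMap.compAlternatingMap_apply, iteratedContract_proj, hL, hu]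
    have := prod_fieldDeriv_prod_field (List.nodup_ofFn.mpr (Function.injective_id (α := Fin p)))
    rw [List.map_ofFn, List.map_ofFn] at this
    refine (congrArg constTerm this).trans (map_one _)
  have h5 : L (MulOpposite.op (lap M ^ (p / 2))) = ∑ h : Fin p → Fin p,
      (∏ r : Fin (p / 2), (1 / 2 * M (h ⟨2 * r.1, by omega⟩) (h ⟨2 * r.1 + 1, by omega⟩))) *
        G (fun a => LinearMap.proj (h a)) := by
    rw [lap_pow_eq_sum, map_sum, ← (pairsEquiv hp (Fin p)).sum_comp]
    refine Finset.sum_congr rfl fun h _ => ?_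
    rw [map_smul, smul_eq_mul, LinearMap.compAlternatingMap_apply, iteratedContract_proj,
      prod_ofFn_eq_prod_pairs hp]
    rfl
  rw [h5, sum_alternating_eq_sum_perm G (fun a => LinearMap.proj a)
    (fun h => ∏ r : Fin (p / 2), (1 / 2 * M (h ⟨2 * r.1, by omega⟩) (h ⟨2 * r.1 + 1, by omega⟩))),
    h4, mul_one] at h3
  rw [h3] at h1
  have hf : ((p / 2).factorial : ℂ) ≠ 0 := by exact_mod_cast (p / 2).factorial_ne_zero
  rw [pfaffian, if_pos hp]
  refine mul_left_cancel₀ hf ?_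
  rw [h1, ← mul_assoc, Finset.mul_sum]
  refine Finset.sum_congr rfl fun σ _ => ?_
  rw [Finset.prod_mul_distrib, Finset.prod_const, Finset.card_univ, Fintype.card_fin]
  rw [one_div_pow]
  field_simp

theorem constTerm_gauss_monomial (A : Matrix I I ℂ) (K : Finset I) :
    constTerm (gauss A (monomial K)) = pfaffianOn A K := by
  have h1 : monomial K =
      ExteriorAlgebra.map (relabel (K.orderEmbOfFin rfl)) (monomial Finset.univ) := by
    rw [map_relabel_monomial]
    congr 1
    exact (Finset.map_orderEmbOfFin_univ K rfl).symm
  rw [h1, gauss_map_relabel (φ := K.orderEmbOfFin rfl)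
    (A := A.submatrix (K.orderEmbOfFin rfl) (K.orderEmbOfFin rfl)) (fun i j => rfl),
    constTerm_map, constTerm_gauss_monomial_univ, pfaffianOn]

theorem expectation_eq_constTerm (A : Matrix I I ℂ) (f : Grassmann I) :
    expectation A f = constTerm (gauss A f) := by
  conv_rhs => rw [← sum_coeff f]
  rw [expectation, map_sum, map_sum]
  refine Finset.sum_congr rfl fun J _ => ?_
  rw [map_smul, map_smul, constTerm_gauss_monomial, smul_eq_mul]

end Pfaffian

/-! ### Convolution -/

section Convolution

variable {I : Type} [Fintype I] [LinearOrder I]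

/-- The order embedding of the indices of the fields `Ψ`. -/
def inlEmb (I : Type) [LinearOrder I] : I ↪o I ⊕ₗ I :=
  OrderEmbedding.ofStrictMono (fun i => Sum.inlₗ i) fun _ _ h => Sum.Lex.inl_lt_inl_iff.mpr h

/-- The order embedding of the indices of the fields `Θ`. -/
def inrEmb (I : Type) [LinearOrder I] : I ↪o I ⊕ₗ I :=
  OrderEmbedding.ofStrictMono (fun i => Sum.inrₗ i) fun _ _ h => Sum.Lex.inr_lt_inr_iff.mpr h

theorem inlEmb_apply (i : I) : inlEmb I i = toLex (Sum.inl i) := rfl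

theorem inrEmb_apply (i : I) : inrEmb I i = toLex (Sum.inr i) := rfl

theorem monomial_pairIndex (J K : Finset I) :
    monomial (pairIndex J K) = ExteriorAlgebra.map (relabel (inlEmb I)) (monomial J) *
      ExteriorAlgebra.map (relabel (inrEmb I)) (monomial K) := by
  rw [map_relabel_monomial, map_relabel_monomial, ← monomial_union_of_lt]
  · congr 1
    ext x
    rcases h : ofLex x with i | i
    all_goals
      obtain rfl : x = toLex _ := h
      simp [pairIndex, inlEmb_apply, inrEmb_apply]
  · intro a ha b hb
    obtain ⟨i, -, rfl⟩ := Finset.mem_map.mp ha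
    obtain ⟨j, -, rfl⟩ := Finset.mem_map.mp hb
    exact Sum.Lex.inl_lt_inr _ _

/-- The covariance on the fields `(Ψ, Θ)` for which only `Θ` is integrated. -/
def thetaCov (A : Matrix I I ℂ) : Matrix (I ⊕ₗ I) (I ⊕ₗ I) ℂ :=
  (Matrix.fromBlocks 0 0 0 A).submatrix ofLex ofLex

/-- The fields `Ψ` are not integrated, so functions of `Ψ` can be pulled out. -/
theorem gauss_thetaCov_mul (A : Matrix I I ℂ) (x : Grassmann I) (y : Grassmann (I ⊕ₗ I)) :
    gauss (thetaCov A) (ExteriorAlgebra.map (relabel (inlEmb I)) x * y) =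
      ExteriorAlgebra.map (relabel (inlEmb I)) x * gauss (thetaCov A) y := by
  induction x using grassmann_induction with
  | algebraMap c =>
    rw [AlgHom.commutes, ← Algebra.smul_def, ← Algebra.smul_def, map_smul]
  | add x z hx hz => simp only [map_add, add_mul, hx, hz]
  | ι_mul x m hx =>
    have h0 : covForm (thetaCov A) (relabel (inlEmb I) m) = 0 := by
      have : covForm (thetaCov A) ∘ₗ relabel (inlEmb I) = 0 := by
        refine (Pi.basisFun ℂ I).ext fun i => LinearMap.ext fun w => ?_
        rw [Pi.basisFun_apply, LinearMap.comp_apply, relabel_single, covForm_apply]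
        simp only [Pi.single_apply, ite_mul, zero_mul, one_mul, LinearMap.zero_apply, neg_eq_zero]
        refine Finset.sum_eq_zero fun a _ => Finset.sum_eq_zero fun b _ => ?_
        split_ifs with h
        · subst h
          rcases hb : ofLex b with j | j <;>
            simp [skewPart, thetaCov, inlEmb_apply, Matrix.fromBlocks, hb]
        · rfl
      exact LinearMap.congr_fun this m
    rw [map_mul (ExteriorAlgebra.map (relabel (inlEmb I))), ExteriorAlgebra.map_apply_ι, mul_assoc,
      gauss_ι_mul', h0, map_zero,
      LinearMap.zero_apply, sub_zero, hx, mul_assoc]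

/-- The substitution `Θ = 0` fixes functions of `Ψ` alone. -/
theorem map_funLeft_map_relabel_inl (x : Grassmann I) :
    ExteriorAlgebra.map (LinearMap.funLeft ℂ ℂ (inlEmb I))
      (ExteriorAlgebra.map (relabel (inlEmb I)) x) = x := by
  rw [← AlgHom.comp_apply, ExteriorAlgebra.map_comp_map]
  have : LinearMap.funLeft ℂ ℂ (inlEmb I) ∘ₗ relabel (inlEmb I) = LinearMap.id := by
    refine (Pi.basisFun ℂ I).ext fun i => ?_
    rw [Pi.basisFun_apply, LinearMap.comp_apply, relabel_single]
    ext j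
    simp [LinearMap.funLeft_apply, Pi.single_apply]
  rw [this, ExteriorAlgebra.map_id]; rfl

/-- The substitution `Θ = 0` evaluates functions of `Θ` alone to their constant term. -/
theorem map_funLeft_map_relabel_inr (x : Grassmann I) :
    ExteriorAlgebra.map (LinearMap.funLeft ℂ ℂ (inlEmb I))
      (ExteriorAlgebra.map (relabel (inrEmb I)) x) = algebraMap ℂ _ (constTerm x) := by
  rw [← AlgHom.comp_apply, ExteriorAlgebra.map_comp_map]
  have : LinearMap.funLeft ℂ ℂ (inlEmb I) ∘ₗ relabel (inrEmb I) = 0 := by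
    refine (Pi.basisFun ℂ I).ext fun i => ?_
    rw [Pi.basisFun_apply, LinearMap.comp_apply, relabel_single]
    ext j
    simp [LinearMap.funLeft_apply, inlEmb_apply, inrEmb_apply]
  rw [this]
  induction x using grassmann_induction with
  | algebraMap c => rw [AlgHom.commutes, constTerm_algebraMap]
  | add x y hx hy => simp only [map_add, hx, hy]
  | ι_mul x m hx =>
    rw [map_mul, ExteriorAlgebra.map_apply_ι, map_mul, constTerm_ι]; simp

/-- Putting `Θ = 0` in `f(Ψ + Θ)` gives back `f(Ψ)`. -/
theorem map_funLeft_translate (x : Grassmann I) :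
    ExteriorAlgebra.map (LinearMap.funLeft ℂ ℂ (inlEmb I)) (translate x) = x := by
  rw [translate, ← AlgHom.comp_apply, ExteriorAlgebra.map_comp_map]
  have : LinearMap.funLeft ℂ ℂ (inlEmb I) ∘ₗ LinearMap.funLeft ℂ ℂ
      (fun x : I ⊕ₗ I => Sum.elim id id (ofLex x)) = LinearMap.id := by
    ext m j
    simp [LinearMap.funLeft_apply, inlEmb_apply]
  rw [this, ExteriorAlgebra.map_id]; rfl

/-- Integrating over `Θ` in `f(Ψ + Θ)` is the same as convolving `f` and then shifting. -/
theorem gauss_thetaCov_translate (A : Matrix I I ℂ) (x : Grassmann I) :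
    gauss (thetaCov A) (translate x) = translate (gauss A x) := by
  refine gauss_map _ (fun i j => ?_) x
  rw [covForm_apply]
  simp only [LinearMap.funLeft_apply, Pi.single_apply]
  have hsum : ∀ F : I ⊕ₗ I → ℂ, ∑ a, F a = ∑ i, F (inlEmb I i) + ∑ i, F (inrEmb I i) := fun F =>
    Fintype.sum_sum_type F
  simp only [hsum]
  simp [inlEmb_apply, inrEmb_apply, skewPart, thetaCov, Matrix.fromBlocks]
  have h : ∑ a, ∑ b, (if a = i then (1 : ℂ) else 0) * ((A a b - A b a) / 2) *
      (if b = j then 1 else 0) = (A i j - A j i) / 2 := by simp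
  exact h

/-- The convolution with `μ_A` is the operator `gauss A`. Integrating over `Θ` in `f(Ψ + Θ)` and then
putting `Θ = 0` computes both sides. -/
theorem convolve_eq_gauss (A : Matrix I I ℂ) (f : Grassmann I) : convolve A f = gauss A f := by
  rw [← map_funLeft_translate (gauss A f), ← gauss_thetaCov_translate]
  conv_rhs => rw [← sum_coeff (translate f)]
  rw [convolve, map_sum, map_sum,
    ← (Finset.sumEquiv.symm.toEquiv.trans (Equiv.finsetCongr (toLex : I ⊕ I ≃ I ⊕ₗ I))).sum_comp,
    Fintype.sum_prod_type]
  refine Finset.sum_congr rfl fun J _ => Finset.sum_congr rfl fun K _ => ?_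
  have hK : (Finset.sumEquiv.symm.toEquiv.trans
      (Equiv.finsetCongr (toLex : I ⊕ I ≃ I ⊕ₗ I))) (J, K) = pairIndex J K := rfl
  rw [hK, map_smul, map_smul, monomial_pairIndex, gauss_thetaCov_mul, map_mul,
    map_funLeft_map_relabel_inl, gauss_map_relabel (A := A), map_funLeft_map_relabel_inr,
    constTerm_gauss_monomial, ← Algebra.commutes, ← Algebra.smul_def, smul_smul]
  intro i j
  simp [inrEmb_apply, thetaCov]

end Convolution

/-! ### Hadamard's and Gram's determinant bounds -/

section Gram

open Module
open scoped MatrixOrder Matrix.Norms.L2Operator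

/-- Hadamard's inequality, by orthogonalization of the vectors. -/
theorem norm_det_le_prod_norm {E : Type*} [NormedAddCommGroup E] [InnerProductSpace ℂ E]
    [FiniteDimensional ℂ E] {p : ℕ} (b : OrthonormalBasis (Fin p) ℂ E) (f : Fin p → E) :
    ‖b.toBasis.det f‖ ≤ ∏ i, ‖f i‖ := by
  have h : finrank ℂ E = Fintype.card (Fin p) := finrank_eq_card_basis b.toBasis
  let g := InnerProductSpace.gramSchmidtOrthonormalBasis h f
  have h1 := InnerProductSpace.gramSchmidtOrthonormalBasis_det h f
  have h2 : b.toBasis.det f = b.toBasis.det g * g.toBasis.det f := by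
    have := congrArg (fun F => F f) (AlternatingMap.eq_smul_basis_det g.toBasis b.toBasis.det)
    simpa using this
  rw [h2, norm_mul, b.det_to_matrix_orthonormalBasis g, one_mul, h1, norm_prod]
  refine Finset.prod_le_prod (fun _ _ => norm_nonneg _) fun i _ => ?_
  refine (norm_inner_le_norm _ _).trans ?_
  rw [OrthonormalBasis.norm_eq_one, one_mul]

/-- Gram's bound. The determinant factors through an orthonormal basis of the span of `w`, onto
which the vectors `v` may be projected. -/
theorem norm_det_inner_le {E : Type*} [NormedAddCommGroup E] [InnerProductSpace ℂ E] {p : ℕ}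
    (v w : Fin p → E) :
    ‖(Matrix.of fun i j => inner ℂ (v i) (w j)).det‖ ≤ (∏ i, ‖v i‖) * ∏ i, ‖w i‖ := by
  by_cases hw : LinearIndependent ℂ w
  · let S := Submodule.span ℂ (Set.range w)
    have hS : finrank ℂ S = p := by simpa using finrank_span_eq_card hw
    have : FiniteDimensional ℂ S := FiniteDimensional.span_of_finite ℂ (Set.finite_range w)
    let b : OrthonormalBasis (Fin p) ℂ S := (stdOrthonormalBasis ℂ S).reindex (finCongr hS)
    let w' : Fin p → S := fun j => ⟨w j, Submodule.subset_span ⟨j, rfl⟩⟩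
    let v' : Fin p → S := fun i => S.orthogonalProjectionOnto (v i)
    have h1 : (Matrix.of fun i j => inner ℂ (v i) (w j)) =
        (b.toBasis.toMatrix v').conjTranspose * b.toBasis.toMatrix w' := by
      ext i j
      rw [Matrix.of_apply, Matrix.mul_apply]
      have h2 : inner ℂ (v i) (w j) = inner ℂ (v' i) (w' j) :=
        (Submodule.inner_orthogonalProjectionOnto_eq_of_mem_right (K := S) (w' j) (v i)).symm
      rw [h2, ← b.sum_inner_mul_inner]
      refine Finset.sum_congr rfl fun k _ => ?_
      simp [Matrix.conjTranspose_apply, Basis.toMatrix_apply, OrthonormalBasis.repr_apply_apply]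
    rw [h1, Matrix.det_mul, Matrix.det_conjTranspose, norm_mul, norm_star,
      ← Basis.det_apply, ← Basis.det_apply]
    refine mul_le_mul ((norm_det_le_prod_norm b v').trans ?_) (norm_det_le_prod_norm b w')
      (norm_nonneg _) (Finset.prod_nonneg fun _ _ => norm_nonneg _)
    exact Finset.prod_le_prod (fun _ _ => norm_nonneg _)
      fun i _ => Submodule.norm_orthogonalProjectionOnto_apply_le S (v i)
  · obtain ⟨g, hg, i, hi⟩ := Fintype.not_linearIndependent_iff.mp hw
    have : (Matrix.of fun i j => inner ℂ (v i) (w j)).det = 0 := by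
      refine Matrix.exists_mulVec_eq_zero_iff.mp ⟨g, fun h => hi (congrFun h i), ?_⟩
      ext a
      have h2 := congrArg (fun x => inner ℂ (v a) x) hg
      simp only [inner_sum, inner_smul_right, inner_zero_right] at h2
      simp only [Matrix.mulVec, dotProduct, Matrix.of_apply, Pi.zero_apply]
      rw [← h2]
      exact Finset.sum_congr rfl fun j _ => mul_comm _ _
    rw [this, norm_zero]
    exact mul_nonneg (Finset.prod_nonneg fun _ _ => norm_nonneg _)
      (Finset.prod_nonneg fun _ _ => norm_nonneg _)

/-- A difference of positive semidefinite matrices is the Gram matrix of the vectors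
`(x_a, y_a)` and `(x_b, -y_b)`. -/
theorem norm_det_sub_le {n p : ℕ} {P M : Matrix (Fin n) (Fin n) ℂ} (hP : P.PosSemidef)
    (hM : M.PosSemidef) {κ : ℝ} (hPκ : ∀ i, (P i i).re ≤ κ) (hMκ : ∀ i, (M i i).re ≤ κ)
    (a b : Fin p → Fin n) :
    ‖(Matrix.of fun i j => (P - M) (a i) (b j)).det‖ ≤ (2 * κ) ^ p := by
  obtain ⟨X, hX⟩ := CStarAlgebra.nonneg_iff_eq_star_mul_self.mp hP.nonneg
  obtain ⟨Y, hY⟩ := CStarAlgebra.nonneg_iff_eq_star_mul_self.mp hM.nonneg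
  rw [Matrix.star_eq_conjTranspose] at hX hY
  let v : Fin n → EuclideanSpace ℂ (Fin n ⊕ Fin n) := fun i =>
    WithLp.toLp 2 (Sum.elim (fun k => X k i) (fun k => Y k i))
  let w : Fin n → EuclideanSpace ℂ (Fin n ⊕ Fin n) := fun i =>
    WithLp.toLp 2 (Sum.elim (fun k => X k i) (fun k => -Y k i))
  have hvw : ∀ i j, inner ℂ (v i) (w j) = (P - M) i j := by
    intro i j
    rw [hX, hY]
    simp only [PiLp.inner_apply, Fintype.sum_sum_type, v, w, Matrix.sub_apply, Matrix.mul_apply,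
      Matrix.conjTranspose_apply]
    simp [sub_eq_add_neg, mul_comm]
  have hPd : ∀ i, (P i i).re = ∑ k, ‖X k i‖ ^ 2 := by
    intro i
    rw [hX]
    simp only [Matrix.mul_apply, Matrix.conjTranspose_apply, Complex.re_sum]
    refine Finset.sum_congr rfl fun k _ => ?_
    rw [Complex.star_def, ← Complex.normSq_eq_conj_mul_self, Complex.ofReal_re,
      Complex.normSq_eq_norm_sq]
  have hMd : ∀ i, (M i i).re = ∑ k, ‖Y k i‖ ^ 2 := by
    intro i
    rw [hY]
    simp only [Matrix.mul_apply, Matrix.conjTranspose_apply, Complex.re_sum]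
    refine Finset.sum_congr rfl fun k _ => ?_
    rw [Complex.star_def, ← Complex.normSq_eq_conj_mul_self, Complex.ofReal_re,
      Complex.normSq_eq_norm_sq]
  have hv : ∀ i, ‖v i‖ ≤ Real.sqrt (2 * κ) := by
    intro i
    refine Real.le_sqrt_of_sq_le ?_
    rw [EuclideanSpace.norm_sq_eq, Fintype.sum_sum_type]
    simp only [v, Sum.elim_inl, Sum.elim_inr]
    rw [← hPd, ← hMd]
    linarith [hPκ i, hMκ i]
  have hw : ∀ i, ‖w i‖ ≤ Real.sqrt (2 * κ) := by
    intro i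
    refine Real.le_sqrt_of_sq_le ?_
    rw [EuclideanSpace.norm_sq_eq, Fintype.sum_sum_type]
    simp only [w, Sum.elim_inl, Sum.elim_inr, norm_neg]
    rw [← hPd, ← hMd]
    linarith [hPκ i, hMκ i]
  have h1 := norm_det_inner_le (fun i => v (a i)) (fun j => w (b j))
  simp only [hvw] at h1
  refine h1.trans ?_
  rcases p with _ | p
  · simp
  have hκ : 0 ≤ κ := by
    refine le_trans ?_ (hPκ (a 0))
    rw [hPd]; positivity
  calc _ ≤ (∏ _i : Fin (p + 1), Real.sqrt (2 * κ)) * ∏ _i : Fin (p + 1), Real.sqrt (2 * κ) := by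
        refine mul_le_mul (Finset.prod_le_prod (fun _ _ => norm_nonneg _) fun i _ => hv _)
          (Finset.prod_le_prod (fun _ _ => norm_nonneg _) fun i _ => hw _)
          (Finset.prod_nonneg fun _ _ => norm_nonneg _) (by positivity)
    _ = (2 * κ) ^ (p + 1) := by
        rw [Finset.prod_const, Finset.card_univ, Fintype.card_fin, ← mul_pow,
          Real.mul_self_sqrt (by positivity)]

end Gram

/-! ### Gaussian integrals for a covariance in block form are minors -/

section Block

section

variable {I : Type} [Fintype I] [LinearOrder I]

/-- The product `ψ_{v 0} ⋯ ψ_{v (p-1)}`. -/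
def fieldProd {p : ℕ} (v : Fin p → I) : Grassmann I := (List.ofFn fun a => field (v a)).prod

theorem fieldProd_zero (v : Fin 0 → I) : fieldProd v = 1 := by simp [fieldProd]

theorem fieldProd_succ {p : ℕ} (v : Fin (p + 1) → I) :
    fieldProd v = field (v 0) * fieldProd (fun a => v a.succ) := by
  simp [fieldProd, List.ofFn_succ]

theorem parity_fieldProd {p : ℕ} (v : Fin p → I) :
    parity (fieldProd v) = (-1 : ℂ) ^ p • fieldProd v := by
  induction p with
  | zero => simp [fieldProd_zero]
  | succ p ih =>
    rw [fieldProd_succ, map_mul, ih, field, parity_ι, pow_succ]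
    simp [mul_comm]

theorem fieldDeriv_fieldProd (i : I) {p : ℕ} (v : Fin (p + 1) → I) :
    fieldDeriv i (fieldProd v) = ∑ r : Fin (p + 1), if v r = i then
      (-1 : ℂ) ^ (r : ℕ) • fieldProd (fun a => v (r.succAbove a)) else 0 := by
  induction p with
  | zero =>
    rw [fieldProd_succ, fieldDeriv_field_mul, fieldProd_zero, fieldDeriv_one]
    rw [mul_zero, sub_zero, Fin.sum_univ_succ, Fin.sum_univ_zero, add_zero]
    simp [fieldProd_zero, eq_comm]
  | succ p ih =>
    rw [fieldProd_succ, fieldDeriv_field_mul, ih,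
      Fin.sum_univ_succ (n := p + 1), sub_eq_add_neg, Finset.mul_sum, ← Finset.sum_neg_distrib]
    congr 1
    · simp [eq_comm]
    · refine Finset.sum_congr rfl fun r _ => ?_
      split_ifs
      · rw [fieldProd_succ (fun a => v (r.succ.succAbove a)), mul_smul_comm, ← neg_smul]
        simp only [Fin.succ_succAbove_zero, Fin.succ_succAbove_succ, Fin.val_succ]
        congr 1; ring
      · simp

theorem fieldDeriv_fieldProd_eq_zero {i : I} {p : ℕ} {v : Fin p → I} (h : ∀ a, v a ≠ i) :
    fieldDeriv i (fieldProd v) = 0 := by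
  rcases p with _ | p
  · rw [fieldProd_zero, fieldDeriv_one]
  · rw [fieldDeriv_fieldProd]
    exact Finset.sum_eq_zero fun r _ => if_neg (h r)

end

variable {n : ℕ}

theorem blockCov_skew {C : Matrix (Fin n) (Fin n) ℂ} (hC : C.IsSymm) (i j : Index n) :
    blockCov C j i = -blockCov C i j := by
  have h : ∀ a b, C a b = C b a := fun a b => hC.apply b a
  rcases hi : ofLex i with a | a <;> rcases hj : ofLex j with b | b <;>
    simp [blockCov, hi, hj, h a b]

theorem sum_index {M : Type*} [AddCommMonoid M] (F : Index n → M) :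
    ∑ a, F a = ∑ i, F (inlEmb (Fin n) i) + ∑ i, F (inrEmb (Fin n) i) :=
  Fintype.sum_sum_type F

/-- Integration by parts against the first field, which contracts with the second block only. -/
theorem constTerm_gauss_block_succ {C : Matrix (Fin n) (Fin n) ℂ} (hC : C.IsSymm) {p q : ℕ}
    (a : Fin (p + 1) → Fin n) (b : Fin q → Fin n) :
    constTerm (gauss (blockCov C) (fieldProd (fun i => inlEmb _ (a i)) *
      fieldProd (fun j => inrEmb _ (b j)))) =
      (-1) ^ p * ∑ c, C (a 0) c * constTerm (gauss (blockCov C)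
        (fieldProd (fun i => inlEmb _ (a (Fin.succ i))) *
          fieldDeriv (inrEmb _ c) (fieldProd (fun j => inrEmb _ (b j))))) := by
  rw [fieldProd_succ, mul_assoc, constTerm_gauss_field_mul, skewPart_of_skew (blockCov_skew hC),
    sum_index, Finset.sum_eq_zero, zero_add, Finset.mul_sum]
  · refine Finset.sum_congr rfl fun c _ => ?_
    rw [fieldDeriv_mul, fieldDeriv_fieldProd_eq_zero (by simp [inlEmb_apply, inrEmb_apply]),
      zero_mul, zero_add, parity_fieldProd, smul_mul_assoc, map_smul, map_smul, smul_eq_mul]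
    have : blockCov C (inlEmb _ (a 0)) (inrEmb _ c) = C (a 0) c := by
      simp [blockCov, inlEmb_apply, inrEmb_apply]
    rw [this]; ring
  · intro c _
    have : blockCov C (inlEmb _ (a 0)) (inlEmb _ c) = 0 := by
      simp [blockCov, inlEmb_apply]
    rw [this, zero_mul]

/-- Each contraction joins the two blocks, so unbalanced products integrate to zero. -/
theorem constTerm_gauss_block_of_ne {C : Matrix (Fin n) (Fin n) ℂ} (hC : C.IsSymm) {p q : ℕ}
    (hpq : p ≠ q) (a : Fin p → Fin n) (b : Fin q → Fin n) :
    constTerm (gauss (blockCov C) (fieldProd (fun i => inlEmb _ (a i)) *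
      fieldProd (fun j => inrEmb _ (b j)))) = 0 := by
  induction p generalizing q with
  | zero =>
    obtain ⟨q, rfl⟩ := Nat.exists_eq_succ_of_ne_zero hpq.symm
    rw [fieldProd_zero, one_mul, fieldProd_succ, constTerm_gauss_field_mul,
      skewPart_of_skew (blockCov_skew hC), sum_index, Finset.sum_eq_zero, Finset.sum_eq_zero,
      zero_add]
    · intro c _
      have : blockCov C (inrEmb _ (b 0)) (inrEmb _ c) = 0 := by
        simp [blockCov, inrEmb_apply]
      rw [this, zero_mul]
    · intro c _
      rw [fieldDeriv_fieldProd_eq_zero (by simp [inlEmb_apply, inrEmb_apply]), map_zero, map_zero,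
        mul_zero]
  | succ p ih =>
    rw [constTerm_gauss_block_succ hC, Finset.sum_eq_zero, mul_zero]
    intro c _
    rcases q with _ | q
    · rw [fieldProd_zero, fieldDeriv_one, mul_zero, map_zero, map_zero, mul_zero]
    · rw [fieldDeriv_fieldProd, Finset.mul_sum, map_sum, map_sum, Finset.sum_eq_zero, mul_zero]
      intro r _
      split_ifs
      · rw [mul_smul_comm, map_smul, map_smul, ih (by omega) (fun i => a i.succ), smul_zero]
      · rw [mul_zero, map_zero, map_zero]

/-- Integration by parts against the first field is the Laplace expansion of the minor along its
first row. -/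
theorem constTerm_gauss_block_eq_det {C : Matrix (Fin n) (Fin n) ℂ} (hC : C.IsSymm) (p : ℕ) :
    ∃ s : ℂ, ‖s‖ = 1 ∧ ∀ a b : Fin p → Fin n,
      constTerm (gauss (blockCov C) (fieldProd (fun i => inlEmb _ (a i)) *
        fieldProd (fun j => inrEmb _ (b j)))) = s * (Matrix.of fun i j => C (a i) (b j)).det := by
  induction p with
  | zero =>
    refine ⟨1, norm_one, fun a b => ?_⟩
    rw [fieldProd_zero, fieldProd_zero, ← map_one (algebraMap ℂ _), ← map_mul, gauss_algebraMap]
    simp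
  | succ p ih =>
    obtain ⟨s, hs, h⟩ := ih
    refine ⟨(-1) ^ p * s, by simp [hs], fun a b => ?_⟩
    rw [constTerm_gauss_block_succ hC, mul_assoc, Matrix.det_succ_row_zero]
    congr 1
    have h1 : ∀ c, constTerm (gauss (blockCov C) (fieldProd (fun i => inlEmb _ (a (Fin.succ i))) *
        fieldDeriv (inrEmb _ c) (fieldProd (fun j => inrEmb _ (b j))))) =
        ∑ r, if b r = c then (-1) ^ (r : ℕ) *
          (s * (Matrix.of fun i j => C (a (Fin.succ i)) (b (r.succAbove j))).det) else 0 := by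
      intro c
      rw [fieldDeriv_fieldProd, Finset.mul_sum, map_sum, map_sum]
      refine Finset.sum_congr rfl fun r _ => ?_
      simp only [EmbeddingLike.apply_eq_iff_eq]
      split_ifs
      · rw [mul_smul_comm, map_smul, map_smul, smul_eq_mul, h]
      · rw [mul_zero, map_zero, map_zero]
    simp only [h1, Finset.mul_sum]
    rw [Finset.sum_comm]
    refine Finset.sum_congr rfl fun r _ => ?_
    rw [Finset.sum_eq_single (b r) (fun c _ hc => by rw [if_neg hc.symm, mul_zero]) (by simp),
      if_pos rfl]
    have : (Matrix.of fun i j => C (a i) (b j)).submatrix Fin.succ r.succAbove =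
      Matrix.of fun i j => C (a (Fin.succ i)) (b (r.succAbove j)) := rfl
    rw [this, Matrix.of_apply]
    ring

theorem map_relabel_monomial_eq_fieldProd {I I' : Type} [Fintype I] [LinearOrder I] [Fintype I']
    [LinearOrder I'] (φ : I → I') (J : Finset I) :
    ExteriorAlgebra.map (relabel φ) (monomial J) =
      fieldProd (fun a => φ (J.orderEmbOfFin rfl a)) := by
  rw [monomial_eq_prod, map_list_prod, List.map_ofFn, fieldProd]
  congr 2
  funext a
  rw [Function.comp_apply, map_relabel_field]

/-- The Gram bound for the Gaussian integral of a monomial with fields `J` in the first and `K` in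
the second block. -/
theorem norm_constTerm_gauss_pairIndex_le {P M : Matrix (Fin n) (Fin n) ℂ} (hP : P.PosSemidef)
    (hM : M.PosSemidef) (hsymm : (P - M).IsSymm) {κ : ℝ} (hPκ : ∀ i, (P i i).re ≤ κ)
    (hMκ : ∀ i, (M i i).re ≤ κ) (J K : Finset (Fin n)) :
    ‖constTerm (gauss (blockCov (P - M)) (monomial (pairIndex J K)))‖ ≤
      if J.card = K.card then (2 * κ) ^ J.card else 0 := by
  rw [monomial_pairIndex, map_relabel_monomial_eq_fieldProd, map_relabel_monomial_eq_fieldProd]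
  split_ifs with h
  · obtain ⟨s, hs, h1⟩ := constTerm_gauss_block_eq_det hsymm J.card
    have h2 : ∀ (q : ℕ) (hq : J.card = q) (b : Fin q → Fin n),
        ‖constTerm (gauss (blockCov (P - M)) (fieldProd (fun i => inlEmb _ (J.orderEmbOfFin rfl i)) *
          fieldProd (fun j => inrEmb _ (b j))))‖ ≤ (2 * κ) ^ J.card := by
      rintro q rfl b
      rw [h1, norm_mul, hs, one_mul]
      exact norm_det_sub_le hP hM hPκ hMκ _ b
    exact h2 _ h _
  · rw [constTerm_gauss_block_of_ne hsymm h, norm_zero]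

end Block

/-! ### Exponentials and logarithms in the Grassmann algebra -/

section ExpLog

variable {I : Type} [Fintype I] [LinearOrder I]

/-- All components of degree less than `k` vanish. -/
def OrderGE (k : ℕ) (x : Grassmann I) : Prop := ∀ J : Finset I, J.card < k → coeff J x = 0

theorem OrderGE.mul {a b : ℕ} {x y : Grassmann I} (hx : OrderGE a x) (hy : OrderGE b y) :
    OrderGE (a + b) (x * y) := by
  intro J hJ
  rw [← sum_coeff x, ← sum_coeff y, Finset.sum_mul_sum, coeff_sum]
  refine Finset.sum_eq_zero fun P _ => ?_
  rw [coeff_sum]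
  refine Finset.sum_eq_zero fun Q _ => ?_
  rw [smul_mul_smul_comm, coeff_smul]
  by_cases hP : P.card < a
  · rw [hx P hP]; simp
  by_cases hQ : Q.card < b
  · rw [hy Q hQ]; simp
  by_cases hPQ : Disjoint P Q
  · obtain ⟨c, -, hc⟩ := monomial_mul_of_disjoint hPQ
    rw [hc, coeff_smul, coeff_monomial, if_neg, mul_zero, mul_zero]
    rintro rfl
    rw [Finset.card_union_of_disjoint hPQ] at hJ
    omega
  · rw [monomial_mul_of_not_disjoint hPQ, coeff_zero, mul_zero]

theorem orderGE_one {x : Grassmann I} (hx : constTerm x = 0) : OrderGE 1 x := by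
  intro J hJ
  obtain rfl : J = ∅ := by rw [← Finset.card_eq_zero]; omega
  rw [← constTerm_eq_coeff, hx]

theorem OrderGE.eq_zero {x : Grassmann I} (hx : OrderGE (Fintype.card I + 1) x) : x = 0 :=
  grassmann_ext fun J => by
    rw [hx J (by have := Finset.card_le_univ J; omega), coeff_zero]

theorem orderGE_pow {x : Grassmann I} (hx : constTerm x = 0) (k : ℕ) : OrderGE k (x ^ k) := by
  induction k with
  | zero => exact fun J hJ => absurd hJ (Nat.not_lt_zero _)
  | succ k ih => rw [pow_succ]; exact ih.mul (orderGE_one hx)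

theorem pow_card_mul_eq_zero {y z : Grassmann I} (hy : constTerm y = 0) (hz : constTerm z = 0) :
    y ^ Fintype.card I * z = 0 :=
  ((orderGE_pow hy _).mul (orderGE_one hz)).eq_zero

theorem isUnit_of_constTerm_eq_one {x : Grassmann I} (hx : constTerm x = 1) : IsUnit x := by
  have h : IsNilpotent (x - 1) :=
    ⟨Fintype.card I + 1, (orderGE_pow (by rw [map_sub, hx, map_one, sub_self]) _).eq_zero⟩
  simpa using h.isUnit_one_add

theorem IsEven.constTerm_fieldDeriv {x : Grassmann I} (hx : IsEven x) (i : I) :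
    constTerm (fieldDeriv i x) = 0 := by
  have := norm_coeff_fieldDeriv i ∅ x
  rw [if_neg (Finset.notMem_empty i), hx _ (by simp), norm_zero, norm_eq_zero] at this
  rw [constTerm_eq_coeff, this]

theorem isEven_applyFun (G : ℂ → ℂ) {x : Grassmann I} (hx : IsEven x) : IsEven (applyFun G x) :=
  IsEven.sum fun k _ => ((hx.sub (isEven_algebraMap _)).pow k).smul _

/-- The truncated power series `∑ c_k y ^ k`. -/
def powerSum (c : ℕ → ℂ) (N : ℕ) (y : Grassmann I) : Grassmann I :=
  ∑ k ∈ Finset.range N, c k • y ^ k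

theorem IsEven.powerSum {y : Grassmann I} (hy : IsEven y) (c : ℕ → ℂ) (N : ℕ) :
    IsEven (powerSum c N y) :=
  IsEven.sum fun k _ => (hy.pow k).smul _

theorem IsEven.fieldDeriv_pow {y : Grassmann I} (hy : IsEven y) (i : I) (k : ℕ) :
    fieldDeriv i (y ^ (k + 1)) = (k + 1 : ℂ) • (y ^ k * fieldDeriv i y) := by
  induction k with
  | zero => simp
  | succ k ih =>
    rw [pow_succ, (hy.pow _).fieldDeriv_mul, ih, smul_mul_assoc, mul_assoc,
      ← (hy.commute (fieldDeriv i y)).eq, ← mul_assoc, ← pow_succ]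
    push_cast
    module

theorem IsEven.fieldDeriv_powerSum {y : Grassmann I} (hy : IsEven y) (i : I) (c : ℕ → ℂ) (N : ℕ) :
    fieldDeriv i (GrassmannRG.powerSum c (N + 1) y) =
      GrassmannRG.powerSum (fun k => (k + 1) * c (k + 1)) N y * fieldDeriv i y := by
  rw [GrassmannRG.powerSum, Finset.sum_range_succ', map_add, map_sum, GrassmannRG.powerSum,
    Finset.sum_mul]
  rw [pow_zero, map_smul, fieldDeriv_one, smul_zero, add_zero]
  refine Finset.sum_congr rfl fun k _ => ?_
  rw [map_smul, hy.fieldDeriv_pow, smul_smul, smul_mul_assoc, mul_comm]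

theorem gexp_eq_powerSum (g : Grassmann I) :
    gexp g = powerSum (fun k => Complex.exp (constTerm g) / (k.factorial : ℂ))
      (Fintype.card I + 1) (g - algebraMap ℂ _ (constTerm g)) := by
  rw [gexp, applyFun, powerSum, constTerm_eq_coeff]
  refine Finset.sum_congr rfl fun k _ => ?_
  rw [iteratedDeriv_eq_iterate, Complex.iter_deriv_exp]

theorem constTerm_sub_algebraMap (g : Grassmann I) :
    constTerm (g - algebraMap ℂ (Grassmann I) (constTerm g)) = 0 := by
  rw [map_sub, constTerm_algebraMap, sub_self]

/-- The truncation is harmless: the last power of the nilpotent part annihilates `∂_i g`, which has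
no constant term because `g` is even. -/
theorem fieldDeriv_gexp {g : Grassmann I} (hg : IsEven g) (i : I) :
    fieldDeriv i (gexp g) = gexp g * fieldDeriv i g := by
  set y := g - algebraMap ℂ (Grassmann I) (constTerm g) with hy
  have hye : IsEven y := hg.sub (isEven_algebraMap _)
  have h1 : fieldDeriv i y = fieldDeriv i g := by rw [hy, map_sub, fieldDeriv_algebraMap, sub_zero]
  rw [gexp_eq_powerSum, ← hy, hye.fieldDeriv_powerSum, powerSum, powerSum,
    Finset.sum_range_succ, add_mul, h1, smul_mul_assoc (_ / _),
    pow_card_mul_eq_zero (constTerm_sub_algebraMap g) (hg.constTerm_fieldDeriv i), smul_zero,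
    add_zero]
  congr 1
  refine Finset.sum_congr rfl fun k _ => ?_
  congr 1
  rw [Nat.factorial_succ]
  have : (k.factorial : ℂ) ≠ 0 := by exact_mod_cast k.factorial_ne_zero
  have : (k + 1 : ℂ) ≠ 0 := by exact_mod_cast k.succ_ne_zero
  push_cast
  field_simp

theorem constTerm_powerSum (c : ℕ → ℂ) (N : ℕ) {y : Grassmann I} (hy : constTerm y = 0) :
    constTerm (powerSum c (N + 1) y) = c 0 := by
  rw [powerSum, Finset.sum_range_succ', map_add, map_sum, Finset.sum_eq_zero]
  · simp
  · intro k _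
    rw [map_smul, map_pow, hy]; simp

theorem constTerm_gexp (g : Grassmann I) : constTerm (gexp g) = Complex.exp (constTerm g) := by
  rw [gexp_eq_powerSum, constTerm_powerSum _ _ (constTerm_sub_algebraMap g)]
  simp

/-- The Taylor coefficients of the logarithm at `1`. -/
def logCoeff (k : ℕ) : ℂ := iteratedDeriv k Complex.log 1 / (k.factorial : ℂ)

theorem succ_mul_logCoeff_succ (k : ℕ) : (k + 1 : ℂ) * logCoeff (k + 1) = (-1) ^ k := by
  rw [logCoeff, iteratedDeriv_succ_log Complex.one_mem_slitPlane, one_zpow, mul_one]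
  have h3 : (k.factorial : ℂ) ≠ 0 := by exact_mod_cast k.factorial_ne_zero
  have h4 : (k + 1 : ℂ) ≠ 0 := by exact_mod_cast k.succ_ne_zero
  rw [Nat.factorial_succ]
  push_cast
  field_simp

theorem glog_eq_powerSum {x : Grassmann I} (hx : constTerm x = 1) :
    glog x = powerSum logCoeff (Fintype.card I + 1) (x - 1) := by
  rw [glog, applyFun, powerSum, ← constTerm_eq_coeff, hx, map_one]
  rfl

/-- The truncation of `∑ (-y) ^ k` inverts `x = 1 + y` up to a multiple of `y ^ |I|`, which
annihilates every `z` without constant term. -/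
theorem mul_powerSum_neg_one {x z : Grassmann I} (hx : constTerm x = 1) (hz : constTerm z = 0) :
    x * (powerSum (fun k => (-1) ^ k) (Fintype.card I) (x - 1) * z) = z := by
  have h1 : ∀ N : ℕ, x * powerSum (fun k => (-1) ^ k) N (x - 1) =
      1 - (-1 : ℂ) ^ N • (x - 1) ^ N := by
    intro N
    induction N with
    | zero => simp [powerSum]
    | succ N ih =>
      rw [powerSum, Finset.sum_range_succ, mul_add, ← powerSum, ih, mul_smul_comm]
      have : x * (x - 1) ^ N = (x - 1) ^ N + (x - 1) ^ (N + 1) := by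
        rw [pow_succ', sub_mul, one_mul]; abel
      rw [this, pow_succ (-1 : ℂ)]
      module
  rw [← mul_assoc, h1, sub_mul, one_mul, smul_mul_assoc,
    pow_card_mul_eq_zero (by rw [map_sub, hx, map_one, sub_self]) hz, smul_zero, sub_zero]

/-- `∂_i log x = x⁻¹ ∂_i x`. -/
theorem mul_fieldDeriv_glog {x : Grassmann I} (hx : IsEven x) (h1 : constTerm x = 1) (i : I) :
    x * fieldDeriv i (glog x) = fieldDeriv i x := by
  have h2 : fieldDeriv i (x - 1) = fieldDeriv i x := by rw [map_sub, fieldDeriv_one, sub_zero]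
  rw [glog_eq_powerSum h1, (hx.sub isEven_one).fieldDeriv_powerSum, h2]
  simp only [succ_mul_logCoeff_succ]
  exact mul_powerSum_neg_one h1 (hx.constTerm_fieldDeriv i)

/-- `log (e ^ {-f} / e ^ {-f₀}) = f₀ - f`, up to the constant term. -/
theorem coeff_glog_gexp {f : Grassmann I} (hf : IsEven f) {J : Finset I} (hJ : J ≠ ∅) :
    coeff J (-glog ((constTerm (gexp (-f)))⁻¹ • gexp (-f))) = coeff J f := by
  set x := (constTerm (gexp (-f)))⁻¹ • gexp (-f) with hx
  have h0 : constTerm (gexp (-f)) ≠ 0 := by rw [constTerm_gexp]; exact Complex.exp_ne_zero _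
  have hxe : IsEven x := (isEven_applyFun _ hf.neg).smul _
  have hx1 : constTerm x = 1 := by rw [hx, map_smul, smul_eq_mul, inv_mul_cancel₀ h0]
  have h2 : ∀ i, fieldDeriv i (glog x + f) = 0 := by
    intro i
    refine (isUnit_of_constTerm_eq_one hx1).mul_left_cancel ?_
    rw [map_add, mul_add, mul_fieldDeriv_glog hxe hx1, mul_zero, hx, map_smul,
      fieldDeriv_gexp hf.neg, map_neg, smul_mul_assoc, mul_neg, smul_neg, neg_add_cancel]
  have h3 := congrArg (coeff J) (eq_algebraMap_of_fieldDeriv_eq_zero h2)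
  rw [coeff_algebraMap, if_neg hJ, coeff_add] at h3
  rw [coeff_neg]
  linear_combination -h3

/-! ### The quadratic term of the flow equation -/

/-- The quadratic term `1/2 ∑ A_ij ∂_j F ∂_i F` of the flow equation. -/
def quadTerm (A : Matrix I I ℂ) (F : Grassmann I) : Grassmann I :=
  (1 / 2 : ℂ) • ∑ i, ∑ j, A i j • (fieldDeriv j F * fieldDeriv i F)

theorem quadTerm_neg (A : Matrix I I ℂ) (F : Grassmann I) : quadTerm A (-F) = quadTerm A F := by
  simp [quadTerm]

/-- The Hopf-Cole transformation: for `x = e ^ G`, `e ^ {-G} lap e ^ G` is `lap G` plus the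
quadratic term. -/
theorem lap_eq_mul {x : Grassmann I} (hx : IsEven x) (h1 : constTerm x = 1) (A : Matrix I I ℂ) :
    lap A x = x * (quadTerm A (glog x) + lap A (glog x)) := by
  have h2 : ∀ i j, fieldDeriv j (fieldDeriv i x) =
      x * (fieldDeriv j (glog x) * fieldDeriv i (glog x) + fieldDeriv j (fieldDeriv i (glog x))) := by
    intro i j
    conv_lhs => rw [← mul_fieldDeriv_glog hx h1 i]
    rw [hx.fieldDeriv_mul, ← mul_fieldDeriv_glog hx h1 j, mul_add, mul_assoc]
  rw [lap_apply, lap_apply, quadTerm, ← smul_add, mul_smul_comm]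
  simp only [h2, ← Finset.sum_add_distrib, ← smul_add, Finset.mul_sum, mul_smul_comm]

end ExpLog

/-! ### Inequalities for binomial coefficients -/

section Binomial

/-- The number of `s`-element subsets of a disjoint union of an `a`-element and a `b`-element set
that meet the former in an even number of points. -/
def evenCount (a b s : ℕ) : ℕ :=
  ∑ j ∈ Finset.range (s + 1), if Even j then a.choose j * b.choose (s - j) else 0

theorem evenCount_zero (a b : ℕ) : evenCount a b 0 = 1 := by simp [evenCount]

theorem evenCount_succ_succ (a b s : ℕ) :
    evenCount a (b + 1) (s + 1) = evenCount a b (s + 1) + evenCount a b s := by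
  rw [evenCount, evenCount, evenCount, Finset.sum_range_succ, Finset.sum_range_succ _ (s + 1),
    add_right_comm, ← Finset.sum_add_distrib]
  congr 1
  · refine Finset.sum_congr rfl fun j hj => ?_
    rw [Finset.mem_range] at hj
    rw [show s + 1 - j = (s - j) + 1 by omega, Nat.choose_succ_succ]
    split_ifs
    · ring
    · rfl
  · simp

theorem evenCount_add_two (a b s : ℕ) :
    evenCount a (b + 2) (s + 2) =
      evenCount a b (s + 2) + 2 * evenCount a b (s + 1) + evenCount a b s := by
  rw [evenCount_succ_succ, evenCount_succ_succ, evenCount_succ_succ]; ring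

theorem evenCount_add_two_one (a b : ℕ) :
    evenCount a (b + 2) 1 = evenCount a b 1 + 2 * evenCount a b 0 := by
  rw [evenCount_succ_succ a (b + 1) 0, evenCount_succ_succ a b 0]
  simp only [evenCount_zero]

theorem evenCount_comm_of_even (a b : ℕ) {s : ℕ} (hs : Even s) :
    evenCount a b s = evenCount b a s := by
  rw [evenCount, ← Finset.sum_range_reflect, evenCount]
  refine Finset.sum_congr rfl fun j hj => ?_
  rw [Finset.mem_range] at hj
  have h1 : s + 1 - 1 - j = s - j := by omega
  have h2 : s - (s - j) = j := by omega
  have h3 : Even (s - j) ↔ Even j := by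
    rw [Nat.even_sub (by omega)]; simp [hs]
  rw [h1, h2, mul_comm]
  simp only [h3]

theorem le_evenCount {a b s j : ℕ} (hj : Even j) (hjs : j ≤ s) :
    a.choose j * b.choose (s - j) ≤ evenCount a b s := by
  have h := Finset.single_le_sum (s := Finset.range (s + 1))
    (f := fun j => if Even j then a.choose j * b.choose (s - j) else 0)
    (fun _ _ => Nat.zero_le _) (Finset.mem_range.mpr (by omega : j < s + 1))
  rw [evenCount]
  simpa only [if_pos hj] using h

/-- The ratio of the two sides of Newton's inequality for binomial coefficients. -/
theorem choose_mul_choose_mul (N r : ℕ) :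
    N.choose r * N.choose (r + 2) * ((N - r) * (r + 2)) =
      N.choose (r + 1) ^ 2 * ((r + 1) * (N - (r + 1))) := by
  have h1 := Nat.choose_succ_right_eq N r
  have h2 := Nat.choose_succ_right_eq N (r + 1)
  calc _ = (N.choose r * (N - r)) * (N.choose (r + 2) * (r + 2)) := by ring
    _ = (N.choose (r + 1) * (r + 1)) * (N.choose (r + 1) * (N - (r + 1))) := by rw [← h1, ← h2]
    _ = _ := by ring

/-- Binomial coefficients are log-concave. -/
theorem choose_mul_choose_le_sq (N r : ℕ) :
    N.choose r * N.choose (r + 2) ≤ N.choose (r + 1) ^ 2 := by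
  rcases Nat.lt_or_ge r N with h | h
  · refine Nat.le_of_mul_le_mul_right (c := (N - r) * (r + 2)) ?_ (by
      have : 0 < N - r := by omega
      positivity)
    rw [choose_mul_choose_mul]
    refine Nat.mul_le_mul_left _ ?_
    rw [mul_comm (N - r)]
    exact Nat.mul_le_mul (by omega) (by omega)
  · rw [Nat.choose_eq_zero_of_lt (show N < r + 2 by omega)]; simp

/-- A converse to log-concavity with constant `4`. -/
theorem choose_sq_le_four_mul {N r : ℕ} (h : r + 1 < N) :
    N.choose (r + 1) ^ 2 ≤ 4 * (N.choose r * N.choose (r + 2)) := by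
  obtain ⟨y, rfl⟩ : ∃ y, N = r + 2 + y := ⟨N - (r + 2), by omega⟩
  have h1 := choose_mul_choose_mul (r + 2 + y) r
  have e1 : r + 2 + y - r = y + 2 := by omega
  have e2 : r + 2 + y - (r + 1) = y + 1 := by omega
  rw [e1, e2] at h1
  refine Nat.le_of_mul_le_mul_right (c := (r + 1) * (y + 1)) ?_ (by positivity)
  rw [← h1]
  have : (y + 2) * (r + 2) ≤ 4 * ((r + 1) * (y + 1)) := by nlinarith
  calc _ ≤ (r + 2 + y).choose r * (r + 2 + y).choose (r + 2) * (4 * ((r + 1) * (y + 1))) :=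
        Nat.mul_le_mul_left _ this
    _ = _ := by ring

/-- The bounds `C(N, r) ^ 2 ≤ 2 ^ r evenCount (2r)` and
`C(N, r + 1) C(N, r) ≤ 2 ^ (r + 1) evenCount (2r + 1)` for `N` the mean of `a ≤ b`, by induction on
`b` in steps of two. For `b = a` one or two middle summands of `evenCount` are large enough; the
step is the recursion `evenCount_add_two` and Pascal's rule. -/
theorem choose_le_evenCount (a d : ℕ) :
    (∀ r, r < a + d → (a + d).choose r ^ 2 ≤ 2 ^ r * evenCount a (a + 2 * d) (2 * r)) ∧
    ∀ r, (a + d).choose (r + 1) * (a + d).choose r ≤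
      2 ^ (r + 1) * evenCount a (a + 2 * d) (2 * r + 1) := by
  induction d with
  | zero =>
    simp only [Nat.mul_zero, Nat.add_zero]
    constructor
    · intro r hr
      rcases Nat.even_or_odd r with he | ho
      · have h1 := le_evenCount (a := a) (b := a) he (show r ≤ 2 * r by omega)
        rw [show 2 * r - r = r by omega, ← sq] at h1
        exact h1.trans (Nat.le_mul_of_pos_left _ (by positivity))
      · obtain ⟨r, rfl⟩ : ∃ r', r = r' + 1 := ⟨r - 1, by have := ho.pos; omega⟩
        have he : Even r := by simpa [parity_simps] using ho
        have h1 : a.choose r * a.choose (r + 2) + a.choose (r + 2) * a.choose r ≤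
            evenCount a a (2 * (r + 1)) := by
          rw [evenCount]
          have hsub : ({r, r + 2} : Finset ℕ) ⊆ Finset.range (2 * (r + 1) + 1) := by
            intro x hx
            simp only [Finset.mem_insert, Finset.mem_singleton] at hx
            rw [Finset.mem_range]; omega
          refine le_trans (le_of_eq ?_) (Finset.sum_le_sum_of_subset hsub)
          rw [Finset.sum_pair (by omega), if_pos he, if_pos (by simpa [parity_simps] using he),
            show 2 * (r + 1) - r = r + 2 by omega, show 2 * (r + 1) - (r + 2) = r by omega]
        have h2 := choose_sq_le_four_mul hr
        calc _ ≤ 2 * (a.choose r * a.choose (r + 2) + a.choose (r + 2) * a.choose r) := by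
              refine h2.trans (le_of_eq ?_); ring
          _ ≤ 2 ^ (r + 1) * evenCount a a (2 * (r + 1)) := by
              refine Nat.mul_le_mul ?_ h1
              rw [pow_succ]; have := Nat.one_le_two_pow (n := r); omega
    · intro r
      refine le_trans ?_ (Nat.le_mul_of_pos_left _ (by positivity))
      rcases Nat.even_or_odd r with he | ho
      · have h1 := le_evenCount (a := a) (b := a) he (show r ≤ 2 * r + 1 by omega)
        rw [show 2 * r + 1 - r = r + 1 by omega] at h1
        rw [mul_comm]; exact h1
      · have h1 := le_evenCount (a := a) (b := a) (j := r + 1) (by simpa [parity_simps] using ho)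
          (show r + 1 ≤ 2 * r + 1 by omega)
        rwa [show 2 * r + 1 - (r + 1) = r by omega] at h1
  | succ d ih =>
    obtain ⟨ih1, ih2⟩ := ih
    have hb : a + 2 * (d + 1) = a + 2 * d + 2 := by ring
    have hN : a + (d + 1) = a + d + 1 := by ring
    rw [hb, hN]
    set b := a + 2 * d
    set N := a + d
    have hu : ∀ r, r < N → N.choose (r + 1) ≤ N.choose r ∨ r + 1 < N := by
      intro r hr
      by_cases h : r + 1 < N
      · exact Or.inr h
      · have : r + 1 = N := by omega
        left
        rw [this, Nat.choose_self]
        exact Nat.choose_pos hr.le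
    constructor
    · intro r hr
      rcases r with _ | r
      · simp [evenCount_zero]
      · have hr' : r < N := by omega
        rw [show 2 * (r + 1) = 2 * r + 2 by ring, evenCount_add_two, Nat.choose_succ_succ, pow_succ 2 r]
        have h1 := ih1 r hr'
        have h2 := ih2 r
        rw [pow_succ 2 r] at h2
        simp only [Nat.succ_eq_add_one]
        rcases hu r hr' with h | h
        · have h3 : N.choose (r + 1) ^ 2 ≤ N.choose r ^ 2 := Nat.pow_le_pow_left h 2
          nlinarith [Nat.zero_le (2 ^ r * evenCount a b (2 * r + 2))]
        · have h3 := ih1 (r + 1) h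
          rw [pow_succ 2 r, show 2 * (r + 1) = 2 * r + 2 by ring] at h3
          nlinarith
    · intro r
      rcases r with _ | r
      · have h2 := ih2 0
        simp only [Nat.choose_one_right, Nat.choose_zero_right, zero_add, mul_one, mul_zero] at h2 ⊢
        rw [evenCount_add_two_one, evenCount_zero]
        omega
      · rw [show 2 * (r + 1) + 1 = 2 * r + 1 + 2 by ring, evenCount_add_two,
          Nat.choose_succ_succ N (r + 1), Nat.choose_succ_succ N r]
        have h1 := ih2 r
        have h2 := ih2 (r + 1)
        have h3 := choose_mul_choose_le_sq N r
        rw [show 2 * (r + 1) + 1 = 2 * r + 3 by ring] at h2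
        rw [show 2 * r + 1 + 2 = 2 * r + 3 by ring, show 2 * r + 1 + 1 = 2 * r + 2 by ring]
        simp only [Nat.succ_eq_add_one, show r + 1 + 1 = r + 2 by ring] at *
        have e : 2 ^ (r + 2) = 2 ^ (r + 1) * 2 := pow_succ 2 (r + 1)
        rcases Nat.lt_or_ge r N with hr' | hr'
        · rcases hu r hr' with h | h
          · have h4 : N.choose (r + 1) ^ 2 ≤ N.choose (r + 1) * N.choose r := by
              rw [sq]; exact Nat.mul_le_mul_left _ h
            rcases Nat.lt_or_ge (r + 1) N with hr2 | hr2
            · have h5 := ih1 (r + 1) hr2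
              rw [show 2 * (r + 1) = 2 * r + 2 by ring] at h5
              nlinarith
            · have h5 : N.choose (r + 2) = 0 := Nat.choose_eq_zero_of_lt (by omega)
              rw [h5]
              nlinarith [Nat.zero_le (2 ^ (r + 1) * evenCount a b (2 * r + 3)),
                Nat.zero_le (2 ^ (r + 1) * evenCount a b (2 * r + 2))]
          · have h5 := ih1 (r + 1) h
            rw [show 2 * (r + 1) = 2 * r + 2 by ring] at h5
            nlinarith
        · have h5 : N.choose (r + 2) = 0 := Nat.choose_eq_zero_of_lt (by omega)
          have h6 : N.choose (r + 1) = 0 := Nat.choose_eq_zero_of_lt (by omega)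
          rw [h5, h6]; simp

theorem choose_sq_le_evenCount {a b N r : ℕ} (ha : Odd a) (hb : Odd b) (hN : a + b = 2 * N)
    (hr : r < N) : N.choose r ^ 2 ≤ 2 ^ r * evenCount a b (2 * r) := by
  wlog hab : a ≤ b generalizing a b
  · rw [evenCount_comm_of_even a b (even_two_mul r)]
    exact this hb ha (by omega) (by omega)
  obtain ⟨d, rfl⟩ : ∃ d, b = a + 2 * d := by
    obtain ⟨x, rfl⟩ := ha; obtain ⟨y, rfl⟩ := hb
    exact ⟨y - x, by omega⟩
  obtain rfl : N = a + d := by omega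
  exact (choose_le_evenCount a d).1 r hr

/-- Passing to complements, the sum over odd `k'`, `k''` in `Gam` counts subsets that meet both
parts evenly. -/
theorem evenCount_le_sum_odd {a b k r : ℕ} (ha : Odd a) (hb : Odd b)
    (h : a + b = 2 * k + 2 * r) : evenCount a b (2 * r) ≤
      ∑ p ∈ Finset.HasAntidiagonal.antidiagonal (2 * k) with Odd p.1 ∧ Odd p.2,
        a.choose p.1 * b.choose p.2 := by
  set S := (Finset.range (2 * r + 1)).filter fun j => Even j ∧ j ≤ a ∧ 2 * r - j ≤ b with hS
  have h1 : evenCount a b (2 * r) = ∑ j ∈ S, a.choose j * b.choose (2 * r - j) := by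
    rw [evenCount, hS, Finset.sum_filter]
    refine Finset.sum_congr rfl fun j _ => ?_
    by_cases h1 : j ≤ a
    · by_cases h2 : 2 * r - j ≤ b
      · simp [h1, h2]
      · simp [h2, Nat.choose_eq_zero_of_lt (not_le.mp h2)]
    · simp [h1, Nat.choose_eq_zero_of_lt (not_le.mp h1)]
  have hinj : Set.InjOn (fun j => (a - j, b - (2 * r - j))) (S : Set ℕ) := by
    intro x hx y hy hxy
    have hx' := (Finset.mem_filter.mp (Finset.mem_coe.mp hx)).2
    have hy' := (Finset.mem_filter.mp (Finset.mem_coe.mp hy)).2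
    have := congrArg Prod.fst hxy
    simp only at this
    omega
  have h2 : ∑ j ∈ S, a.choose j * b.choose (2 * r - j) =
      ∑ p ∈ S.image (fun j => (a - j, b - (2 * r - j))), a.choose p.1 * b.choose p.2 := by
    rw [Finset.sum_image hinj]
    refine Finset.sum_congr rfl fun j hj => ?_
    have hj' := (Finset.mem_filter.mp hj).2
    rw [Nat.choose_symm hj'.2.1, Nat.choose_symm hj'.2.2]
  rw [h1, h2]
  refine Finset.sum_le_sum_of_subset fun p hp => ?_
  obtain ⟨j, hj, rfl⟩ := Finset.mem_image.mp hp
  obtain ⟨hj1, hj2, hj3, hj4⟩ := Finset.mem_filter.mp hj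
  rw [Finset.mem_range] at hj1
  rw [Finset.mem_filter, Finset.HasAntidiagonal.mem_antidiagonal]
  obtain ⟨x, hx⟩ := ha
  obtain ⟨y, hy⟩ := hb
  obtain ⟨z, hz⟩ := hj2
  refine ⟨by simp only; omega, ⟨x - z, by simp only; omega⟩, ⟨y - (r - z), by simp only; omega⟩⟩

theorem choose_succ_mul_choose_le {p q : ℕ} (r : ℕ) (h : q ≤ p) :
    (p + 1).choose r * q.choose r ≤ p.choose r * (q + 1).choose r := by
  rcases Nat.lt_or_ge q r with hr | hr
  · rw [Nat.choose_eq_zero_of_lt hr]; simp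
  · have h1 := Nat.choose_mul_succ_eq p r
    have h2 := Nat.choose_mul_succ_eq q r
    refine Nat.le_of_mul_le_mul_right (c := (p + 1 - r) * (q + 1 - r)) ?_ (by
      have : 0 < p + 1 - r := by omega
      have : 0 < q + 1 - r := by omega
      positivity)
    have h3 : (p + 1) * (q + 1 - r) ≤ (q + 1) * (p + 1 - r) := by
      obtain ⟨e, rfl⟩ := Nat.exists_eq_add_of_le hr
      obtain ⟨g, rfl⟩ := Nat.exists_eq_add_of_le h
      rw [show r + e + 1 - r = e + 1 by omega, show r + e + g + 1 - r = e + g + 1 by omega]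
      nlinarith
    calc (p + 1).choose r * q.choose r * ((p + 1 - r) * (q + 1 - r))
        = ((p + 1).choose r * (p + 1 - r)) * (q.choose r * (q + 1 - r)) := by ring
      _ = p.choose r * q.choose r * ((p + 1) * (q + 1 - r)) := by rw [← h1]; ring
      _ ≤ p.choose r * q.choose r * ((q + 1) * (p + 1 - r)) := Nat.mul_le_mul_left _ h3
      _ = p.choose r * (q.choose r * (q + 1)) * (p + 1 - r) := by ring
      _ = p.choose r * (q + 1).choose r * ((p + 1 - r) * (q + 1 - r)) := by rw [h2]; ring

/-- Among blocks of sizes `p + q = 2N - 1`, the number of pairs of `r`-element subsets is largest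
for blocks of nearly equal sizes. -/
theorem choose_mul_choose_le {p q N : ℕ} (r : ℕ) (h : p + q + 1 = 2 * N) :
    p.choose r * q.choose r ≤ (N - 1).choose r * N.choose r := by
  wlog hpq : q ≤ p generalizing p q
  · rw [mul_comm]; exact this (by omega) (by omega)
  obtain ⟨d, hd⟩ : ∃ d, p = N + d := ⟨p - N, by omega⟩
  induction d generalizing p q with
  | zero =>
    obtain rfl : p = N := by omega
    obtain rfl : q = p - 1 := by omega
    rw [mul_comm]
  | succ d ih =>
    obtain rfl : p = N + d + 1 := by omega
    exact (choose_succ_mul_choose_le r (by omega)).trans (ih (by omega) (by omega) rfl)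

/-- The combinatorial bound behind `Gam`. With `N = k + r`, the left side is
`4 l m C(N, r)² (ξ² / 2) ^ r`, as `(N / k) C(N - 1, r) = C(N, r)`; it arises from
`C(N - 1, r) C(N, r)` balanced contractions of `2r` legs for each external leg. -/
theorem choose_mul_choose_le_Gam {k l m r : ℕ} (hl : 1 ≤ l) (hm : 1 ≤ m) (hk : 1 ≤ k)
    (h : l + m = k + r + 1) {ξ : ℝ} (hξ : 0 ≤ ξ) :
    4 * (l : ℝ) * m * ((k + r : ℝ) / k * ((k + r - 1).choose r * (k + r).choose r : ℝ)) *
      (ξ ^ 2 / 2) ^ r ≤ Gam k l m ξ := by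
  have h1 : (k + r : ℝ) / k * ((k + r - 1).choose r : ℝ) = ((k + r).choose r : ℝ) := by
    obtain ⟨k, rfl⟩ : ∃ k', k = k' + 1 := ⟨k - 1, by omega⟩
    have h2 := Nat.choose_mul_succ_eq (k + r) r
    rw [show k + r + 1 - r = k + 1 by omega] at h2
    have h3 : ((k + r).choose r : ℝ) * (k + r + 1) = ((k + r + 1).choose r : ℝ) * (k + 1) := by
      exact_mod_cast h2
    rw [show k + 1 + r - 1 = k + r by omega, show k + 1 + r = k + r + 1 by omega]
    push_cast
    field_simp
    linear_combination h3
  have h4 : ((k + r).choose r : ℝ) ^ 2 ≤ 2 ^ r *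
      ∑ p ∈ Finset.HasAntidiagonal.antidiagonal (2 * k) with Odd p.1 ∧ Odd p.2,
        ((2 * l - 1).choose p.1 : ℝ) * ((2 * m - 1).choose p.2 : ℝ) := by
    have ha : Odd (2 * l - 1) := ⟨l - 1, by omega⟩
    have hb : Odd (2 * m - 1) := ⟨m - 1, by omega⟩
    have := (choose_sq_le_evenCount ha hb (N := k + r) (r := r) (by omega) (by omega)).trans
      (Nat.mul_le_mul_left _ (evenCount_le_sum_odd (k := k) ha hb (by omega)))
    exact_mod_cast this
  have h5 : Gam k l m ξ = 4 * (l : ℝ) * m * (ξ ^ (2 * r) *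
      ∑ p ∈ Finset.HasAntidiagonal.antidiagonal (2 * k) with Odd p.1 ∧ Odd p.2,
        ((2 * l - 1).choose p.1 : ℝ) * ((2 * m - 1).choose p.2 : ℝ)) := by
    rw [Gam]
    congr 1
    rw [Finset.mul_sum]
    refine Finset.sum_congr rfl fun p hp => ?_
    have hp1 := Finset.HasAntidiagonal.mem_antidiagonal.mp (Finset.mem_filter.mp hp).1
    by_cases h6 : p.1 ≤ 2 * l - 1
    · by_cases h7 : p.2 ≤ 2 * m - 1
      · have : ξ ^ (2 * r) = ξ ^ (2 * l - 1 - p.1) * ξ ^ (2 * m - 1 - p.2) := by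
          rw [← pow_add]; congr 1; omega
        rw [this]; ring
      · rw [Nat.choose_eq_zero_of_lt (not_le.mp h7)]; simp
    · rw [Nat.choose_eq_zero_of_lt (not_le.mp h6)]; simp
  rw [h5, ← mul_assoc ((k + r : ℝ) / k), h1, mul_assoc]
  refine mul_le_mul_of_nonneg_left ?_ (by positivity)
  rw [← sq, div_pow, ← pow_mul]
  have h8 : (0 : ℝ) < 2 ^ r := by positivity
  calc _ = ((k + r).choose r : ℝ) ^ 2 / 2 ^ r * ξ ^ (2 * r) := by ring
    _ ≤ _ := by
      rw [mul_comm (ξ ^ (2 * r))]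
      refine mul_le_mul_of_nonneg_right ?_ (by positivity)
      rw [div_le_iff₀ h8]
      linarith

end Binomial

/-! ### Norm estimates -/

section Estimates

variable {I : Type} [Fintype I] [LinearOrder I]

/-- Up to sign, the coefficient `J` of `μ_A * Ψ_U` is the Gaussian integral of the remaining fields
`U \ J`, as derivatives commute with convolution. -/
theorem norm_coeff_gauss_monomial (A : Matrix I I ℂ) (J U : Finset I) :
    ‖coeff J (gauss A (monomial U))‖ =
      if J ⊆ U then ‖constTerm (gauss A (monomial (U \ J)))‖ else 0 := by
  induction J using Finset.induction_on generalizing U with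
  | empty => simp [constTerm_eq_coeff]
  | insert i J hi ih =>
    have h := norm_coeff_fieldDeriv i J (gauss A (monomial U))
    rw [if_neg hi] at h
    rw [← h, ← gauss_fieldDeriv]
    by_cases hU : i ∈ U
    · obtain ⟨c, hc, h1⟩ := fieldDeriv_monomial_of_mem hU
      rw [h1, map_smul, coeff_smul, norm_mul, hc, one_mul, ih]
      have e1 : U.erase i \ J = U \ insert i J := by grind
      have e2 : J ⊆ U.erase i ↔ insert i J ⊆ U := by grind
      rw [e1]
      simp only [e2]
    · rw [fieldDeriv_monomial_of_notMem hU, map_zero, coeff_zero, norm_zero, if_neg]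
      exact fun h => hU (h (Finset.mem_insert_self i J))

/-- Passage from the external legs `J ∋ x` of a vertex `U` to the contracted legs `U \ J`. -/
theorem sum_subset_eq_sum_compl {U : Finset I} {x : I} (hx : x ∈ U) {p : ℕ} (hp : p ≤ U.card)
    (h : Finset I → ℝ) :
    (∑ J : Finset I with x ∈ J ∧ J.card = p, if J ⊆ U then h (U \ J) else 0) =
      ∑ M ∈ (U.erase x).powersetCard (U.card - p), h M := by
  rw [← Finset.sum_filter, Finset.filter_filter]
  refine Finset.sum_nbij' (fun J => U \ J) (fun M => U \ M) ?_ ?_ ?_ ?_ ?_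
  · intro J hJ
    simp only [Finset.mem_filter, Finset.mem_univ, true_and] at hJ
    rw [Finset.mem_powersetCard, Finset.card_sdiff_of_subset hJ.2, hJ.1.2]
    exact ⟨by grind, rfl⟩
  · intro M hM
    rw [Finset.mem_powersetCard] at hM
    have hMU : M ⊆ U := hM.1.trans (Finset.erase_subset x U)
    simp only [Finset.mem_filter, Finset.mem_univ, true_and]
    rw [Finset.card_sdiff_of_subset hMU, hM.2]
    exact ⟨⟨by grind, by omega⟩, Finset.sdiff_subset⟩
  · intro J hJ
    simp only [Finset.mem_filter, Finset.mem_univ, true_and] at hJ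
    exact Finset.sdiff_sdiff_eq_self hJ.2
  · intro M hM
    rw [Finset.mem_powersetCard] at hM
    exact Finset.sdiff_sdiff_eq_self (hM.1.trans (Finset.erase_subset x U))
  · intro J _; rfl

theorem sum_eq_sum_even_card {n : ℕ} (hn : Fintype.card I = 2 * n) (h : Finset I → ℝ)
    (h0 : h ∅ = 0) (hodd : ∀ L : Finset I, Odd L.card → h L = 0) :
    ∑ L, h L = ∑ l ∈ Finset.Icc 1 n, ∑ L : Finset I with L.card = 2 * l, h L := by
  have h1 : ∀ L, h L = ∑ l ∈ Finset.Icc 1 n, if L.card = 2 * l then h L else 0 := by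
    intro L
    rcases Nat.even_or_odd L.card with ⟨c, hc⟩ | ho
    · by_cases hc0 : c = 0
      · obtain rfl : L = ∅ := by rw [← Finset.card_eq_zero]; omega
        simp [h0]
      · have := Finset.card_le_univ L
        rw [Finset.sum_eq_single c, if_pos (by omega)]
        · intro l _ hl
          rw [if_neg (by omega)]
        · intro hc'
          exact absurd (Finset.mem_Icc.mpr ⟨by omega, by omega⟩) hc'
    · simp [hodd L ho]
  rw [Finset.sum_congr rfl fun L _ => h1 L, Finset.sum_comm]
  exact Finset.sum_congr rfl fun l _ => (Finset.sum_filter _ _).symm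

theorem sum_norm_coeff_le {l : ℕ} (hl : 1 ≤ l) (F : Grassmann I) (y : I) :
    ∑ L : Finset I with y ∈ L ∧ L.card = 2 * l, ‖coeff L F‖ ≤ 2 * l * normCoeff l F := by
  have h := le_ciSup (f := fun i : I => (1 / (2 * (l : ℝ))) *
    ∑ J : Finset I with i ∈ J ∧ J.card = 2 * l, ‖coeff J F‖) (Set.finite_range _).bddAbove y
  have hl' : (0 : ℝ) < 2 * l := by positivity
  rw [← normCoeff] at h
  calc _ = 2 * l * ((1 / (2 * (l : ℝ))) *
        ∑ J : Finset I with y ∈ J ∧ J.card = 2 * l, ‖coeff J F‖) := by field_simp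
    _ ≤ _ := mul_le_mul_of_nonneg_left h hl'.le

theorem normCoeff_nonneg (m : ℕ) (f : Grassmann I) : 0 ≤ normCoeff m f :=
  Real.iSup_nonneg fun _ => mul_nonneg (by positivity) (Finset.sum_nonneg fun _ _ => norm_nonneg _)

theorem normCoeff_le {m : ℕ} {f : Grassmann I} {b : ℝ} (hb : 0 ≤ b)
    (h : ∀ x, (1 / (2 * (m : ℝ))) *
      ∑ J : Finset I with x ∈ J ∧ J.card = 2 * m, ‖coeff J f‖ ≤ b) : normCoeff m f ≤ b := by
  rcases isEmpty_or_nonempty I with hI | hI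
  · rw [normCoeff, Real.iSup_of_isEmpty]; exact hb
  · exact ciSup_le h

/-- The convolution bound: if `|E[Ψ_M]| ≤ ξ ^ |M|`, then convolution maps coefficients of degree
`2m` to degree `2k` at the cost of `C(2m, 2k) ξ ^ {2(m-k)}`. -/
theorem normCoeff_gauss_le {n : ℕ} (hn : Fintype.card I = 2 * n) {A : Matrix I I ℂ} {ξ : ℝ}
    (hξ : 0 ≤ ξ) (hA : ∀ (M : Finset I) (r : ℕ), M.card = 2 * r →
      ‖constTerm (gauss A (monomial M))‖ ≤ ξ ^ (2 * r)) {f : Grassmann I} (hf : IsEven f) {k : ℕ}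
    (hk : 1 ≤ k) (x : I) :
    (1 / (2 * (k : ℝ))) *
      ∑ J : Finset I with x ∈ J ∧ J.card = 2 * k, ‖coeff J (gauss A f)‖ ≤
      ∑ m ∈ Finset.Icc k n, normCoeff m f * ((2 * m).choose (2 * k) : ℝ) * ξ ^ (2 * (m - k)) := by
  let w : Finset I → ℝ := fun M => ‖constTerm (gauss A (monomial M))‖
  let T : Finset I → ℝ := fun U =>
    ∑ J : Finset I with x ∈ J ∧ J.card = 2 * k, if J ⊆ U then w (U \ J) else 0
  have hT0 : ∀ U, x ∉ U → T U = 0 := fun U hU => Finset.sum_eq_zero fun J hJ => by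
    rw [if_neg]; exact fun h => hU (h (Finset.mem_filter.mp hJ).2.1)
  have hT1 : ∀ U, U.card < 2 * k → T U = 0 := fun U hU => Finset.sum_eq_zero fun J hJ => by
    rw [if_neg]; intro h
    have := Finset.card_le_card h
    rw [(Finset.mem_filter.mp hJ).2.2] at this
    omega
  have hT2 : ∀ (U : Finset I) (m : ℕ), U.card = 2 * m → k ≤ m → x ∈ U →
      T U ≤ ((2 * m - 1).choose (2 * k - 1) : ℝ) * ξ ^ (2 * (m - k)) := by
    intro U m hm hkm hx
    have h1 : T U = ∑ M ∈ (U.erase x).powersetCard (U.card - 2 * k), w M :=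
      sum_subset_eq_sum_compl hx (by omega) w
    rw [h1]
    refine (Finset.sum_le_card_nsmul _ _ (ξ ^ (2 * (m - k))) fun M hM => ?_).trans (le_of_eq ?_)
    · exact hA M (m - k) (by rw [(Finset.mem_powersetCard.mp hM).2]; omega)
    · rw [Finset.card_powersetCard, Finset.card_erase_of_mem hx, nsmul_eq_mul, hm,
        Nat.choose_symm_of_eq_add (by omega : 2 * m - 1 = 2 * m - 2 * k + (2 * k - 1))]
  have h1 : ∑ J : Finset I with x ∈ J ∧ J.card = 2 * k, ‖coeff J (gauss A f)‖ ≤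
      ∑ U, ‖coeff U f‖ * T U := by
    have : ∀ J, ‖coeff J (gauss A f)‖ ≤
        ∑ U, ‖coeff U f‖ * (if J ⊆ U then w (U \ J) else 0) := by
      intro J
      rw [coeff_linearMap]
      refine (norm_sum_le _ _).trans (Finset.sum_le_sum fun U _ => ?_)
      rw [norm_mul, norm_coeff_gauss_monomial]
    refine (Finset.sum_le_sum fun J _ => this J).trans ?_
    rw [Finset.sum_comm]
    simp only [T, Finset.mul_sum]
    exact le_rfl
  rw [sum_eq_sum_even_card hn _ (by rw [hT0 ∅ (by simp), mul_zero])
    (fun L hL => by rw [hf L hL, norm_zero, zero_mul])] at h1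
  have hk' : (0 : ℝ) < 2 * k := by positivity
  have h2 : ∀ m ∈ Finset.Icc 1 n, ∑ U : Finset I with U.card = 2 * m, ‖coeff U f‖ * T U ≤
      2 * k * if k ≤ m then
        normCoeff m f * ((2 * m).choose (2 * k) : ℝ) * ξ ^ (2 * (m - k)) else 0 := by
    intro m hm
    have hm1 : 1 ≤ m := (Finset.mem_Icc.mp hm).1
    split_ifs with hkm
    · have h3 : ∑ U : Finset I with U.card = 2 * m, ‖coeff U f‖ * T U =
          ∑ U : Finset I with x ∈ U ∧ U.card = 2 * m, ‖coeff U f‖ * T U := by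
        symm
        refine Finset.sum_subset (fun U hU => by simp_all) fun U hU hU' => ?_
        rw [hT0 U (by simp_all), mul_zero]
      have h4 : ((2 * m).choose (2 * k) : ℝ) * (2 * k) =
          2 * m * ((2 * m - 1).choose (2 * k - 1) : ℝ) := by
        obtain ⟨a, ha⟩ : ∃ a, 2 * m = a + 1 := ⟨2 * m - 1, by omega⟩
        obtain ⟨b, hb⟩ : ∃ b, 2 * k = b + 1 := ⟨2 * k - 1, by omega⟩
        have h5 := Nat.add_one_mul_choose_eq a b
        have h6 : ((a + 1 : ℕ) : ℝ) * (a.choose b : ℝ) =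
            ((a + 1).choose (b + 1) : ℝ) * ((b + 1 : ℕ) : ℝ) := by exact_mod_cast h5
        rw [← ha, ← hb, show a = 2 * m - 1 by omega, show b = 2 * k - 1 by omega] at h6
        push_cast at h6
        linarith
      rw [h3]
      calc _ ≤ ∑ U : Finset I with x ∈ U ∧ U.card = 2 * m,
            ‖coeff U f‖ * (((2 * m - 1).choose (2 * k - 1) : ℝ) * ξ ^ (2 * (m - k))) := by
            refine Finset.sum_le_sum fun U hU => mul_le_mul_of_nonneg_left ?_ (norm_nonneg _)
            have := (Finset.mem_filter.mp hU).2
            exact hT2 U m this.2 hkm this.1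
        _ ≤ 2 * m * normCoeff m f *
            (((2 * m - 1).choose (2 * k - 1) : ℝ) * ξ ^ (2 * (m - k))) := by
            rw [← Finset.sum_mul]
            exact mul_le_mul_of_nonneg_right (sum_norm_coeff_le hm1 f x) (by positivity)
        _ = _ := by linear_combination (-(normCoeff m f * ξ ^ (2 * (m - k)))) * h4
    · rw [mul_zero]
      refine le_of_eq (Finset.sum_eq_zero fun U hU => ?_)
      have := (Finset.mem_filter.mp hU).2
      rw [hT1 U (by omega), mul_zero]
  have h3 := h1.trans (Finset.sum_le_sum h2)
  rw [← Finset.mul_sum, ← Finset.sum_filter] at h3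
  have h4 : (Finset.Icc 1 n).filter (fun m => k ≤ m) = Finset.Icc k n := by
    ext m; simp only [Finset.mem_filter, Finset.mem_Icc]; omega
  rw [h4] at h3
  rw [one_div, inv_mul_le_iff₀ hk']
  exact h3

/-- Summation over two vertices joined by a line of weight `α`, with a marked leg `x` on the first
vertex: the leg `j` can be chosen in `2l - 1` ways. -/
theorem sum_pair_le {l m : ℕ} (hl : 1 ≤ l) {a : Finset I → ℝ} (ha : ∀ L, 0 ≤ a L)
    {α : I → I → ℝ} (hα : ∀ i j, 0 ≤ α i j) {α0 bl bm : ℝ} (hα0 : ∀ j, ∑ i, α i j ≤ α0)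
    (hbl : ∀ y, ∑ L : Finset I with y ∈ L ∧ L.card = 2 * l, a L ≤ bl)
    (hbm : ∀ y, ∑ L : Finset I with y ∈ L ∧ L.card = 2 * m, a L ≤ bm) (x : I) :
    ∑ i, ∑ j, α i j * ∑ L : Finset I with L.card = 2 * l, ∑ K : Finset I with K.card = 2 * m,
      a L * a K * (if x ∈ L ∧ j ∈ L.erase x ∧ i ∈ K then 1 else 0) ≤
        (2 * l - 1) * bl * α0 * bm := by
  have hbm0 : 0 ≤ bm := le_trans (Finset.sum_nonneg fun _ _ => ha _) (hbm x)
  have hα00 : 0 ≤ α0 := le_trans (Finset.sum_nonneg fun i _ => hα i x) (hα0 x)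
  have h1 : ∑ i, ∑ j, α i j * ∑ L : Finset I with L.card = 2 * l,
      ∑ K : Finset I with K.card = 2 * m,
        a L * a K * (if x ∈ L ∧ j ∈ L.erase x ∧ i ∈ K then 1 else 0) =
      ∑ L : Finset I with x ∈ L ∧ L.card = 2 * l, a L * ∑ j ∈ L.erase x, ∑ i, α i j *
        ∑ K : Finset I with i ∈ K ∧ K.card = 2 * m, a K := by
    simp only [Finset.sum_filter, Finset.mul_sum]
    have h2 : ∀ (L : Finset I) (g : I → ℝ), ∑ j ∈ L.erase x, g j =
        ∑ j, if j ∈ L.erase x then g j else 0 := fun L g => by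
      rw [← Finset.sum_filter]; congr 1; ext; simp
    simp only [h2]
    rw [Finset.sum_congr rfl fun i _ => Finset.sum_comm, Finset.sum_comm]
    refine Finset.sum_congr rfl fun L _ => ?_
    by_cases hL : L.card = 2 * l
    swap
    · simp [hL]
    by_cases hx : x ∈ L
    swap
    · simp [hx]
    simp only [hL, hx, true_and, if_true, Finset.mul_sum]
    rw [Finset.sum_comm]
    refine Finset.sum_congr rfl fun j _ => ?_
    by_cases hj : j ∈ L.erase x
    swap
    · simp [hj]
    simp only [hj, true_and, if_true]
    refine Finset.sum_congr rfl fun i _ => Finset.sum_congr rfl fun K _ => ?_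
    by_cases hK : K.card = 2 * m <;> by_cases hi : i ∈ K <;> simp [hK, hi]
    ring
  rw [h1]
  calc _ ≤ ∑ L : Finset I with x ∈ L ∧ L.card = 2 * l, a L * ((2 * l - 1) * α0 * bm) := by
        refine Finset.sum_le_sum fun L hL => mul_le_mul_of_nonneg_left ?_ (ha L)
        have hL' := (Finset.mem_filter.mp hL).2
        calc _ ≤ ∑ j ∈ L.erase x, α0 * bm := by
              refine Finset.sum_le_sum fun j _ => ?_
              calc _ ≤ ∑ i, α i j * bm :=
                    Finset.sum_le_sum fun i _ => mul_le_mul_of_nonneg_left (hbm i) (hα i j)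
                _ ≤ _ := by
                    rw [← Finset.sum_mul]
                    exact mul_le_mul_of_nonneg_right (hα0 j) hbm0
          _ = _ := by
              rw [Finset.sum_const, Finset.card_erase_of_mem hL'.1, hL'.2, nsmul_eq_mul,
                Nat.cast_sub (by omega)]
              push_cast; ring
    _ ≤ bl * ((2 * l - 1) * α0 * bm) := by
        rw [← Finset.sum_mul]
        refine mul_le_mul_of_nonneg_right (hbl x) ?_
        have : (1 : ℝ) ≤ l := by exact_mod_cast hl
        have : (0 : ℝ) ≤ 2 * l - 1 := by linarith
        positivity
    _ = _ := by ring

theorem fieldDeriv_mul_fieldDeriv_monomial (i j : I) (L K : Finset I) :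
    ∃ c : ℂ, ‖c‖ = (if (j ∈ L ∧ i ∈ K) ∧ Disjoint (L.erase j) (K.erase i) then 1 else 0) ∧
      fieldDeriv j (monomial L) * fieldDeriv i (monomial K) =
        c • monomial (L.erase j ∪ K.erase i) := by
  by_cases hj : j ∈ L
  swap
  · exact ⟨0, by simp [hj], by rw [fieldDeriv_monomial_of_notMem hj]; simp⟩
  by_cases hi : i ∈ K
  swap
  · exact ⟨0, by simp [hi], by rw [fieldDeriv_monomial_of_notMem hi]; simp⟩
  obtain ⟨c1, hc1, h1⟩ := fieldDeriv_monomial_of_mem hj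
  obtain ⟨c2, hc2, h2⟩ := fieldDeriv_monomial_of_mem hi
  rw [h1, h2, smul_mul_smul_comm]
  by_cases hd : Disjoint (L.erase j) (K.erase i)
  · obtain ⟨c3, hc3, h3⟩ := monomial_mul_of_disjoint hd
    exact ⟨c1 * c2 * c3, by simp [hj, hi, hd, hc1, hc2, hc3], by rw [h3, smul_smul]⟩
  · exact ⟨0, by simp [hd], by rw [monomial_mul_of_not_disjoint hd]; simp⟩

theorem norm_coeff_gauss_quadTerm_le (A A' : Matrix I I ℂ) (F : Grassmann I) (J : Finset I) :
    ‖coeff J (gauss A (quadTerm A' F))‖ ≤ (1 / 2) * ∑ i, ∑ j, ‖A' i j‖ * ∑ L, ∑ K,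
      ‖coeff L F‖ * ‖coeff K F‖ *
        ‖coeff J (gauss A (fieldDeriv j (monomial L) * fieldDeriv i (monomial K)))‖ := by
  have h1 : ∀ i j, fieldDeriv j F * fieldDeriv i F = ∑ L, ∑ K, (coeff L F * coeff K F) •
      (fieldDeriv j (monomial L) * fieldDeriv i (monomial K)) := by
    intro i j
    conv_lhs => rw [← sum_coeff F]
    simp only [map_sum, map_smul, Finset.sum_mul_sum, smul_mul_smul_comm]
  simp only [quadTerm, map_smul, map_sum, coeff_smul, coeff_sum, norm_mul]
  refine mul_le_mul (by simp) ?_ (norm_nonneg _) (by norm_num)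
  refine (norm_sum_le _ _).trans (Finset.sum_le_sum fun i _ => ?_)
  refine (norm_sum_le _ _).trans (Finset.sum_le_sum fun j _ => ?_)
  rw [norm_mul]
  refine mul_le_mul_of_nonneg_left ?_ (norm_nonneg _)
  rw [h1]
  simp only [map_sum, map_smul, coeff_sum, coeff_smul]
  refine (norm_sum_le _ _).trans (Finset.sum_le_sum fun L _ => ?_)
  refine (norm_sum_le _ _).trans (Finset.sum_le_sum fun K _ => ?_)
  rw [norm_mul, norm_mul]

end Estimates

/-! ### Balanced contractions and the quadratic estimate -/

section Balanced

variable {n : ℕ}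

/-- The part of a set of fields that lies in the first block. -/
def leftPart (M : Finset (Index n)) : Finset (Fin n) :=
  Finset.univ.filter fun i => inlEmb (Fin n) i ∈ M

/-- The part of a set of fields that lies in the second block. -/
def rightPart (M : Finset (Index n)) : Finset (Fin n) :=
  Finset.univ.filter fun i => inrEmb (Fin n) i ∈ M

theorem mem_leftPart {M : Finset (Index n)} {i : Fin n} :
    i ∈ leftPart M ↔ toLex (Sum.inl i) ∈ M := by
  rw [leftPart, Finset.mem_filter, inlEmb_apply]
  exact and_iff_right (Finset.mem_univ i)

theorem mem_rightPart {M : Finset (Index n)} {i : Fin n} :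
    i ∈ rightPart M ↔ toLex (Sum.inr i) ∈ M := by
  rw [rightPart, Finset.mem_filter, inrEmb_apply]
  exact and_iff_right (Finset.mem_univ i)

theorem pairIndex_leftPart_rightPart (M : Finset (Index n)) :
    pairIndex (leftPart M) (rightPart M) = M := by
  ext a
  rcases h : ofLex a with i | i
  · obtain rfl : a = inlEmb (Fin n) i := by rw [inlEmb_apply, ← h]; rfl
    simp [pairIndex, inlEmb_apply, mem_leftPart]
  · obtain rfl : a = inrEmb (Fin n) i := by rw [inrEmb_apply, ← h]; rfl
    simp [pairIndex, inrEmb_apply, mem_rightPart]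

theorem card_leftPart_add_card_rightPart (M : Finset (Index n)) :
    (leftPart M).card + (rightPart M).card = M.card := by
  conv_rhs => rw [← pairIndex_leftPart_rightPart M]
  rw [pairIndex, Finset.card_map, Finset.card_disjSum]

/-- Only balanced subsets of `V` contribute, and choosing `r` elements in each block can be done in at
most `C(N - 1, r) C(N, r)` ways. -/
theorem sum_powersetCard_le {φ : Finset (Index n) → ℝ} {ρ : ℝ} (hρ : 0 ≤ ρ)
    (hφ : ∀ J K, φ (pairIndex J K) ≤ if J.card = K.card then ρ ^ J.card else 0)
    {N : ℕ} {V : Finset (Index n)} (hV : V.card + 1 = 2 * N) (r : ℕ) :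
    ∑ M ∈ V.powersetCard (2 * r), φ M ≤
      ((N - 1).choose r * N.choose r : ℝ) * ρ ^ r := by
  have h1 : ∀ M ∈ V.powersetCard (2 * r), φ M ≤ if (leftPart M).card = r then ρ ^ r else 0 := by
    intro M hM
    have h2 := hφ (leftPart M) (rightPart M)
    rw [pairIndex_leftPart_rightPart] at h2
    have h3 := card_leftPart_add_card_rightPart M
    rw [(Finset.mem_powersetCard.mp hM).2] at h3
    refine h2.trans (le_of_eq ?_)
    by_cases h4 : (leftPart M).card = r
    · rw [if_pos (by omega), if_pos h4, h4]
    · rw [if_neg (by omega), if_neg h4]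
  refine (Finset.sum_le_sum h1).trans ?_
  rw [← Finset.sum_filter, Finset.sum_const, nsmul_eq_mul]
  refine mul_le_mul_of_nonneg_right ?_ (pow_nonneg hρ r)
  have h5 : ((V.powersetCard (2 * r)).filter fun M => (leftPart M).card = r).card ≤
      ((leftPart V).powersetCard r ×ˢ (rightPart V).powersetCard r).card := by
    refine Finset.card_le_card_of_injOn (fun M => (leftPart M, rightPart M)) ?_ ?_
    · intro M hM
      simp only [Finset.coe_filter, Set.mem_ofPred_eq, Finset.mem_powersetCard] at hM
      have h3 := card_leftPart_add_card_rightPart M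
      simp only [Finset.coe_product, Set.mem_prod, Finset.mem_coe, Finset.mem_powersetCard]
      refine ⟨⟨?_, hM.2⟩, ⟨?_, by omega⟩⟩
      · exact fun i hi => by
          simp only [leftPart, Finset.mem_filter, Finset.mem_univ, true_and] at hi ⊢
          exact hM.1.1 hi
      · exact fun i hi => by
          simp only [rightPart, Finset.mem_filter, Finset.mem_univ, true_and] at hi ⊢
          exact hM.1.1 hi
    · intro M _ M' _ h
      simp only [Prod.mk.injEq] at h
      rw [← pairIndex_leftPart_rightPart M, ← pairIndex_leftPart_rightPart M', h.1, h.2]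
  rw [Finset.card_product, Finset.card_powersetCard, Finset.card_powersetCard] at h5
  have h6 := choose_mul_choose_le (p := (leftPart V).card) (q := (rightPart V).card) r
    (by rw [card_leftPart_add_card_rightPart, hV])
  exact_mod_cast h5.trans h6

end Balanced

section Quadratic

variable {I : Type} [Fintype I] [LinearOrder I]

/-- The weight of two vertices of degrees `2l` and `2m` joined by one line, after contraction down
to degree `2k`, for a given marked leg. Of the remaining `2 (l + m - 1)` legs, `2 (l + m - 1 - k)` are
contracted; if there are fewer than `2k` legs, the weight is zero. -/
def contractionWeight (k l m : ℕ) (ρ : ℝ) : ℝ :=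
  if k + 1 ≤ l + m then
    ((l + m - 1 - 1).choose (l + m - 1 - k) * (l + m - 1).choose (l + m - 1 - k) : ℝ) *
      ρ ^ (l + m - 1 - k)
  else 0

theorem contractionWeight_nonneg (k l m : ℕ) {ρ : ℝ} (hρ : 0 ≤ ρ) :
    0 ≤ contractionWeight k l m ρ := by
  rw [contractionWeight]; split_ifs <;> positivity

/-- The marked leg `x` belongs to the first or to the second vertex, and differs from the leg used for
the line. -/
theorem sum_norm_coeff_gauss_mul_le {A : Matrix I I ℂ} {ρ : ℝ} (hρ : 0 ≤ ρ)
    (hA : ∀ (N r : ℕ) (V : Finset I), V.card + 1 = 2 * N → ∑ M ∈ V.powersetCard (2 * r),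
      ‖constTerm (gauss A (monomial M))‖ ≤ ((N - 1).choose r * N.choose r : ℝ) * ρ ^ r)
    {k l m : ℕ} (hl : 1 ≤ l) (hm : 1 ≤ m) {L K : Finset I}
    (hL : L.card = 2 * l) (hK : K.card = 2 * m) (x i j : I) :
    ∑ J : Finset I with x ∈ J ∧ J.card = 2 * k,
      ‖coeff J (gauss A (fieldDeriv j (monomial L) * fieldDeriv i (monomial K)))‖ ≤
      contractionWeight k l m ρ *
        ((if x ∈ L ∧ j ∈ L.erase x ∧ i ∈ K then 1 else 0) +
          (if x ∈ K ∧ i ∈ K.erase x ∧ j ∈ L then 1 else 0)) := by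
  have hw := contractionWeight_nonneg k l m hρ
  obtain ⟨c, hc, h1⟩ := fieldDeriv_mul_fieldDeriv_monomial i j L K
  rw [h1]
  set U := L.erase j ∪ K.erase i with hU
  simp only [map_smul, coeff_smul, norm_mul, hc]
  rw [← Finset.mul_sum]
  simp only [norm_coeff_gauss_monomial]
  have h0 : (0 : ℝ) ≤ contractionWeight k l m ρ *
        ((if x ∈ L ∧ j ∈ L.erase x ∧ i ∈ K then 1 else 0) +
          (if x ∈ K ∧ i ∈ K.erase x ∧ j ∈ L then 1 else 0)) :=
    mul_nonneg hw (by positivity)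
  by_cases h2 : (j ∈ L ∧ i ∈ K) ∧ Disjoint (L.erase j) (K.erase i)
  swap
  · rw [if_neg h2, zero_mul]; exact h0
  rw [if_pos h2, one_mul]
  have hUc : U.card = 2 * (l + m - 1) := by
    rw [hU, Finset.card_union_of_disjoint h2.2, Finset.card_erase_of_mem h2.1.1,
      Finset.card_erase_of_mem h2.1.2, hL, hK]
    omega
  by_cases hx : x ∈ U
  swap
  · rw [Finset.sum_eq_zero]
    · exact h0
    · exact fun J hJ => if_neg fun h => hx (h (Finset.mem_filter.mp hJ).2.1)
  have h3 : (1 : ℝ) ≤ (if x ∈ L ∧ j ∈ L.erase x ∧ i ∈ K then 1 else 0) +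
          (if x ∈ K ∧ i ∈ K.erase x ∧ j ∈ L then 1 else 0) := by
    rcases Finset.mem_union.mp (hU ▸ hx) with h | h
    · rw [if_pos (by grind)]
      exact le_add_of_nonneg_right (by positivity)
    · rw [if_pos (c := x ∈ K ∧ i ∈ K.erase x ∧ j ∈ L) (by grind)]
      exact le_add_of_nonneg_left (by positivity)
  refine le_trans ?_ (le_mul_of_one_le_right hw h3)
  rw [contractionWeight]
  split_ifs with h4
  · rw [sum_subset_eq_sum_compl hx (by omega) (fun M => ‖constTerm (gauss A (monomial M))‖), hUc,
      show 2 * (l + m - 1) - 2 * k = 2 * (l + m - 1 - k) by omega]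
    exact hA (l + m - 1) (l + m - 1 - k) (U.erase x)
      (by rw [Finset.card_erase_of_mem hx]; omega)
  · refine le_of_eq (Finset.sum_eq_zero fun J hJ => if_neg fun h => ?_)
    have := Finset.card_le_card h
    rw [hUc, (Finset.mem_filter.mp hJ).2.2] at this
    omega

theorem sum_norm_le_normOneInf (A : Matrix I I ℂ) (i : I) :
    ∑ j, ‖A i j‖ ≤ normOneInf A :=
  le_ciSup (f := fun i : I => ∑ j, ‖A i j‖) (Set.finite_range _).bddAbove i

/-- The bound on the quadratic term of the flow equation. With `2N = 2 (k + r)` legs to choose the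
marked one from, the factor `2N / 2k` turns `C(N - 1, r)` into `C(N, r)`. -/
theorem sum_norm_coeff_gauss_quadTerm_le {n : ℕ} (hcard : Fintype.card I = 2 * n)
    {A A' : Matrix I I ℂ} {ξ : ℝ} (hξ : 0 ≤ ξ)
    (hA : ∀ (N r : ℕ) (V : Finset I), V.card + 1 = 2 * N → ∑ M ∈ V.powersetCard (2 * r),
      ‖constTerm (gauss A (monomial M))‖ ≤ ((N - 1).choose r * N.choose r : ℝ) * (ξ ^ 2 / 2) ^ r)
    (hA' : ∀ i j, A' j i = -A' i j) {F : Grassmann I} (hF : IsEven F) {k : ℕ} (hk : 1 ≤ k)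
    (x : I) :
    (1 / (2 * (k : ℝ))) * ∑ J : Finset I with x ∈ J ∧ J.card = 2 * k,
      ‖coeff J (gauss A (quadTerm A' F))‖ ≤
      (1 / 2) * (normOneInf A' * ∑ p ∈ Finset.Icc 1 n ×ˢ Finset.Icc 1 n with k + 1 ≤ p.1 + p.2,
        normCoeff p.1 F * normCoeff p.2 F * Gam k p.1 p.2 ξ) := by
  set ρ := ξ ^ 2 / 2 with hρdef
  have hρ : 0 ≤ ρ := by positivity
  set a : Finset I → ℝ := fun L => ‖coeff L F‖ with ha
  have ha0 : ∀ L, 0 ≤ a L := fun L => norm_nonneg _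
  let S : I → I → Finset I → Finset I → ℝ := fun i j L K =>
    ∑ J : Finset I with x ∈ J ∧ J.card = 2 * k,
      ‖coeff J (gauss A (fieldDeriv j (monomial L) * fieldDeriv i (monomial K)))‖
  have h1 : ∑ J : Finset I with x ∈ J ∧ J.card = 2 * k,
      ‖coeff J (gauss A (quadTerm A' F))‖ ≤
      (1 / 2) * ∑ i, ∑ j, ‖A' i j‖ * ∑ L, ∑ K, a L * a K * S i j L K := by
    refine (Finset.sum_le_sum fun J _ => norm_coeff_gauss_quadTerm_le A A' F J).trans ?_
    rw [← Finset.mul_sum, Finset.sum_comm]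
    refine mul_le_mul_of_nonneg_left (le_of_eq ?_) (by norm_num)
    refine Finset.sum_congr rfl fun i _ => ?_
    rw [Finset.sum_comm]
    refine Finset.sum_congr rfl fun j _ => ?_
    rw [← Finset.mul_sum, Finset.sum_comm]
    congr 1
    refine Finset.sum_congr rfl fun L _ => ?_
    rw [Finset.sum_comm]
    refine Finset.sum_congr rfl fun K _ => ?_
    rw [← Finset.mul_sum]
  have hS0 : ∀ i j L, S i j L ∅ = 0 := fun i j L => Finset.sum_eq_zero fun J _ => by
    rw [fieldDeriv_monomial_of_notMem (Finset.notMem_empty i), mul_zero, map_zero, coeff_zero,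
      norm_zero]
  have hS0' : ∀ i j K, S i j ∅ K = 0 := fun i j K => Finset.sum_eq_zero fun J _ => by
    rw [fieldDeriv_monomial_of_notMem (Finset.notMem_empty j), zero_mul, map_zero, coeff_zero,
      norm_zero]
  have h2 : ∀ i j, ∑ L, ∑ K, a L * a K * S i j L K =
      ∑ l ∈ Finset.Icc 1 n, ∑ m ∈ Finset.Icc 1 n, ∑ L : Finset I with L.card = 2 * l,
        ∑ K : Finset I with K.card = 2 * m, a L * a K * S i j L K := by
    intro i j
    rw [sum_eq_sum_even_card hcard _ (by simp [hS0']) (fun L hL => by simp [ha, hF L hL])]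
    refine Finset.sum_congr rfl fun l _ => ?_
    rw [Finset.sum_comm (s := Finset.Icc 1 n)]
    refine Finset.sum_congr rfl fun L _ => ?_
    rw [sum_eq_sum_even_card hcard _ (by simp [hS0]) (fun K hK => by simp [ha, hF K hK])]
  have h3 : ∑ i, ∑ j, ‖A' i j‖ * ∑ L, ∑ K, a L * a K * S i j L K =
      ∑ l ∈ Finset.Icc 1 n, ∑ m ∈ Finset.Icc 1 n, ∑ i, ∑ j, ‖A' i j‖ *
        ∑ L : Finset I with L.card = 2 * l,
          ∑ K : Finset I with K.card = 2 * m, a L * a K * S i j L K := by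
    simp only [h2, Finset.mul_sum (s := Finset.Icc 1 n)]
    rw [Finset.sum_congr rfl fun i _ => Finset.sum_comm, Finset.sum_comm]
    refine Finset.sum_congr rfl fun l _ => ?_
    rw [Finset.sum_congr rfl fun i _ => Finset.sum_comm, Finset.sum_comm]
  have hrow : ∀ j, ∑ i, ‖A' i j‖ ≤ normOneInf A' := fun j => by
    refine le_trans (le_of_eq (Finset.sum_congr rfl fun i _ => ?_)) (sum_norm_le_normOneInf A' j)
    rw [hA' i j, norm_neg]
  have h4 : ∀ l ∈ Finset.Icc 1 n, ∀ m ∈ Finset.Icc 1 n, ∑ i, ∑ j, ‖A' i j‖ *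
        ∑ L : Finset I with L.card = 2 * l,
          ∑ K : Finset I with K.card = 2 * m, a L * a K * S i j L K ≤
      contractionWeight k l m ρ * (normOneInf A' * (2 * l * normCoeff l F) *
        (2 * m * normCoeff m F) * (2 * l - 1 + (2 * m - 1))) := by
    intro l hl m hm
    have hl1 := (Finset.mem_Icc.mp hl).1
    have hm1 := (Finset.mem_Icc.mp hm).1
    have h5 := sum_pair_le hl1 ha0 (fun i j => norm_nonneg (A' i j)) hrow
      (sum_norm_coeff_le hl1 F) (sum_norm_coeff_le hm1 F) x
    have h6 := sum_pair_le hm1 ha0 (fun i j => norm_nonneg (A' j i))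
      (sum_norm_le_normOneInf A')
      (sum_norm_coeff_le hm1 F) (sum_norm_coeff_le hl1 F) x
    rw [Finset.sum_comm] at h6
    rw [Finset.sum_congr rfl fun i _ => Finset.sum_congr rfl fun j _ => congrArg _
      Finset.sum_comm] at h6
    have hw := contractionWeight_nonneg k l m hρ
    refine le_trans ?_ (le_of_le_of_eq (mul_le_mul_of_nonneg_left (add_le_add h5 h6) hw) (by ring))
    simp only [← Finset.sum_add_distrib, Finset.mul_sum]
    refine Finset.sum_le_sum fun i _ => Finset.sum_le_sum fun j _ => ?_
    refine Finset.sum_le_sum fun L hL => ?_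
    refine Finset.sum_le_sum fun K hK => ?_
    have h7 := sum_norm_coeff_gauss_mul_le hρ hA (k := k) hl1 hm1 (Finset.mem_filter.mp hL).2
      (Finset.mem_filter.mp hK).2 x i j
    refine (mul_le_mul_of_nonneg_left (mul_le_mul_of_nonneg_left h7
      (mul_nonneg (ha0 L) (ha0 K))) (norm_nonneg (A' i j))).trans (le_of_eq ?_)
    ring
  have hA0 : 0 ≤ normOneInf A' := le_trans (Finset.sum_nonneg fun _ _ => norm_nonneg _) (hrow x)
  have hk0 : (0 : ℝ) < k := by exact_mod_cast hk
  calc _ ≤ (1 / (2 * (k : ℝ))) * ((1 / 2) * ∑ l ∈ Finset.Icc 1 n, ∑ m ∈ Finset.Icc 1 n,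
        contractionWeight k l m ρ * (normOneInf A' * (2 * l * normCoeff l F) *
          (2 * m * normCoeff m F) * (2 * l - 1 + (2 * m - 1)))) := by
        refine mul_le_mul_of_nonneg_left (h1.trans (mul_le_mul_of_nonneg_left ?_ (by norm_num)))
          (by positivity)
        rw [h3]
        exact Finset.sum_le_sum fun l hl => Finset.sum_le_sum fun m hm => h4 l hl m hm
    _ = (1 / 2) * ∑ l ∈ Finset.Icc 1 n, ∑ m ∈ Finset.Icc 1 n, (1 / (2 * (k : ℝ))) *
        (contractionWeight k l m ρ * (normOneInf A' * (2 * l * normCoeff l F) *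
          (2 * m * normCoeff m F) * (2 * l - 1 + (2 * m - 1)))) := by
        rw [mul_left_comm]; simp only [Finset.mul_sum]
    _ ≤ _ := by
        refine mul_le_mul_of_nonneg_left ?_ (by norm_num)
        rw [Finset.sum_filter, Finset.sum_product, Finset.mul_sum]
        refine Finset.sum_le_sum fun l hl => ?_
        rw [Finset.mul_sum]
        refine Finset.sum_le_sum fun m hm => ?_
        have hl1 := (Finset.mem_Icc.mp hl).1
        have hm1 := (Finset.mem_Icc.mp hm).1
        rw [contractionWeight]
        split_ifs with h8
        · obtain ⟨r, hr⟩ : ∃ r, l + m = k + r + 1 := ⟨l + m - 1 - k, by omega⟩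
          have h9 := choose_mul_choose_le_Gam hl1 hm1 hk hr hξ
          have h10 : (l : ℝ) + m = k + r + 1 := by exact_mod_cast hr
          rw [show l + m - 1 - k = r by omega, show l + m - 1 = k + r by omega]
          -- the `(2l - 1) + (2m - 1)` choices of a leg other than the marked one
          have h11 : (2 * l - 1 + (2 * m - 1) : ℝ) = 2 * (k + r) := by linarith
          rw [h11]
          refine le_trans (le_of_eq ?_) (mul_le_mul_of_nonneg_left (mul_le_mul_of_nonneg_left h9
            (mul_nonneg (normCoeff_nonneg l F) (normCoeff_nonneg m F))) hA0)
          rw [← hρdef]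
          field_simp
          ring
        · simp

end Quadratic

/-! ### Absolutely continuous curves in the Grassmann algebra -/

section Curves

open MeasureTheory

/-- `u` is absolutely continuous on `[0, t]` and has the integrable derivative `u'` almost
everywhere. -/
structure HasACDeriv (t : ℝ) (u u' : ℝ → ℂ) : Prop where
  ac : AbsolutelyContinuousOnInterval u 0 t
  integrable : IntervalIntegrable u' volume 0 t
  deriv : ∀ᵐ s, s ∈ Set.uIcc 0 t → HasDerivAt u (u' s) s

namespace HasACDeriv

variable {t : ℝ} {u u' v v' : ℝ → ℂ}

theorem const (c : ℂ) : HasACDeriv t (fun _ => c) (fun _ => 0) where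
  ac := by simpa [AbsolutelyContinuousOnInterval] using tendsto_const_nhds
  integrable := by simp
  deriv := Filter.Eventually.of_forall fun s _ => hasDerivAt_const s c

theorem add (hu : HasACDeriv t u u') (hv : HasACDeriv t v v') :
    HasACDeriv t (fun s => u s + v s) (fun s => u' s + v' s) where
  ac := hu.ac.fun_add hv.ac
  integrable := hu.integrable.add hv.integrable
  deriv := by
    filter_upwards [hu.deriv, hv.deriv] with s h1 h2 hs using (h1 hs).fun_add (h2 hs)

theorem mul (hu : HasACDeriv t u u') (hv : HasACDeriv t v v') :
    HasACDeriv t (fun s => u s * v s) (fun s => u' s * v s + u s * v' s) where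
  ac := hu.ac.fun_smul hv.ac
  integrable := (hu.integrable.mul_continuousOn hv.ac.continuousOn).add
    (hv.integrable.continuousOn_mul hu.ac.continuousOn)
  deriv := by
    filter_upwards [hu.deriv, hv.deriv] with s h1 h2 hs using (h1 hs).fun_mul (h2 hs)

theorem congr (hu : HasACDeriv t u u') (h : ∀ s ∈ Set.uIcc 0 t, u' s = v' s) :
    HasACDeriv t u v' where
  ac := hu.ac
  integrable := hu.integrable.congr fun s hs => h s (Set.uIoc_subset_uIcc hs)
  deriv := by
    filter_upwards [hu.deriv] with s h1 hs
    rw [← h s hs]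
    exact h1 hs

theorem const_mul (c : ℂ) (hu : HasACDeriv t u u') :
    HasACDeriv t (fun s => c * u s) (fun s => c * u' s) :=
  ((const c).mul hu).congr fun s _ => by simp

theorem sum {ι : Type*} (S : Finset ι) {u u' : ι → ℝ → ℂ}
    (h : ∀ i ∈ S, HasACDeriv t (u i) (u' i)) :
    HasACDeriv t (fun s => ∑ i ∈ S, u i s) (fun s => ∑ i ∈ S, u' i s) := by
  classical
  induction S using Finset.induction_on with
  | empty => simpa using const 0
  | insert a S ha ih =>
    simp only [Finset.sum_insert ha]
    exact (h a (Finset.mem_insert_self a S)).add (ih fun i hi => h i (Finset.mem_insert_of_mem hi))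

theorem inv (hu : HasACDeriv t u u') (h0 : ∀ s ∈ Set.uIcc 0 t, u s ≠ 0) :
    HasACDeriv t (fun s => (u s)⁻¹) (fun s => -u' s / u s ^ 2) where
  ac := by
    obtain ⟨C, hC⟩ := isCompact_uIcc.exists_bound_of_continuousOn
      (hu.ac.continuousOn.inv₀ h0)
    have h1 : Filter.Tendsto _ _ _ := hu.ac
    refine squeeze_zero' (Filter.Eventually.of_forall fun E =>
      Finset.sum_nonneg fun i _ => dist_nonneg) ?_ (by simpa using h1.const_mul (C ^ 2))
    rw [Filter.eventually_inf_principal]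
    filter_upwards with E hE
    rw [Finset.mul_sum]
    refine Finset.sum_le_sum fun i hi => ?_
    obtain ⟨ha, hb⟩ := hE.1 i hi
    have ha0 := h0 _ ha
    have hb0 := h0 _ hb
    have hC0 : 0 ≤ C := (norm_nonneg _).trans (hC _ ha)
    rw [dist_eq_norm, dist_eq_norm, inv_sub_inv ha0 hb0, div_eq_mul_inv, mul_inv, norm_mul,
      norm_mul, norm_sub_rev, mul_comm, sq]
    exact mul_le_mul_of_nonneg_right (mul_le_mul (hC _ ha) (hC _ hb) (norm_nonneg _) hC0)
      (norm_nonneg _)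
  integrable := by
    have h1 : ContinuousOn (fun s => -(u s ^ 2)⁻¹) (Set.uIcc 0 t) :=
      ((hu.ac.continuousOn.pow 2).inv₀ fun s hs => pow_ne_zero 2 (h0 s hs)).neg
    refine (hu.integrable.mul_continuousOn h1).congr fun s _ => ?_
    ring
  deriv := by
    filter_upwards [hu.deriv] with s h1 hs using (h1 hs).fun_inv (h0 s hs)

/-- Mathlib has absolute continuity of the primitive for real functions; real and imaginary parts are
treated separately. -/
theorem integral {g : ℝ → ℂ} (hg : IntervalIntegrable g volume 0 t) :
    HasACDeriv t (fun s => ∫ τ in (0 : ℝ)..s, g τ) g where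
  ac := by
    have hre : IntervalIntegrable (fun s => (g s).re) volume 0 t := ⟨hg.1.re, hg.2.re⟩
    have him : IntervalIntegrable (fun s => (g s).im) volume 0 t := ⟨hg.1.im, hg.2.im⟩
    have h0 : (0 : ℝ) ∈ Set.uIcc 0 t := Set.left_mem_uIcc
    have h1 := hre.absolutelyContinuousOnInterval_intervalIntegral h0
    have h2 := him.absolutelyContinuousOnInterval_intervalIntegral h0
    have h3 : Filter.Tendsto _ _ _ := h1
    have h4 : Filter.Tendsto _ _ _ := h2
    refine squeeze_zero' (Filter.Eventually.of_forall fun E =>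
      Finset.sum_nonneg fun i _ => dist_nonneg) ?_ (by simpa using h3.add h4)
    rw [Filter.eventually_inf_principal]
    filter_upwards with E hE
    rw [← Finset.sum_add_distrib]
    refine Finset.sum_le_sum fun i hi => ?_
    have h5 : ∀ s ∈ Set.uIcc 0 t, (∫ τ in (0 : ℝ)..s, g τ).re = ∫ τ in (0 : ℝ)..s, (g τ).re ∧
        (∫ τ in (0 : ℝ)..s, g τ).im = ∫ τ in (0 : ℝ)..s, (g τ).im := fun s hs => by
      have hi := hg.mono_set (Set.uIcc_subset_uIcc_left hs)
      exact ⟨(Complex.reCLM.intervalIntegral_comp_comm hi).symm,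
        (Complex.imCLM.intervalIntegral_comp_comm hi).symm⟩
    obtain ⟨ha, hb⟩ := hE.1 i hi
    rw [dist_eq_norm, dist_eq_norm, dist_eq_norm, ← (h5 _ ha).1, ← (h5 _ hb).1, ← (h5 _ ha).2,
      ← (h5 _ hb).2, ← Complex.sub_re, ← Complex.sub_im]
    exact Complex.norm_le_abs_re_add_abs_im _
  integrable := hg
  deriv := by
    filter_upwards [hg.ae_hasDerivAt_integral] with s h1 hs using h1 hs 0 Set.left_mem_uIcc

/-- The fundamental theorem of calculus for absolutely continuous functions. -/
theorem integral_eq_sub (hu : HasACDeriv t u u') : ∫ s in (0 : ℝ)..t, u' s = u t - u 0 := by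
  have h1 := hu.add ((integral hu.integrable).const_mul (-1))
  obtain ⟨C, hC⟩ := h1.ac.const_of_ae_hasDerivAt_zero (by
    filter_upwards [h1.deriv] with s h2 hs
    simpa using h2 hs)
  have h2 := hC 0 Set.left_mem_uIcc
  have h3 := hC t Set.right_mem_uIcc
  simp only [intervalIntegral.integral_same] at h2
  linear_combination h2 - h3

end HasACDeriv

variable {I : Type} [Fintype I] [LinearOrder I]

/-- `HasACDeriv` for curves in the Grassmann algebra, coefficient by coefficient. -/
def HasGrassmannDeriv (t : ℝ) (u u' : ℝ → Grassmann I) : Prop :=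
  ∀ J, HasACDeriv t (fun s => coeff J (u s)) (fun s => coeff J (u' s))

/-- The product is bilinear with constant coefficients in the monomial basis. -/
theorem coeff_mul_eq_sum (J : Finset I) (x y : Grassmann I) :
    coeff J (x * y) = ∑ K, ∑ L, coeff J (monomial K * monomial L) * (coeff K x * coeff L y) := by
  conv_lhs => rw [← sum_coeff x, ← sum_coeff y]
  simp only [Finset.sum_mul_sum, coeff_sum, smul_mul_smul_comm, coeff_smul]
  exact Finset.sum_congr rfl fun K _ => Finset.sum_congr rfl fun L _ => mul_comm _ _

namespace HasGrassmannDeriv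

variable {t : ℝ} {u u' v v' : ℝ → Grassmann I} {c c' : ℝ → ℂ}

theorem congr (hu : HasGrassmannDeriv t u u') (h : ∀ s ∈ Set.uIcc 0 t, u' s = v' s) :
    HasGrassmannDeriv t u v' :=
  fun J => (hu J).congr fun s hs => by rw [h s hs]

theorem const (x : Grassmann I) : HasGrassmannDeriv t (fun _ => x) (fun _ => 0) := fun J => by
  simpa only [coeff_zero] using HasACDeriv.const (coeff J x)

theorem add (hu : HasGrassmannDeriv t u u') (hv : HasGrassmannDeriv t v v') :
    HasGrassmannDeriv t (fun s => u s + v s) (fun s => u' s + v' s) := fun J => by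
  simpa only [coeff_add] using (hu J).add (hv J)

theorem sum {ι : Type*} (S : Finset ι) {u u' : ι → ℝ → Grassmann I}
    (h : ∀ i ∈ S, HasGrassmannDeriv t (u i) (u' i)) :
    HasGrassmannDeriv t (fun s => ∑ i ∈ S, u i s) (fun s => ∑ i ∈ S, u' i s) := fun J => by
  simpa only [coeff_sum] using HasACDeriv.sum S fun i hi => h i hi J

theorem linearMap (hu : HasGrassmannDeriv t u u') (L : Grassmann I →ₗ[ℂ] Grassmann I) :
    HasGrassmannDeriv t (fun s => L (u s)) (fun s => L (u' s)) := fun J => by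
  have h : ∀ x, coeff J (L x) = ∑ K, coeff J (L (monomial K)) * coeff K x := fun x => by
    rw [coeff_linearMap]; exact Finset.sum_congr rfl fun K _ => mul_comm _ _
  rw [funext fun s => h (u s), funext fun s => h (u' s)]
  exact HasACDeriv.sum _ fun K _ => (hu K).const_mul _

theorem smul (hc : HasACDeriv t c c') (hu : HasGrassmannDeriv t u u') :
    HasGrassmannDeriv t (fun s => c s • u s) (fun s => c' s • u s + c s • u' s) := fun J => by
  simpa only [coeff_add, coeff_smul] using hc.mul (hu J)

theorem mul (hu : HasGrassmannDeriv t u u') (hv : HasGrassmannDeriv t v v') :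
    HasGrassmannDeriv t (fun s => u s * v s) (fun s => u' s * v s + u s * v' s) := fun J => by
  rw [funext fun s => coeff_mul_eq_sum J (u s) (v s), funext fun s => (coeff_add J _ _).trans
    (congrArg₂ _ (coeff_mul_eq_sum J (u' s) (v s)) (coeff_mul_eq_sum J (u s) (v' s)))]
  simp only [← Finset.sum_add_distrib, ← mul_add]
  exact HasACDeriv.sum _ fun K _ => HasACDeriv.sum _ fun L _ => ((hu K).mul (hv L)).const_mul _

theorem pow (hu : HasGrassmannDeriv t u u') (he : ∀ s, IsEven (u s)) (k : ℕ) :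
    HasGrassmannDeriv t (fun s => u s ^ (k + 1))
      (fun s => (k + 1 : ℂ) • (u s ^ k * u' s)) := by
  induction k with
  | zero => simpa using hu
  | succ k ih =>
    simp only [pow_succ _ (k + 1)]
    refine (ih.mul hu).congr fun s _ => ?_
    have h : u' s * u s = u s * u' s := ((he s).commute (u' s)).symm
    rw [smul_mul_assoc, mul_assoc, h, ← mul_assoc, ← pow_succ]
    push_cast
    module

theorem powerSum (hu : HasGrassmannDeriv t u u') (he : ∀ s, IsEven (u s)) (c : ℕ → ℂ) (N : ℕ) :
    HasGrassmannDeriv t (fun s => powerSum c (N + 1) (u s))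
      (fun s => GrassmannRG.powerSum (fun k => (k + 1) * c (k + 1)) N (u s) * u' s) := by
  simp only [GrassmannRG.powerSum, Finset.sum_range_succ' _ N, pow_zero]
  refine ((sum (Finset.range N) (fun k _ => (hu.pow he k).linearMap
    (LinearMap.lsmul ℂ (Grassmann I) (c (k + 1))))).add (const _)).congr fun s _ => ?_
  simp only [add_zero, Finset.sum_mul, LinearMap.lsmul_apply, smul_mul_assoc, smul_smul]
  exact Finset.sum_congr rfl fun k _ => by rw [mul_comm]

theorem gauss_const {A A' : ℝ → Matrix I I ℂ}
    (hA : ∀ i j, HasACDeriv t (fun s => A s i j) (fun s => A' s i j)) (x : Grassmann I) :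
    HasGrassmannDeriv t (fun s => gauss (A s) x) (fun s => gauss (A s) (lap (A' s) x)) := by
  induction x using grassmann_induction with
  | algebraMap c =>
    simp only [gauss_algebraMap, lap_algebraMap, map_zero]
    exact const _
  | add x y hx hy =>
    simp only [map_add]
    exact hx.add hy
  | ι_mul x m hx =>
    have hsk : ∀ j, HasACDeriv t (fun s => ∑ i, m i * skewPart (A s) i j)
        (fun s => ∑ i, m i * skewPart (A' s) i j) := fun j => by
      refine HasACDeriv.sum _ fun i _ => ?_
      refine HasACDeriv.const_mul _ ?_
      simp only [skewPart]
      have h := ((hA i j).add ((hA j i).const_mul (-1))).const_mul (1 / 2)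
      convert h using 2 <;> ring
    simp only [gauss_ι_mul]
    refine ((hx.linearMap (LinearMap.mulLeft ℂ (ExteriorAlgebra.ι ℂ m))).add
      (sum Finset.univ fun j _ => smul (hsk j) (hx.linearMap (fieldDeriv j)))).congr
      fun s _ => ?_
    simp only [lap_ι_mul, map_add, gauss_ι_mul, LinearMap.mulLeft_apply, map_sum, map_smul,
      gauss_fieldDeriv, Finset.sum_add_distrib]
    abel

/-- Product rule for the convolution operator: `∂_s (μ_A * u) = μ_A * (Δ_{A'} u + u')`. -/
theorem gauss {A A' : ℝ → Matrix I I ℂ}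
    (hA : ∀ i j, HasACDeriv t (fun s => A s i j) (fun s => A' s i j))
    (hu : HasGrassmannDeriv t u u') :
    HasGrassmannDeriv t (fun s => gauss (A s) (u s))
      (fun s => GrassmannRG.gauss (A s) (lap (A' s) (u s) + u' s)) := by
  have h1 : ∀ (L : Grassmann I →ₗ[ℂ] Grassmann I) x, L x = ∑ K, coeff K x • L (monomial K) :=
    fun L x => by
      conv_lhs => rw [← sum_coeff x]
      simp only [map_sum, map_smul]
  have h2 : ∀ s, GrassmannRG.gauss (A s) (u s) =
      ∑ K, coeff K (u s) • GrassmannRG.gauss (A s) (monomial K) := fun s => h1 _ _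
  simp only [h2]
  refine (sum Finset.univ fun K _ => smul (hu K) (gauss_const hA (monomial K))).congr fun s _ => ?_
  rw [Finset.sum_add_distrib, ← h1, map_add, add_comm]
  congr 1
  exact (h1 (GrassmannRG.gauss (A s) ∘ₗ lap (A' s)) (u s)).symm

end HasGrassmannDeriv

end Curves

/-! ### The flow equation in integrated form -/

section Flow

open MeasureTheory

variable {I : Type} [Fintype I] [LinearOrder I]

theorem lap_gauss (A A' : Matrix I I ℂ) (x : Grassmann I) :
    gauss A (lap A' x) = lap A' (gauss A x) := by
  simp only [lap_apply, map_smul, map_sum, gauss_fieldDeriv]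

theorem lap_neg (A : Matrix I I ℂ) (x : Grassmann I) : lap (-A) x = -lap A x := by
  simp [lap_apply]

/-- The effective action as a power series in the nilpotent part. -/
theorem effectiveAction_eq {A' : ℝ → Matrix I I ℂ} {f : Grassmann I} {s : ℝ}
    (h0 : expectation (cumulative A' s) (gexp (-f)) ≠ 0) :
    constTerm ((constTerm (gauss (cumulative A' s) (gexp (-f))))⁻¹ •
        gauss (cumulative A' s) (gexp (-f))) = 1 ∧
      effectiveAction A' f s = -powerSum logCoeff (Fintype.card I + 1)
        ((constTerm (gauss (cumulative A' s) (gexp (-f))))⁻¹ •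
          gauss (cumulative A' s) (gexp (-f)) - 1) := by
  rw [expectation_eq_constTerm] at h0
  have h1 : constTerm ((constTerm (gauss (cumulative A' s) (gexp (-f))))⁻¹ •
        gauss (cumulative A' s) (gexp (-f))) = 1 := by
    rw [map_smul, smul_eq_mul, inv_mul_cancel₀ h0]
  refine ⟨h1, ?_⟩
  rw [effectiveAction, expectation_eq_constTerm, convolve_eq_gauss, glog_eq_powerSum h1]

/-- As `Z = μ_A * e^{-f}` solves `Z' = Δ Z`, its normalization `W = Z / constTerm Z` solves
`W' = Δ W - c W` with a scalar `c`; hence `G = log W` solves the Polchinski equation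
`G' = Δ G + ½ ∑ A'_ij ∂_j G ∂_i G - c`. -/
theorem exists_hasGrassmannDeriv_log {t : ℝ} {A' : ℝ → Matrix I I ℂ}
    (hA' : ∀ i j, IntervalIntegrable (fun s => A' s i j) volume 0 t) {f : Grassmann I}
    (hf : IsEven f)
    (h0 : ∀ s ∈ Set.uIcc 0 t, expectation (cumulative A' s) (gexp (-f)) ≠ 0) :
    ∃ (G : ℝ → Grassmann I) (c : ℝ → ℂ), (∀ s, IsEven (G s)) ∧
      (∀ s ∈ Set.uIcc 0 t, effectiveAction A' f s = -G s) ∧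
      HasGrassmannDeriv t G
        (fun s => quadTerm (A' s) (G s) + lap (A' s) (G s) - algebraMap ℂ _ (c s)) := by
  have hX : IsEven (gexp (-f)) := isEven_applyFun _ hf.neg
  set X := gexp (-f)
  have hA : ∀ i j, HasACDeriv t (fun s => cumulative A' s i j) (fun s => A' s i j) :=
    fun i j => HasACDeriv.integral (hA' i j)
  set Z : ℝ → Grassmann I := fun s => gauss (cumulative A' s) X with hZdef
  set E : ℝ → ℂ := fun s => constTerm (Z s) with hEdef
  set W : ℝ → Grassmann I := fun s => (E s)⁻¹ • Z s with hWdef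
  have hE0 : ∀ s ∈ Set.uIcc 0 t, E s ≠ 0 := fun s hs => by
    have := h0 s hs
    rwa [expectation_eq_constTerm] at this
  have hZ : HasGrassmannDeriv t Z (fun s => lap (A' s) (Z s)) := by
    simpa only [lap_gauss] using HasGrassmannDeriv.gauss_const hA X
  have hE : HasACDeriv t E (fun s => constTerm (lap (A' s) (Z s))) := by
    simpa only [hEdef, constTerm_eq_coeff] using hZ ∅
  let c : ℝ → ℂ := fun s => constTerm (lap (A' s) (Z s)) / E s
  have hW : HasGrassmannDeriv t W (fun s => lap (A' s) (W s) - c s • W s) := by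
    refine (HasGrassmannDeriv.smul (hE.inv hE0) hZ).congr fun s hs => ?_
    have := hE0 s hs
    simp only [hWdef, map_smul, c, smul_smul]
    rw [sub_eq_add_neg, add_comm, ← neg_smul]
    congr 2
    field_simp
  have hWe : ∀ s, IsEven (W s) := fun s => (hX.gauss _).smul _
  have hW1 : ∀ s ∈ Set.uIcc 0 t, constTerm (W s) = 1 := fun s hs => (effectiveAction_eq (h0 s hs)).1
  have hWc : ∀ s ∈ Set.uIcc 0 t, constTerm (lap (A' s) (W s) - c s • W s) = 0 := fun s hs => by
    rw [map_sub, map_smul constTerm (c s), hW1 s hs]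
    simp only [hWdef, map_smul, c, smul_eq_mul]
    ring
  have hY : HasGrassmannDeriv t (fun s => W s - 1) (fun s => lap (A' s) (W s) - c s • W s) := by
    simpa only [sub_eq_add_neg, add_zero] using hW.add (HasGrassmannDeriv.const (-1))
  have hYe : ∀ s, IsEven (W s - 1) := fun s => (hWe s).sub isEven_one
  refine ⟨fun s => powerSum logCoeff (Fintype.card I + 1) (W s - 1), c,
    fun s => (hYe s).powerSum _ _, fun s hs => (effectiveAction_eq (h0 s hs)).2,
    (hY.powerSum hYe logCoeff (Fintype.card I)).congr fun s hs => ?_⟩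
  simp only [succ_mul_logCoeff_succ]
  have h1 := hW1 s hs
  -- both sides agree after multiplication by the unit `W s`, by the Hopf-Cole transformation
  refine (isUnit_of_constTerm_eq_one h1).mul_left_cancel ?_
  rw [mul_powerSum_neg_one h1 (hWc s hs), mul_sub, ← glog_eq_powerSum h1, ← lap_eq_mul (hWe s) h1,
    ← Algebra.commutes, ← Algebra.smul_def]

/-- Convolution does not mix the constant term into the others. -/
theorem gauss_eq_of_coeff_eq {x y : Grassmann I} (h : ∀ J, J ≠ ∅ → coeff J x = coeff J y)
    (A : Matrix I I ℂ) {J : Finset I} (hJ : J ≠ ∅) : coeff J (gauss A x) = coeff J (gauss A y) := by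
  have h1 : x = y + algebraMap ℂ _ (coeff ∅ x - coeff ∅ y) := grassmann_ext fun K => by
    rw [coeff_add, coeff_algebraMap]
    split_ifs with hK
    · rw [hK]; ring
    · rw [h K hK, add_zero]
  rw [h1, map_add, gauss_algebraMap, coeff_add, coeff_algebraMap, if_neg hJ, add_zero]

/-- Duhamel's formula for the effective action. In the derivative of `s ↦ μ_{A(t) - A(s)} * F(s)` the
Laplacian of `F` cancels; the scalar term of the
flow equation does not contribute to coefficients with `J ≠ ∅`. -/
theorem effectiveAction_duhamel {t : ℝ} {A' : ℝ → Matrix I I ℂ}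
    (hA' : ∀ i j, IntervalIntegrable (fun s => A' s i j) volume 0 t) {f : Grassmann I}
    (hf : IsEven f)
    (h0 : ∀ s ∈ Set.uIcc 0 t, expectation (cumulative A' s) (gexp (-f)) ≠ 0) :
    (∀ s ∈ Set.uIcc 0 t, IsEven (effectiveAction A' f s)) ∧
    (∀ J, ContinuousOn (fun s => coeff J (effectiveAction A' f s)) (Set.uIcc 0 t)) ∧
    ∀ J, J ≠ ∅ →
      IntervalIntegrable (fun s => coeff J (gauss (cumulative A' t - cumulative A' s)
        (quadTerm (A' s) (effectiveAction A' f s)))) volume 0 t ∧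
      coeff J (effectiveAction A' f t) = coeff J (gauss (cumulative A' t) f) -
        ∫ s in (0 : ℝ)..t, coeff J (gauss (cumulative A' t - cumulative A' s)
          (quadTerm (A' s) (effectiveAction A' f s))) := by
  obtain ⟨G, c, hGe, hFG, hG⟩ := exists_hasGrassmannDeriv_log hA' hf h0
  refine ⟨fun s hs => by rw [hFG s hs]; exact (hGe s).neg, fun J => ?_, fun J hJ => ?_⟩
  · refine (hG J).ac.continuousOn.neg.congr fun s hs => ?_
    simp only [hFG s hs, coeff_neg]
    rfl
  have hB : ∀ i j, HasACDeriv t (fun s => (cumulative A' t - cumulative A' s) i j)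
      (fun s => (-A' s) i j) := fun i j => by
    have := (HasACDeriv.const (t := t) (cumulative A' t i j)).add
      ((HasACDeriv.integral (hA' i j)).const_mul (-1))
    convert this using 2
    · rw [Matrix.sub_apply]; simp only [cumulative]; ring
    · rw [Matrix.neg_apply]; ring
  have hH := HasGrassmannDeriv.gauss hB hG J
  have hH' : HasACDeriv t (fun s => coeff J (gauss (cumulative A' t - cumulative A' s) (G s)))
      (fun s => coeff J (gauss (cumulative A' t - cumulative A' s)
        (quadTerm (A' s) (effectiveAction A' f s)))) := by
    refine hH.congr fun s hs => ?_
    beta_reduce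
    rw [lap_neg, hFG s hs, quadTerm_neg,
      show -lap (A' s) (G s) + (quadTerm (A' s) (G s) + lap (A' s) (G s) -
        algebraMap ℂ _ (c s)) = quadTerm (A' s) (G s) - algebraMap ℂ _ (c s) by abel,
      map_sub, gauss_algebraMap, coeff_sub, coeff_algebraMap, if_neg hJ, sub_zero]
  refine ⟨hH'.integrable, ?_⟩
  have h1 := hH'.integral_eq_sub
  have hz : cumulative A' 0 = 0 := by ext i j; simp [cumulative]
  have h2 : coeff J (gauss (cumulative A' t) (effectiveAction A' f 0)) =
      coeff J (gauss (cumulative A' t) f) := by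
    refine gauss_eq_of_coeff_eq (fun K hK => ?_) _ hJ
    rw [effectiveAction, expectation_eq_constTerm, convolve_eq_gauss, hz, gauss_zero]
    exact coeff_glog_gexp hf hK
  rw [hFG 0 Set.left_mem_uIcc, map_neg, coeff_neg] at h2
  rw [h1, hFG t Set.right_mem_uIcc, coeff_neg, hz, sub_zero, sub_self, gauss_zero, ← h2]
  ring

end Flow

/-! ### Integrability and the bound on the norm coefficients -/

section Bound

open MeasureTheory

theorem abs_iSup_le_sum {ι : Type*} [Fintype ι] (g : ι → ℝ) : |⨆ i, g i| ≤ ∑ i, |g i| := by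
  rcases isEmpty_or_nonempty ι with h | h
  · simp
  · obtain ⟨i, hi⟩ := exists_eq_ciSup_of_finite (f := g)
    rw [← hi]
    exact Finset.single_le_sum (f := fun i => |g i|) (fun _ _ => abs_nonneg _) (Finset.mem_univ i)

theorem intervalIntegrable_iSup {ι : Type*} [Fintype ι] {g : ι → ℝ → ℝ} {a b : ℝ}
    (hg : ∀ i, IntervalIntegrable (g i) volume a b) :
    IntervalIntegrable (fun s => ⨆ i, g i s) volume a b := by
  have h : ∀ c d, (∀ i, IntegrableOn (g i) (Set.Ioc c d) volume) →
      IntegrableOn (fun s => ⨆ i, g i s) (Set.Ioc c d) volume := fun c d h1 => by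
    refine (integrable_finsetSum Finset.univ fun i _ => (h1 i).abs).mono'
      (AEMeasurable.iSup fun i => (h1 i).aemeasurable).aestronglyMeasurable
      (Filter.Eventually.of_forall fun s => ?_)
    rw [Real.norm_eq_abs]
    exact abs_iSup_le_sum fun i => g i s
  exact ⟨h a b fun i => (hg i).1, h b a fun i => (hg i).2⟩

theorem continuousOn_iSup {ι : Type*} [Fintype ι] {g : ι → ℝ → ℝ} {S : Set ℝ}
    (hg : ∀ i, ContinuousOn (g i) S) : ContinuousOn (fun s => ⨆ i, g i s) S := by
  rcases isEmpty_or_nonempty ι with h | h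
  · simp only [Real.iSup_of_isEmpty]
    exact continuousOn_const
  · simp only [← Finset.sup'_univ_eq_ciSup]
    exact ContinuousOn.finset_sup'_apply _ fun i _ => hg i

theorem continuous_gam (k l m : ℕ) : Continuous (Gam k l m) := by
  unfold Gam
  fun_prop

variable {I : Type} [Fintype I] [LinearOrder I]

theorem continuousOn_normCoeff {F : ℝ → Grassmann I} {S : Set ℝ}
    (hF : ∀ J, ContinuousOn (fun s => coeff J (F s)) S) (m : ℕ) :
    ContinuousOn (fun s => normCoeff m (F s)) S :=
  continuousOn_iSup fun _ => continuousOn_const.mul (continuousOn_finsetSum _ fun J _ => (hF J).norm)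

/-- The bound for a flow whose partial covariances `A(t) - A(s)` satisfy Gram-type bounds with
constants `ξ s`. -/
theorem normCoeff_effectiveAction_le {n : ℕ} (hcard : Fintype.card I = 2 * n) {t : ℝ} (ht : 0 ≤ t)
    {A' : ℝ → Matrix I I ℂ} (hA' : ∀ i j, IntervalIntegrable (fun s => A' s i j) volume 0 t)
    (hskew : ∀ s ∈ Set.Icc 0 t, ∀ i j, A' s j i = -A' s i j) {f : Grassmann I} (hf : IsEven f)
    (h0 : ∀ s ∈ Set.Icc 0 t, expectation (cumulative A' s) (gexp (-f)) ≠ 0)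
    {ξ : ℝ → ℝ} (hξ0 : ∀ s, 0 ≤ ξ s) (hξ : ContinuousOn ξ (Set.Icc 0 t))
    (hlin : ∀ (M : Finset I) (r : ℕ), M.card = 2 * r →
      ‖constTerm (gauss (cumulative A' t) (monomial M))‖ ≤ ξ 0 ^ (2 * r))
    (hquad : ∀ s ∈ Set.Icc 0 t, ∀ (N r : ℕ) (V : Finset I), V.card + 1 = 2 * N →
      ∑ M ∈ V.powersetCard (2 * r),
        ‖constTerm (gauss (cumulative A' t - cumulative A' s) (monomial M))‖ ≤
          ((N - 1).choose r * N.choose r : ℝ) * (ξ s ^ 2 / 2) ^ r) {k : ℕ} (hk : 1 ≤ k) :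
    IntervalIntegrable
        (fun s => normOneInf (A' s) *
          ∑ p ∈ Finset.Icc 1 n ×ˢ Finset.Icc 1 n with k + 1 ≤ p.1 + p.2,
            normCoeff p.1 (effectiveAction A' f s) * normCoeff p.2 (effectiveAction A' f s) *
              Gam k p.1 p.2 (ξ s)) volume 0 t ∧
      normCoeff k (effectiveAction A' f t) ≤
        ∑ m ∈ Finset.Icc k n,
            normCoeff m f * ((2 * m).choose (2 * k) : ℝ) * ξ 0 ^ (2 * (m - k)) +
          (1 / 2) * ∫ s in (0 : ℝ)..t, normOneInf (A' s) *
            ∑ p ∈ Finset.Icc 1 n ×ˢ Finset.Icc 1 n with k + 1 ≤ p.1 + p.2,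
              normCoeff p.1 (effectiveAction A' f s) * normCoeff p.2 (effectiveAction A' f s) *
                Gam k p.1 p.2 (ξ s) := by
  have hu : Set.uIcc 0 t = Set.Icc 0 t := Set.uIcc_of_le ht
  obtain ⟨hFe, hFc, hFd⟩ := effectiveAction_duhamel hA' hf (by rwa [hu])
  have hInt : IntervalIntegrable
        (fun s => normOneInf (A' s) *
          ∑ p ∈ Finset.Icc 1 n ×ˢ Finset.Icc 1 n with k + 1 ≤ p.1 + p.2,
            normCoeff p.1 (effectiveAction A' f s) * normCoeff p.2 (effectiveAction A' f s) *
              Gam k p.1 p.2 (ξ s)) volume 0 t := by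
    refine IntervalIntegrable.mul_continuousOn ?_ (continuousOn_finsetSum _ fun p _ =>
      ((continuousOn_normCoeff hFc p.1).mul (continuousOn_normCoeff hFc p.2)).mul
        ((continuous_gam k p.1 p.2).comp_continuousOn (by rwa [hu])))
    refine intervalIntegrable_iSup fun i => ?_
    have := IntervalIntegrable.sum Finset.univ fun j _ => (hA' i j).norm
    simpa only [Finset.sum_fn] using this
  refine ⟨hInt, ?_⟩
  set Q : ℝ → ℝ := fun s => normOneInf (A' s) *
          ∑ p ∈ Finset.Icc 1 n ×ˢ Finset.Icc 1 n with k + 1 ≤ p.1 + p.2,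
            normCoeff p.1 (effectiveAction A' f s) * normCoeff p.2 (effectiveAction A' f s) *
              Gam k p.1 p.2 (ξ s) with hQ
  have hGam0 : ∀ l m (y : ℝ), 0 ≤ y → 0 ≤ Gam k l m y := fun l m y hy =>
    mul_nonneg (by positivity) (Finset.sum_nonneg fun p _ => by positivity)
  have hQ0 : ∀ s, 0 ≤ Q s := fun s => by
    refine mul_nonneg (Real.iSup_nonneg fun i => Finset.sum_nonneg fun j _ => norm_nonneg _)
      (Finset.sum_nonneg fun p _ => mul_nonneg (mul_nonneg (normCoeff_nonneg _ _)
        (normCoeff_nonneg _ _)) (hGam0 _ _ _ (hξ0 s)))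
  refine normCoeff_le ?_ fun x => ?_
  · refine add_nonneg (Finset.sum_nonneg fun m _ => mul_nonneg (mul_nonneg (normCoeff_nonneg _ _)
      (Nat.cast_nonneg _)) (pow_nonneg (hξ0 0) _)) (mul_nonneg (by norm_num) ?_)
    exact intervalIntegral.integral_nonneg ht fun s _ => hQ0 s
  let q : Finset I → ℝ → ℂ := fun J s => coeff J (gauss (cumulative A' t - cumulative A' s)
        (quadTerm (A' s) (effectiveAction A' f s)))
  have hk0 : (0 : ℝ) ≤ 1 / (2 * k) := by positivity
  have hne : ∀ J ∈ (Finset.univ : Finset (Finset I)).filter (fun J => x ∈ J ∧ J.card = 2 * k),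
      J ≠ ∅ := fun J hJ => Finset.ne_empty_of_mem (Finset.mem_filter.mp hJ).2.1
  have hqi : IntervalIntegrable (fun s => (1 / (2 * (k : ℝ))) *
      ∑ J : Finset I with x ∈ J ∧ J.card = 2 * k, ‖q J s‖) volume 0 t := by
    have := (IntervalIntegrable.sum _ fun J hJ => (hFd J (hne J hJ)).1.norm).const_mul
      (1 / (2 * (k : ℝ)))
    simpa only [Finset.sum_apply] using this
  calc _ ≤ (1 / (2 * (k : ℝ))) * (∑ J : Finset I with x ∈ J ∧ J.card = 2 * k,
            ‖coeff J (gauss (cumulative A' t) f)‖ +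
          ∑ J : Finset I with x ∈ J ∧ J.card = 2 * k, ∫ s in (0 : ℝ)..t, ‖q J s‖) := by
        refine mul_le_mul_of_nonneg_left ?_ hk0
        rw [← Finset.sum_add_distrib]
        refine Finset.sum_le_sum fun J hJ => ?_
        rw [(hFd J (hne J hJ)).2]
        exact (norm_sub_le _ _).trans (add_le_add le_rfl
          (intervalIntegral.norm_integral_le_integral_norm ht))
    _ = (1 / (2 * (k : ℝ))) * ∑ J : Finset I with x ∈ J ∧ J.card = 2 * k,
            ‖coeff J (gauss (cumulative A' t) f)‖ +
          ∫ s in (0 : ℝ)..t, (1 / (2 * (k : ℝ))) *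
            ∑ J : Finset I with x ∈ J ∧ J.card = 2 * k, ‖q J s‖ := by
        rw [mul_add, intervalIntegral.integral_const_mul,
          intervalIntegral.integral_finsetSum fun J hJ => (hFd J (hne J hJ)).1.norm]
    _ ≤ _ := by
        refine add_le_add (normCoeff_gauss_le hcard (hξ0 0) hlin hf hk x) ?_
        rw [← intervalIntegral.integral_const_mul]
        refine intervalIntegral.integral_mono_on ht hqi (hInt.const_mul _) fun s hs => ?_
        exact sum_norm_coeff_gauss_quadTerm_le hcard (hξ0 s) (hquad s hs) (hskew s hs)
          (hFe s (by rwa [hu])) hk x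

end Bound

/-! ### The integrated block covariance -/

section Covariance

open MeasureTheory

variable {n : ℕ}

/-- The entrywise integral of a matrix-valued function. -/
def integralMatrix {ι : Type*} (C : ℝ → Matrix ι ι ℂ) (s t : ℝ) : Matrix ι ι ℂ :=
  fun i j => ∫ τ in s..t, C τ i j

theorem posSemidef_integralMatrix {C : ℝ → Matrix (Fin n) (Fin n) ℂ} {s t : ℝ} (hst : s ≤ t)
    (hC : ∀ τ ∈ Set.Icc s t, (C τ).PosSemidef)
    (hint : ∀ i j, IntervalIntegrable (fun τ => C τ i j) volume s t) :
    (integralMatrix C s t).PosSemidef := by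
  refine Matrix.PosSemidef.of_dotProduct_mulVec_nonneg ?_ fun x => ?_
  · ext i j
    rw [Matrix.conjTranspose_apply]
    simp only [integralMatrix, Complex.star_def]
    rw [← intervalIntegral.intervalIntegral_conj]
    refine intervalIntegral.integral_congr fun τ hτ => ?_
    exact (hC τ (Set.uIcc_of_le hst ▸ hτ)).isHermitian.apply i j
  · have h1 : star x ⬝ᵥ (integralMatrix C s t).mulVec x =
        ∫ τ in s..t, star x ⬝ᵥ (C τ).mulVec x := by
      simp only [dotProduct, Matrix.mulVec, integralMatrix]
      rw [intervalIntegral.integral_finsetSum]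
      · refine Finset.sum_congr rfl fun i _ => ?_
        rw [intervalIntegral.integral_const_mul, intervalIntegral.integral_finsetSum]
        · congr 1
          exact Finset.sum_congr rfl fun j _ => (intervalIntegral.integral_mul_const _ _).symm
        · exact fun j _ => (hint i j).mul_const _
      · intro i _
        refine IntervalIntegrable.const_mul ?_ _
        simpa only [Finset.sum_fn] using
          IntervalIntegrable.sum Finset.univ fun j _ => (hint i j).mul_const (x j)
    have h2 : ∫ τ in s..t, star x ⬝ᵥ (C τ).mulVec x =
        ∫ τ in s..t, (((star x ⬝ᵥ (C τ).mulVec x).re : ℝ) : ℂ) := by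
      refine intervalIntegral.integral_congr fun τ hτ => ?_
      have := (hC τ (Set.uIcc_of_le hst ▸ hτ)).dotProduct_mulVec_nonneg x
      exact Complex.ext (by simp) (by simpa using (Complex.le_def.mp this).2.symm)
    rw [h1, h2, intervalIntegral.integral_ofReal, Complex.zero_le_real]
    refine intervalIntegral.integral_nonneg hst fun τ hτ => ?_
    exact (Complex.le_def.mp ((hC τ hτ).dotProduct_mulVec_nonneg x)).1

theorem intervalIntegrable_blockCov {C : ℝ → Matrix (Fin n) (Fin n) ℂ} {s t : ℝ}
    (hint : ∀ i j, IntervalIntegrable (fun τ => C τ i j) volume s t) (i j : Index n) :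
    IntervalIntegrable (fun τ => blockCov (C τ) i j) volume s t := by
  rcases hi : ofLex i with a | a <;> rcases hj : ofLex j with b | b
  · simp [blockCov, hi, hj]
  · simpa [blockCov, hi, hj] using hint a b
  · simpa [blockCov, hi, hj, Function.comp_def, Pi.neg_def] using (hint a b).neg
  · simp [blockCov, hi, hj]

theorem integral_blockCov (C : ℝ → Matrix (Fin n) (Fin n) ℂ) (s t : ℝ) :
    integralMatrix (fun τ => blockCov (C τ)) s t = blockCov (integralMatrix C s t) := by
  ext i j
  rcases hi : ofLex i with a | a <;> rcases hj : ofLex j with b | b <;>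
    simp [integralMatrix, blockCov, hi, hj]

/-- The constants of the Gram bound for the covariance accumulated between `s` and `t`. -/
theorem norm_constTerm_gauss_sub_le {T : ℝ} {Cp Cm : ℝ → Matrix (Fin n) (Fin n) ℂ}
    (hCp : ∀ τ ∈ Set.Icc 0 T, (Cp τ).PosSemidef)
    (hCm : ∀ τ ∈ Set.Icc 0 T, (Cm τ).PosSemidef)
    (hsymm : ∀ τ ∈ Set.Icc 0 T, (Cp τ - Cm τ).IsSymm)
    (hCp_int : ∀ i j, IntervalIntegrable (fun τ => Cp τ i j) volume 0 T)
    (hCm_int : ∀ i j, IntervalIntegrable (fun τ => Cm τ i j) volume 0 T)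
    {Adot : ℝ → Matrix (Index n) (Index n) ℂ} (hAdot : ∀ τ, Adot τ = blockCov (Cp τ - Cm τ))
    {s t : ℝ} (hs : 0 ≤ s) (hst : s ≤ t) (ht : t ≤ T) (J K : Finset (Fin n)) :
    ‖constTerm (gauss (cumulative Adot t - cumulative Adot s) (monomial (pairIndex J K)))‖ ≤
      if J.card = K.card then (sigma Cp Cm s t ^ 2 / 2) ^ J.card else 0 := by
  have hsub : ∀ a b, 0 ≤ a → a ≤ b → b ≤ T → Set.uIcc a b ⊆ Set.uIcc 0 T := fun a b ha hab hb => by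
    rw [Set.uIcc_of_le hab, Set.uIcc_of_le (ha.trans (hab.trans hb))]
    exact Set.Icc_subset_Icc ha hb
  have hsubI : Set.Icc s t ⊆ Set.Icc 0 T := Set.Icc_subset_Icc hs ht
  have hp := fun i j => (hCp_int i j).mono_set (hsub s t hs hst ht)
  have hm := fun i j => (hCm_int i j).mono_set (hsub s t hs hst ht)
  have hD : ∀ a b, 0 ≤ a → a ≤ b → b ≤ T → ∀ i j,
      IntervalIntegrable (fun τ => Adot τ i j) volume a b := fun a b ha hab hb i j => by
    simp only [hAdot]
    exact intervalIntegrable_blockCov (fun i j => ((hCp_int i j).sub (hCm_int i j)).mono_set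
      (hsub a b ha hab hb)) i j
  have h1 : cumulative Adot t - cumulative Adot s =
      blockCov (integralMatrix Cp s t - integralMatrix Cm s t) := by
    have h2 : integralMatrix Cp s t - integralMatrix Cm s t =
        integralMatrix (fun τ => Cp τ - Cm τ) s t := by
      ext i j
      exact (intervalIntegral.integral_sub (hp i j) (hm i j)).symm
    rw [h2, ← integral_blockCov]
    ext i j
    simp only [← hAdot]
    exact intervalIntegral.integral_interval_sub_left (hD 0 t le_rfl (hs.trans hst) ht i j)
      (hD 0 s le_rfl hs (hst.trans ht) i j)
  have hre : ∀ {C : ℝ → Matrix (Fin n) (Fin n) ℂ} i, IntervalIntegrable (fun τ => C τ i i) volume s t →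
      IntervalIntegrable (fun τ => (C τ i i).re) volume s t ∧
        (integralMatrix C s t i i).re = ∫ τ in s..t, (C τ i i).re := fun i h =>
    ⟨⟨h.1.re, h.2.re⟩, (Complex.reCLM.intervalIntegral_comp_comm h).symm⟩
  have hmax : IntervalIntegrable (fun τ => ⨆ i : Fin n, max (Cp τ i i).re (Cm τ i i).re)
      volume s t := intervalIntegrable_iSup fun i =>
    ⟨(hre i (hp i i)).1.1.sup (hre i (hm i i)).1.1, (hre i (hp i i)).1.2.sup (hre i (hm i i)).1.2⟩
  have hle : ∀ τ (i : Fin n), max (Cp τ i i).re (Cm τ i i).re ≤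
      ⨆ i : Fin n, max (Cp τ i i).re (Cm τ i i).re := fun τ i =>
    le_ciSup (f := fun i : Fin n => max (Cp τ i i).re (Cm τ i i).re) (Set.finite_range _).bddAbove i
  -- the integrand is nonnegative on `[s, t]`, so the square root in `sigma` is undone
  have hσ : sigma Cp Cm s t ^ 2 =
      4 * ∫ τ in s..t, ⨆ i : Fin n, max (Cp τ i i).re (Cm τ i i).re := by
    rw [sigma, Real.sq_sqrt, intervalIntegral.integral_const_mul]
    refine intervalIntegral.integral_nonneg hst fun τ hτ => mul_nonneg (by norm_num)
      (Real.iSup_nonneg fun i => le_max_of_le_left ?_)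
    exact (Complex.le_def.mp (hCp τ (hsubI hτ)).diag_nonneg).1
  -- the constant `κ = σ² / 4` bounds both diagonals, and `2 κ = σ² / 2`
  have hκ : ∀ {C : ℝ → Matrix (Fin n) (Fin n) ℂ} i, IntervalIntegrable (fun τ => C τ i i) volume s t →
      (∀ τ, (C τ i i).re ≤ max (Cp τ i i).re (Cm τ i i).re) →
      (integralMatrix C s t i i).re ≤ sigma Cp Cm s t ^ 2 / 4 := fun i h hC => by
    rw [(hre i h).2, hσ, mul_div_cancel_left₀ _ (by norm_num)]
    exact intervalIntegral.integral_mono_on hst (hre i h).1 hmax fun τ _ => (hC τ).trans (hle τ i)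
  have hsy : (integralMatrix Cp s t - integralMatrix Cm s t).IsSymm := by
    ext i j
    rw [Matrix.transpose_apply]
    simp only [Matrix.sub_apply, integralMatrix]
    rw [← intervalIntegral.integral_sub (hp i j) (hm i j),
      ← intervalIntegral.integral_sub (hp j i) (hm j i)]
    exact intervalIntegral.integral_congr fun τ hτ =>
      (hsymm τ (hsubI (Set.uIcc_of_le hst ▸ hτ))).apply i j
  have h3 := norm_constTerm_gauss_pairIndex_le
    (posSemidef_integralMatrix hst (fun τ hτ => hCp τ (hsubI hτ)) hp)
    (posSemidef_integralMatrix hst (fun τ hτ => hCm τ (hsubI hτ)) hm) hsy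
    (fun i => hκ i (hp i i) fun τ => le_max_left _ _)
    (fun i => hκ i (hm i i) fun τ => le_max_right _ _) J K
  rw [h1]
  rwa [show 2 * (sigma Cp Cm s t ^ 2 / 4) = sigma Cp Cm s t ^ 2 / 2 by ring] at h3

theorem continuousOn_sigma {T : ℝ} {Cp Cm : ℝ → Matrix (Fin n) (Fin n) ℂ}
    (hCp_int : ∀ i j, IntervalIntegrable (fun τ => Cp τ i j) volume 0 T)
    (hCm_int : ∀ i j, IntervalIntegrable (fun τ => Cm τ i j) volume 0 T)
    {t : ℝ} (h0t : 0 ≤ t) (ht : t ≤ T) :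
    ContinuousOn (fun s => sigma Cp Cm s t) (Set.Icc 0 t) := by
  have hsub : Set.uIcc 0 t ⊆ Set.uIcc 0 T := by
    rw [Set.uIcc_of_le h0t, Set.uIcc_of_le (h0t.trans ht)]
    exact Set.Icc_subset_Icc le_rfl ht
  have hre : ∀ {C : ℝ → Matrix (Fin n) (Fin n) ℂ},
      (∀ i j, IntervalIntegrable (fun τ => C τ i j) volume 0 T) → ∀ i,
      IntervalIntegrable (fun τ => (C τ i i).re) volume 0 t := fun h i =>
    ⟨((h i i).mono_set hsub).1.re, ((h i i).mono_set hsub).2.re⟩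
  have hmax : IntervalIntegrable (fun τ => ⨆ i : Fin n, max (Cp τ i i).re (Cm τ i i).re)
      volume 0 t := intervalIntegrable_iSup fun i =>
    ⟨(hre hCp_int i).1.sup (hre hCm_int i).1, (hre hCp_int i).2.sup (hre hCm_int i).2⟩
  rw [← Set.uIcc_of_le h0t]
  refine Real.continuous_sqrt.comp_continuousOn ?_
  have h1 := intervalIntegral.continuousOn_primitive_interval' (hmax.const_mul 4)
    (Set.right_mem_uIcc (a := (0 : ℝ)) (b := t))
  exact h1.neg.congr fun s _ => intervalIntegral.integral_symm _ _

end Covariance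

end GrassmannRG

end

theorem mainTheorem2 (n : ℕ) (T : ℝ) (Cp Cm : ℝ → Matrix (Fin n) (Fin n) ℂ)
    (hCp : ∀ τ ∈ Set.Icc 0 T, (Cp τ).PosSemidef)
    (hCm : ∀ τ ∈ Set.Icc 0 T, (Cm τ).PosSemidef)
    (hsymm : ∀ τ ∈ Set.Icc 0 T, (Cp τ - Cm τ).IsSymm)
    (hCp_int : ∀ i j, IntervalIntegrable (fun τ => Cp τ i j) MeasureTheory.volume 0 T)
    (hCm_int : ∀ i j, IntervalIntegrable (fun τ => Cm τ i j) MeasureTheory.volume 0 T)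
    (Adot : ℝ → Matrix (Index n) (Index n) ℂ)
    (hAdot : ∀ τ, Adot τ = blockCov (Cp τ - Cm τ))
    (f : Grassmann (Index n)) (hf : IsEven f)
    (hZ : ∀ s ∈ Set.Icc 0 T, expectation (cumulative Adot s) (gexp (-f)) ≠ 0)
    (F : ℝ → ℕ → ℝ) (hF : ∀ s m, F s m = normCoeff m (effectiveAction Adot f s))
    (t : ℝ) (ht : t ∈ Set.Icc 0 T) (k : ℕ) (hk : 1 ≤ k) :
    IntervalIntegrable
        (fun s => normOneInf (Adot s) *
          ∑ p ∈ Finset.Icc 1 n ×ˢ Finset.Icc 1 n with k + 1 ≤ p.1 + p.2,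
            F s p.1 * F s p.2 * Gam k p.1 p.2 (sigma Cp Cm s t))
        MeasureTheory.volume 0 t ∧
      F t k ≤
        ∑ m ∈ Finset.Icc k n,
            normCoeff m f * ((2 * m).choose (2 * k) : ℝ) * sigma Cp Cm 0 t ^ (2 * (m - k)) +
          (1 / 2) * ∫ s in (0 : ℝ)..t, normOneInf (Adot s) *
            ∑ p ∈ Finset.Icc 1 n ×ˢ Finset.Icc 1 n with k + 1 ≤ p.1 + p.2,
              F s p.1 * F s p.2 * Gam k p.1 p.2 (sigma Cp Cm s t) := by
  have htT : Set.Icc 0 t ⊆ Set.Icc 0 T := Set.Icc_subset_Icc le_rfl ht.2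
  have hgram := fun s (hs : s ∈ Set.Icc 0 t) =>
    norm_constTerm_gauss_sub_le hCp hCm hsymm hCp_int hCm_int hAdot hs.1 hs.2 ht.2
  have hA : ∀ i j, IntervalIntegrable (fun s => Adot s i j) MeasureTheory.volume 0 t := by
    intro i j
    simp only [hAdot]
    refine intervalIntegrable_blockCov (fun i j => ((hCp_int i j).sub (hCm_int i j)).mono_set ?_) i j
    rwa [Set.uIcc_of_le ht.1, Set.uIcc_of_le (ht.1.trans ht.2)]
  have hz : cumulative Adot 0 = 0 := by ext i j; simp [cumulative]
  simp only [hF]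
  refine normCoeff_effectiveAction_le (by simp [Index, two_mul]) ht.1 hA ?_ hf
    (fun s hs => hZ s (htT hs)) (ξ := fun s => sigma Cp Cm s t) (fun s => Real.sqrt_nonneg _)
    (continuousOn_sigma hCp_int hCm_int ht.1 ht.2) ?_ ?_ hk
  · intro s hs i j
    rw [hAdot]
    exact blockCov_skew (hsymm s (htT hs)) i j
  · intro M r hM
    have h1 := hgram 0 ⟨le_rfl, ht.1⟩ (leftPart M) (rightPart M)
    rw [pairIndex_leftPart_rightPart, hz, sub_zero] at h1
    have h2 := card_leftPart_add_card_rightPart M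
    refine h1.trans ?_
    split_ifs with h3
    · rw [show (leftPart M).card = r by omega, pow_mul]
      exact pow_le_pow_left₀ (by positivity) (half_le_self (by positivity)) r
    · exact pow_nonneg (Real.sqrt_nonneg _) _
  · intro s hs N r V hV
    exact sum_powersetCard_le (φ := fun M =>
      ‖constTerm (gauss (cumulative Adot t - cumulative Adot s) (monomial M))‖)
      (by positivity) (hgram s hs) hV r
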